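/- Let $\mathbb{F}_q$ be a finite field of odd characteristic $p$, let $K=\mathbb{F}_q(t)$, let $d\ge 2$ be an integer prime to $q$, and let $E_d/K$ be the Legendre elliptic curve $y^2=x(x+1)(x+t^d)$. The Hasse–Weil $L$-function $L(E_d/K,T)\in\mathbb{Z}[[T]]$ is the formal Euler product over all places $v$ of $K$ of the factors $(1-a_vT^{\deg v}+q^{\deg v}T^{2\deg v})^{-1}$ if $E_d$ has good reduction at $v$ (with $a_v=q^{\deg v}+1-|\tilde E_{d,v}(\mathbb{F}_v)|$, $\tilde E_{d,v}$ being the reduction of a minimal model over the residue field $\mathbb{F}_v$) and $(1-a_vT^{\deg v})^{-1}$ if $E_d$ has bad reduction at $v$ (with $a_v=1,-1,0$ if the reduction is split multiplicative, nonsplit multiplicative, additive, respectively). Let $Z_d=\mathbb{Z}/d\mathbb{Z}\smallsetminus\{0,d/2\}$ if $d$ is even and $Z_d=\mathbb{Z}/d\mathbb{Z}\smallsetminus\{0\}$ if $d$ is odd. For $Z\subset \mathbb{Z}/d\mathbb{Z}$ stable under multiplication by $q$, let $\mathcal{O}_q(Z)$ be the set of orbits of $Z$ under multiplication by $q$; the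 orbit of $m$ is denoted by $\mathbf{m}$ and its cardinality by $|\mathbf{m}|$. Let $\bar{\mathbb{Q}}$ be an algebraic closure of $\mathbb{Q}$, $\bar{\mathbb{Z}}$ its ring of algebraic integers, and $\mathfrak{P}$ a prime ideal of $\bar{\mathbb{Z}}$ above $p$; the finite fields of characteristic $p$ are viewed as subfields of the algebraic closure $\bar{\mathbb{Z}}/\mathfrak{P}$ of $\mathbb{F}_p$. Let $\mathbf{t}:(\bar{\mathbb{Z}}/\mathfrak{P})^\times\to\bar{\mathbb{Q}}^\times$ be the inverse of the isomorphism given by reduction modulo $\mathfrak{P}$ from the group of roots of unity of order prime to $p$ to $(\bar{\mathbb{Z}}/\mathfrak{P})^\times$. For $m\in Z_d$ put $$J(m)=\sum_{x\in\mathbb{F}_{q^{|\mathbf{m}|}}}\mathbf{t}_m(x)\,\lambda(1-x),\qquad \mathbf{t}_m(x)=\mathbf{t}(x)^{(q^{|\mathbf{m}|}-1)m/d}\ (x\ne0),\quad \mathbf{t}_m(0)=0,$$ where $\lambda$ is the nontrivial quadratic character of $\mathbb{F}_{q^{|\mathbf{m}|}}^\times$, extended by $\lambda(0)=0$. Let $V_d=\{m\in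 Z_d: J(m)^2=q^{|\mathbf{m}|}\}$ and $S_d=Z_d\smallsetminus V_d$. Then the Euler product $L(E_d/K,T)$ is a polynomial in $T$ with integer coefficients, and the special value $$L^*(E_d/K,1):=\left.\frac{L(E_d/K,T)}{(1-qT)^{\rho}}\right|_{T=q^{-1}},\qquad \rho=\operatorname{ord}_{T=q^{-1}}L(E_d/K,T),$$ satisfies $$L^*(E_d/K,1)=\prod_{\mathbf{m}\in\mathcal{O}_q(V_d)}|\mathbf{m}|\cdot\prod_{\mathbf{m}\in\mathcal{O}_q(S_d)}\left(1-\frac{J(\mathbf{m})^2}{q^{|\mathbf{m}|}}\right),$$ where $J(\mathbf{m})=J(m)$ for any choice of representative $m\in\mathbf{m}$. -/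

import Mathlib

open scoped Polynomial PowerSeries

noncomputable section

namespace LegendreLValue

/-! ### The special value of the `L`-function of an elliptic curve over `K = 𝔽_q(t)` -/

/-- The places of a one-variable function field `K` over a finite field, as the discrete valuation
rings of `K` with fraction field `K`. For `K = 𝔽_q(t)` these are the local rings at the monic
irreducible polynomials of `𝔽_q[t]` and the local ring at infinity. -/
def Place (K : Type*) [Field K] : Type _ :=
  {v : ValuationSubring K // IsDiscreteValuationRing v}

instance {K : Type*} [Field K] (v : Place K) : IsDiscreteValuationRing v.1 := v.2

/-- The degree of a place of a function field over `𝔽_q`: the residue field has `q ^ deg v`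
elements. -/
def Place.deg {K : Type*} [Field K] (q : ℕ) (v : Place K) : ℕ :=
  Nat.log q (Nat.card (IsLocalRing.ResidueField v.1))

/-- The Euler factor at `v` of the `L`-function of `W / K`, as a formal power series in `T`. It is
`P_v(T ^ deg v)⁻¹`, where `P_v` is `1 - a_v T + q_v T²` at a place of good reduction, `1 - T` (resp.
`1 + T`, resp. `1`) at a place of split multiplicative (resp. nonsplit multiplicative, resp.
additive) reduction. -/
def eulerFactor {K : Type*} [Field K] (q : ℕ) (W : WeierstrassCurve K) (v : Place K) : ℤ⟦X⟧ :=
  PowerSeries.invOfUnit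
    (Polynomial.toPowerSeries (Polynomial.expand ℤ (v.deg q) (W.localPolynomial v.1))) 1

open scoped PowerSeries.WithPiTopology in
/-- The formal Euler product of `W / K` over all places of `K` converges (coefficientwise) to the
formal power series `L`, that is to say, `L = L(W/K, T)`. -/
def HasLFunction {K : Type*} [Field K] (q : ℕ) (W : WeierstrassCurve K) (L : ℤ⟦X⟧) : Prop :=
  HasProd (fun v : Place K => eulerFactor q W v) L

/-- The special value at `T = q⁻¹` of a polynomial `L(T)`: the value at `T = q⁻¹` of
`L(T) / (1 - q T) ^ ρ`, where `ρ` is the order of vanishing of `L` at `T = q⁻¹`. -/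
def specialValue (q : ℕ) (L : ℤ[X]) : ℚ :=
  let P : ℚ[X] := L.map (Int.castRingHom ℚ)
  let ρ : ℕ := P.rootMultiplicity (q : ℚ)⁻¹
  (P / (1 - Polynomial.C (q : ℚ) * Polynomial.X) ^ ρ).eval (q : ℚ)⁻¹

/-- The Legendre curve `E_d : y² = x (x + 1) (x + t ^ d)` over `F(t)`, with the right-hand side
expanded. -/
def legendreCurve (F : Type*) [Field F] (d : ℕ) : WeierstrassCurve (RatFunc F) where
  a₁ := 0
  a₂ := 1 + RatFunc.X ^ d
  a₃ := 0
  a₄ := RatFunc.X ^ d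
  a₆ := 0

/-! ### The action of `q` on `ℤ/dℤ` -/

open Classical in
/-- `ℤ/dℤ ∖ {0, d/2}` if `d` is even, `ℤ/dℤ ∖ {0}` if `d` is odd. -/
def Z (d : ℕ) [NeZero d] : Finset (ZMod d) :=
  Finset.univ.filter fun m => m ≠ 0 ∧ ¬ (Even d ∧ m = ((d / 2 : ℕ) : ZMod d))

open Classical in
/-- The orbit `{m, q m, q² m, …}` of `m` under multiplication by `q`. -/
def orbit (q : ℕ) {d : ℕ} [NeZero d] (m : ZMod d) : Finset (ZMod d) :=
  Finset.univ.filter fun x => ∃ k : ℕ, x = (q : ZMod d) ^ k * m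

open Classical in
/-- The set of orbits of the elements of a subset `A` of `ℤ/dℤ` under multiplication by `q`. -/
def orbits (q : ℕ) {d : ℕ} [NeZero d] (A : Finset (ZMod d)) : Finset (Finset (ZMod d)) :=
  A.image (orbit q)

/-! ### Jacobi sums

`Ω` is an algebraic closure of `ℚ`, `integralClosure ℤ Ω` its ring of algebraic integers, and `𝔓` a
prime ideal of the latter above `p`. The quotient by `𝔓` is an algebraic closure of `𝔽_p`, in which
the field with `Q` elements is the set of the solutions of `x ^ Q = x`. -/

section Jacobi

variable {Ω : Type*} [Field Ω]

/-- The Teichmüller lift attached to `𝔓`: on nonzero elements of the residue field, the inverse of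
the bijection from the roots of unity of order prime to `p` to the nonzero elements of the residue
field that is given by reduction modulo `𝔓`. It is not used at `0`. (Elements of infinite order have
`orderOf` equal to `0`, which is not prime to `p`.) -/
def teichmuller (p : ℕ) (𝔓 : Ideal (integralClosure ℤ Ω)) (x : integralClosure ℤ Ω ⧸ 𝔓) : Ω :=
  (Function.invFunOn (Ideal.Quotient.mk 𝔓)
    {ζ : integralClosure ℤ Ω | (orderOf ζ).Coprime p} x : integralClosure ℤ Ω)

/-- The field with `Q` elements inside the residue field `k`. -/
def finiteSubfield (k : Type*) [CommRing k] (Q : ℕ) : Set k := {x | x ^ Q = x}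

open Classical in
/-- The quadratic character of the field with `Q` elements, extended by `0` at `0`: it is `1` at
the nonzero squares of that field and `-1` at the non-squares. -/
def quadChar {k : Type*} [CommRing k] (Q : ℕ) (x : k) : Ω :=
  if x = 0 then 0 else if ∃ y ∈ finiteSubfield k Q, y * y = x then 1 else -1

open Classical in
/-- The character `t_m` of the field with `q ^ |𝐦|` elements, where `𝐦` is the orbit of `m`:
`x ↦ t(x) ^ ((q ^ |𝐦| - 1) m / d)` for `x ≠ 0`, where `t` is the Teichmüller lift, extended by
`0` at `0`. The division by `d` is exact for `q` prime to `d`. -/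
def teichmullerChar (p : ℕ) (𝔓 : Ideal (integralClosure ℤ Ω)) (q : ℕ) {d : ℕ} [NeZero d]
    (m : ZMod d) (x : integralClosure ℤ Ω ⧸ 𝔓) : Ω :=
  if x = 0 then 0 else teichmuller p 𝔓 x ^ ((q ^ (orbit q m).card - 1) * m.val / d)

/-- The Jacobi sum `J(m) = ∑ t_m(x) λ(1 - x)`, over the `x` in the field with `q ^ |𝐦|` elements,
where `λ` is the quadratic character of that field. -/
def J (p : ℕ) (𝔓 : Ideal (integralClosure ℤ Ω)) (q : ℕ) {d : ℕ} [NeZero d] (m : ZMod d) : Ω :=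
  ∑ᶠ x ∈ finiteSubfield (integralClosure ℤ Ω ⧸ 𝔓) (q ^ (orbit q m).card),
    teichmullerChar p 𝔓 q m x * quadChar (q ^ (orbit q m).card) (1 - x)

open Classical in
/-- The set of the `m ∈ Z d` with `J(m)² = q ^ |𝐦|`. -/
def V (p : ℕ) (𝔓 : Ideal (integralClosure ℤ Ω)) (q d : ℕ) [NeZero d] : Finset (ZMod d) :=
  (Z d).filter fun m => J p 𝔓 q m ^ 2 = (q : Ω) ^ (orbit q m).card

/-- The complement of `V` in `Z d`. -/
def S (p : ℕ) (𝔓 : Ideal (integralClosure ℤ Ω)) (q d : ℕ) [NeZero d] : Finset (ZMod d) :=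
  Z d \ V p 𝔓 q d

end Jacobi

end LegendreLValue

end

noncomputable section

namespace LegendreLValue

/-! ### Logarithmic derivatives of formal power series -/

section DLog

variable {R : Type*} [CommRing R]

/-! In characteristic zero a power series with constant term 1 is determined by its logarithmic
derivative `T L' / L` (`HasDLog.coeff_eq`), so the Euler product and the product over orbits are
compared through the coefficients of their logarithmic derivatives. Write χ for a quadratic
character and `legSum s` for the sum of χ(x (x + 1) (x + s)). The Euler product has n-th coefficient
[d even] - ∑ `legSum (x ^ d)`, with x in the field of q^n elements (`sum_coeff_eulerSeries`). The
bracket comes from infinity, where the reduction is split multiplicative for d even and additive for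
d odd.

Locally, χ of the product of x (x + 1) (x + s) over the roots x of g is multiplicative in g. Its
generating series over monic polynomials has an Euler product, whose logarithmic derivative collects
the sums over all finite extensions (`hasDLog_monicSum`, `sum_minpoly`). A translation argument
kills the terms of degree at least 3, so the series is a polynomial (`hasDLog_legPoly`), and
`localPolynomial_eq` identifies it with the local polynomial of the curve. The same device applied
to ψ(x) χ(x - 1) yields a linear series, which is the Hasse–Davenport relation (`sum_comp_norm`).

Globally, the solutions of x^d = s are counted by the characters of order dividing d, and the
substitution s = x u gives ∑ ψ(s) `legSum s` = `jacSum ψ ^ 2` (`sum_mul_legSum`). Hence ∑ `legSum (x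
^ d)` is -1 plus a sum of squared Jacobi sums over the m with q^n m = m. The indices 0 and, for d
even, d/2 contribute 1 each, so these terms cancel against -1 and the term at infinity, and only m
in `Z d` remain. By Hasse–Davenport the sum over an orbit o whose size divides n is |o|
J(o)^(2n/|o|), which is minus the coefficient for 1 - J(o)² T^|o|. So L is the product of these
factors (`exists_hasLFunction`).

For o in V the factor is 1 - (qT)^|o| = (1 - qT)(1 + qT + ... + (qT)^(|o|-1)), whose cofactor takes
the value |o| at 1/q. The factors for S do not vanish at 1/q. So ρ is the number of orbits in V, and
the special value can be read off. -/

/-- `s` is the logarithmic derivative `T A' / A` of the power series `A`. -/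
def HasDLog (A s : R⟦X⟧) : Prop :=
  PowerSeries.X * PowerSeries.derivative R A = A * s

lemma coeff_X_mul_derivative (A : R⟦X⟧) (n : ℕ) :
    PowerSeries.coeff n (PowerSeries.X * PowerSeries.derivative R A) =
      n * PowerSeries.coeff n A := by
  cases n with
  | zero => simp
  | succ n =>
    rw [PowerSeries.coeff_succ_X_mul, PowerSeries.coeff_derivative]
    push_cast; ring

lemma hasDLog_iff {A s : R⟦X⟧} : HasDLog A s ↔
    ∀ n : ℕ, n * PowerSeries.coeff n A = PowerSeries.coeff n (A * s) := by
  rw [HasDLog, PowerSeries.ext_iff]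
  simp_rw [coeff_X_mul_derivative]

lemma HasDLog.one : HasDLog (1 : R⟦X⟧) 0 := by
  simp [HasDLog]

lemma HasDLog.mul {A B s t : R⟦X⟧} (hA : HasDLog A s) (hB : HasDLog B t) :
    HasDLog (A * B) (s + t) := by
  unfold HasDLog at *
  rw [Derivation.leibniz, smul_eq_mul, smul_eq_mul]
  linear_combination A * hB + B * hA

lemma HasDLog.prod {ι : Type*} (I : Finset ι) {A s : ι → R⟦X⟧} (h : ∀ i ∈ I, HasDLog (A i) (s i)) :
    HasDLog (∏ i ∈ I, A i) (∑ i ∈ I, s i) := by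
  classical
  induction I using Finset.induction_on with
  | empty => simpa using HasDLog.one
  | insert a I ha ih =>
    rw [Finset.prod_insert ha, Finset.sum_insert ha]
    exact (h a (by simp)).mul (ih fun i hi => h i (by simp [hi]))

lemma HasDLog.of_mul_eq_one {A B s : R⟦X⟧} (hA : HasDLog A s) (h : A * B = 1) :
    HasDLog B (-s) := by
  unfold HasDLog at *
  have h1 := congrArg (PowerSeries.derivative R) h
  rw [Derivation.leibniz, smul_eq_mul, smul_eq_mul, Derivation.map_one_eq_zero] at h1
  linear_combination (-(B * s) - PowerSeries.X * PowerSeries.derivative R B) * h +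
    (PowerSeries.X * B) * h1 - B ^ 2 * hA

lemma HasDLog.map {S : Type*} [CommRing S] (φ : R →+* S) {A s : R⟦X⟧} (h : HasDLog A s) :
    HasDLog (PowerSeries.map φ A) (PowerSeries.map φ s) := by
  rw [hasDLog_iff] at h ⊢
  intro n
  rw [← map_mul, PowerSeries.coeff_map, PowerSeries.coeff_map, ← h n, map_mul, map_natCast]

/-- A coefficient of index k moves to index `m * k`, and `X · d/dX` multiplies by the index; this is
the source of the factor `m`. -/
lemma HasDLog.expand {A s : R⟦X⟧} (h : HasDLog A s) (m : ℕ) (hm : m ≠ 0) :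
    HasDLog (PowerSeries.expand m hm A) (m * PowerSeries.expand m hm s) := by
  rw [hasDLog_iff] at h ⊢
  intro n
  rw [mul_left_comm, ← map_mul, ← map_natCast (PowerSeries.C (R := R)),
    PowerSeries.coeff_C_mul, PowerSeries.coeff_expand, PowerSeries.coeff_expand]
  split_ifs with hmn
  · obtain ⟨k, rfl⟩ := hmn
    rw [Nat.mul_div_cancel_left _ (Nat.pos_of_ne_zero hm), ← h k]
    push_cast; ring
  · simp

lemma hasDLog_one_sub_C_mul_X (c : R) :
    HasDLog (1 - PowerSeries.C c * PowerSeries.X)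
      (-PowerSeries.mk fun n => if n = 0 then 0 else c ^ n) := by
  rw [hasDLog_iff]
  intro n
  rw [mul_neg, sub_mul, one_mul, mul_assoc, map_neg, map_sub, map_sub, PowerSeries.coeff_C_mul,
    PowerSeries.coeff_C_mul]
  rcases n with _ | _ | n
  · simp
  · rw [PowerSeries.coeff_succ_X_mul]
    simp [PowerSeries.coeff_one]
  · rw [PowerSeries.coeff_succ_X_mul]
    simp [PowerSeries.coeff_one, PowerSeries.coeff_X]
    ring

/-- The relation n a_n = ∑ a_i s_(n-i) is a recursion: since s_0 = 0 it involves only a_i with i < n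
on the right, and n can be cancelled. -/
lemma HasDLog.coeff_eq [NoZeroDivisors R] [CharZero R] {A B s t : R⟦X⟧}
    (hA : HasDLog A s) (hB : HasDLog B t)
    (hA0 : PowerSeries.constantCoeff A = 1) (hB0 : PowerSeries.constantCoeff B = 1) (N : ℕ)
    (hst : ∀ k ≤ N, PowerSeries.coeff k s = PowerSeries.coeff k t) :
    ∀ k ≤ N, PowerSeries.coeff k A = PowerSeries.coeff k B := by
  intro k
  induction k using Nat.strong_induction_on with
  | _ k ih =>
    intro hk
    rcases Nat.eq_zero_or_pos k with rfl | hpos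
    · simpa using hA0.trans hB0.symm
    have hs0 : PowerSeries.coeff 0 s = 0 := by
      have := hasDLog_iff.1 hA 0
      simpa [hA0] using this.symm
    have ht0 : PowerSeries.coeff 0 t = 0 := by rw [← hst 0 (Nat.zero_le _), hs0]
    have h1 := hasDLog_iff.1 hA k
    have h2 := hasDLog_iff.1 hB k
    have h3 : PowerSeries.coeff k (A * s) = PowerSeries.coeff k (B * t) := by
      rw [PowerSeries.coeff_mul, PowerSeries.coeff_mul]
      refine Finset.sum_congr rfl fun x hx => ?_
      rw [Finset.HasAntidiagonal.mem_antidiagonal] at hx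
      by_cases hx2 : x.2 = 0
      · rw [hx2, hs0, ht0, mul_zero, mul_zero]
      · rw [ih x.1 (by omega) (by omega), hst x.2 (by omega)]
    have h4 : (k : R) * PowerSeries.coeff k A = k * PowerSeries.coeff k B := by
      rw [h1, h2, h3]
    exact mul_left_cancel₀ (Nat.cast_ne_zero.2 hpos.ne') h4

open scoped PowerSeries.WithPiTopology in
/-- An infinite product of integral power series whose logarithmic derivatives sum to that of
`L` converges to a power series with image `L`. -/
theorem exists_hasProd_of_hasDLog [NoZeroDivisors R] [CharZero R] {ι : Type*} {f σ : ι → ℤ⟦X⟧}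
    (hf : ∀ i, HasDLog (f i) (σ i)) (hf0 : ∀ i, PowerSeries.constantCoeff (f i) = 1)
    (I : ℕ → Finset ι) (hI : ∀ n i, i ∉ I n → ∀ k ≤ n, PowerSeries.coeff k (σ i) = 0)
    {L τ : R⟦X⟧} (hL : HasDLog L τ) (hL0 : PowerSeries.constantCoeff L = 1)
    (hτ : ∀ n, ∑ i ∈ I n, PowerSeries.coeff n (σ i) = PowerSeries.coeff n τ) :
    ∃ L₀ : ℤ⟦X⟧, PowerSeries.map (Int.castRingHom R) L₀ = L ∧ HasProd f L₀ := by
  classical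
  have key : ∀ n (s : Finset ι), I n ⊆ s →
      ((PowerSeries.coeff n (∏ i ∈ s, f i) : ℤ) : R) = PowerSeries.coeff n L := by
    intro n s hs
    have h1 := (HasDLog.prod s fun i _ => hf i).map (Int.castRingHom R)
    have h2 := h1.coeff_eq hL ?_ hL0 n ?_ n le_rfl
    · rwa [PowerSeries.coeff_map] at h2
    · rw [← PowerSeries.coeff_zero_eq_constantCoeff_apply, PowerSeries.coeff_map,
        PowerSeries.coeff_zero_eq_constantCoeff_apply, map_prod, Finset.prod_congr rfl
        fun i _ => hf0 i]
      simp
    · intro k hk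
      rw [PowerSeries.coeff_map, map_sum, ← hτ k]
      have e : ∀ J : Finset ι, I k ⊆ J →
          ∑ i ∈ J, PowerSeries.coeff k (σ i) = ∑ i ∈ I k, PowerSeries.coeff k (σ i) := by
        intro J hJ
        exact (Finset.sum_subset hJ fun i _ hi => hI k i hi k le_rfl).symm
      -- `s` contains `I n` but perhaps not `I k`, so the two sums are compared through `s ∪ I k`.
      have : ∑ i ∈ s, PowerSeries.coeff k (σ i) = ∑ i ∈ I k, PowerSeries.coeff k (σ i) := by
        rw [← e (s ∪ I k) Finset.subset_union_right]
        refine Finset.sum_subset Finset.subset_union_left fun i _ hi => ?_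
        exact hI n i (fun h => hi (hs h)) k hk
      rw [this]
      simp
  refine ⟨PowerSeries.mk fun n => PowerSeries.coeff n (∏ i ∈ I n, f i), ?_, ?_⟩
  · ext n
    rw [PowerSeries.coeff_map, PowerSeries.coeff_mk]
    exact key n _ subset_rfl
  · unfold HasProd
    rw [SummationFilter.unconditional_filter, PowerSeries.WithPiTopology.tendsto_iff_coeff_tendsto]
    intro n
    refine tendsto_const_nhds.congr' ?_
    filter_upwards [Filter.eventually_ge_atTop (I n)] with s hs
    rw [PowerSeries.coeff_mk]
    apply Int.cast_injective (α := R)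
    rw [key n _ subset_rfl, key n s hs]

end DLog

/-! ### Sums over monic polynomials over a finite field -/

section Monic

open Polynomial

variable {F : Type*} [Field F] [Fintype F]

open Classical in
/-- The monic polynomials of degree `n`. -/
def monics (F : Type*) [Field F] [Fintype F] (n : ℕ) : Finset F[X] :=
  Finset.univ.image fun a : Fin n → F => X ^ n + ∑ i : Fin n, C (a i) * X ^ (i : ℕ)

lemma mem_monics {n : ℕ} {g : F[X]} : g ∈ monics F n ↔ g.Monic ∧ g.natDegree = n := by
  classical
  simp only [monics, Finset.mem_image, Finset.mem_univ, true_and]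
  constructor
  · rintro ⟨a, rfl⟩
    have h := degree_sum_fin_lt a
    refine ⟨monic_X_pow_add h, ?_⟩
    rw [natDegree_add_eq_left_of_degree_lt, natDegree_X_pow]
    rwa [degree_X_pow]
  · rintro ⟨hm, rfl⟩
    refine ⟨fun i => g.coeff i, ?_⟩
    conv_rhs => rw [hm.as_sum]
    rw [Finset.sum_range]

open Classical in
/-- The monic irreducible polynomials of degree at most `n`. -/
def irrLE (F : Type*) [Field F] [Fintype F] (n : ℕ) : Finset F[X] :=
  ((Finset.range (n + 1)).biUnion (monics F)).filter Irreducible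

lemma mem_irrLE {n : ℕ} {P : F[X]} :
    P ∈ irrLE F n ↔ P.Monic ∧ Irreducible P ∧ P.natDegree ≤ n := by
  simp only [irrLE, Finset.mem_filter, Finset.mem_biUnion, Finset.mem_range, mem_monics]
  constructor
  · rintro ⟨⟨k, hk, hm, rfl⟩, hi⟩
    exact ⟨hm, hi, by omega⟩
  · rintro ⟨hm, hi, hk⟩
    exact ⟨⟨_, by omega, hm, rfl⟩, hi⟩

open Classical in
/-- The monic irreducible polynomials of degree dividing the positive integer `n`. -/
def irrDvd (F : Type*) [Field F] [Fintype F] (n : ℕ) : Finset F[X] :=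
  (irrLE F n).filter fun P => P.natDegree ∣ n

lemma mem_irrDvd {n : ℕ} (hn : n ≠ 0) {P : F[X]} :
    P ∈ irrDvd F n ↔ P.Monic ∧ Irreducible P ∧ P.natDegree ∣ n := by
  rw [irrDvd, Finset.mem_filter, mem_irrLE]
  constructor
  · rintro ⟨⟨h1, h2, -⟩, h3⟩
    exact ⟨h1, h2, h3⟩
  · rintro ⟨h1, h2, h3⟩
    exact ⟨⟨h1, h2, Nat.le_of_dvd (Nat.pos_of_ne_zero hn) h3⟩, h3⟩

/-- The polynomial analogue of log n = ∑ Λ(d) over d ∣ n: the exponent of `P` in `g` is the number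
of j ≥ 1 with `P ^ j ∣ g`. Divisibility indicators allow the order of summation to be exchanged in
`hasDLog_monicSum`. -/
lemma natDegree_eq_sum_pow_dvd {n : ℕ} {g : F[X]} (hg : g ∈ monics F n) [DecidableEq F]
    [∀ P g : F[X], Decidable (P ∣ g)] :
    n = ∑ P ∈ irrLE F n, ∑ j ∈ Finset.Icc 1 n, if P ^ j ∣ g then P.natDegree else 0 := by
  obtain ⟨hm, hd⟩ := mem_monics.1 hg
  have hg0 : g ≠ 0 := hm.ne_zero
  set m := UniqueFactorizationMonoid.normalizedFactors g with hmdef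
  have hprod : m.prod = g := by
    have h1 := UniqueFactorizationMonoid.prod_normalizedFactors_eq hg0
    rw [← hmdef, hm.normalize_eq_self] at h1
    exact h1
  have hirr : ∀ P ∈ m, P.Monic ∧ Irreducible P := fun P hP =>
    ⟨by
      rw [← UniqueFactorizationMonoid.normalize_normalized_factor P hP]
      exact monic_normalize (UniqueFactorizationMonoid.irreducible_of_normalized_factor P hP).ne_zero,
      UniqueFactorizationMonoid.irreducible_of_normalized_factor P hP⟩
  have hdeg : n = (m.map natDegree).sum := by
    rw [← hd, ← hprod, natDegree_multiset_prod_of_monic _ fun P hP => (hirr P hP).1]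
  have hcount : ∀ P ∈ irrLE F n, ∀ j, P ^ j ∣ g ↔ j ≤ m.count P := by
    intro P hP j
    obtain ⟨hPm, hPi, -⟩ := mem_irrLE.1 hP
    rw [pow_dvd_iff_le_emultiplicity,
      UniqueFactorizationMonoid.emultiplicity_eq_count_normalizedFactors hPi hg0,
      hPm.normalize_eq_self, Nat.cast_le]
  have hsub : m.toFinset ⊆ irrLE F n := by
    intro P hP
    rw [Multiset.mem_toFinset] at hP
    refine mem_irrLE.2 ⟨(hirr P hP).1, (hirr P hP).2, ?_⟩
    rw [← hd]
    exact natDegree_le_of_dvd (UniqueFactorizationMonoid.dvd_of_mem_normalizedFactors hP) hg0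
  conv_lhs => rw [hdeg, Finset.sum_multiset_map_count]
  rw [Finset.sum_subset hsub]
  · refine Finset.sum_congr rfl fun P hP => ?_
    obtain ⟨hPm, hPi, -⟩ := mem_irrLE.1 hP
    rw [← Finset.sum_filter, Finset.sum_const]
    congr 1
    have hle : m.count P ≤ n := by
      have h1 := (hcount P hP (m.count P)).2 le_rfl
      have h2 := natDegree_le_of_dvd h1 hg0
      rw [natDegree_pow, hd] at h2
      exact (Nat.le_mul_of_pos_right _ hPi.natDegree_pos).trans h2
    have : (Finset.Icc 1 n).filter (fun j => P ^ j ∣ g) = Finset.Icc 1 (m.count P) := by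
      ext j
      simp only [Finset.mem_filter, Finset.mem_Icc, hcount P hP]
      omega
    rw [this, Nat.card_Icc]
    omega
  · intro P _ hP
    rw [Multiset.mem_toFinset] at hP
    rw [Multiset.count_eq_zero_of_notMem hP, zero_smul]

variable {R : Type*} [CommRing R]

/-- The sum of the values of `h` at the monic polynomials of degree `n`. -/
def monicSum (h : F[X] →* R) (n : ℕ) : R := ∑ g ∈ monics F n, h g

/-- The coefficient of `T ^ n` in the logarithmic derivative of the generating series of the
`monicSum h`. -/
def primeSum (h : F[X] →* R) (n : ℕ) : R :=
  ∑ P ∈ irrDvd F n, (P.natDegree : R) * h P ^ (n / P.natDegree)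

lemma monicSum_zero (h : F[X] →* R) : monicSum h 0 = 1 := by
  have : monics F 0 = {1} := by
    ext g
    rw [mem_monics, Finset.mem_singleton]
    constructor
    · rintro ⟨h1, h2⟩
      exact h1.natDegree_eq_zero.1 h2
    · rintro rfl
      exact ⟨monic_one, natDegree_one⟩
  rw [monicSum, this, Finset.sum_singleton, map_one]

lemma monicSum_one (h : F[X] →* R) : monicSum h 1 = ∑ b : F, h (X - C b) := by
  symm
  refine Finset.sum_bij (fun b _ => X - C b) ?_ ?_ ?_ ?_
  · intro b _
    exact mem_monics.2 ⟨monic_X_sub_C b, natDegree_X_sub_C b⟩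
  · intro b _ c _ hbc
    simpa using hbc
  · intro g hg
    obtain ⟨h1, h2⟩ := mem_monics.1 hg
    refine ⟨-g.coeff 0, Finset.mem_univ _, ?_⟩
    rw [h1.eq_X_add_C h2]
    simp
  · intros
    rfl

lemma monicSum_two (h : F[X] →* R) :
    monicSum h 2 = ∑ x : F × F, h (X ^ 2 + C x.1 * X + C x.2) := by
  symm
  have hd : ∀ x : F × F, (C x.1 * X + C x.2 : F[X]).degree < 2 := fun x =>
    lt_of_le_of_lt degree_linear_le (by norm_num)
  refine Finset.sum_bij (fun x _ => X ^ 2 + C x.1 * X + C x.2) ?_ ?_ ?_ ?_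
  · intro x _
    rw [add_assoc]
    refine mem_monics.2 ⟨monic_X_pow_add (hd x), ?_⟩
    rw [natDegree_add_eq_left_of_degree_lt, natDegree_X_pow]
    rw [degree_X_pow]
    exact hd x
  · intro x _ y _ hxy
    have h0 := congrArg (fun f : F[X] => f.coeff 0) hxy
    have h1 := congrArg (fun f : F[X] => f.coeff 1) hxy
    simp [coeff_X_pow] at h0 h1
    exact Prod.ext h1 h0
  · intro g hg
    obtain ⟨h1, h2⟩ := mem_monics.1 hg
    refine ⟨(g.coeff 1, g.coeff 0), Finset.mem_univ _, ?_⟩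
    conv_rhs => rw [h1.as_sum, h2]
    simp [Finset.sum_range_succ]
    ring
  · intros
    rfl

lemma sum_filter_dvd_monics (h : F[X] →* R) {n : ℕ} {P : F[X]} (hP : P.Monic) (j : ℕ)
    [∀ P g : F[X], Decidable (P ∣ g)] :
    ∑ g ∈ monics F n, (if P ^ j ∣ g then h g else 0) =
      if j * P.natDegree ≤ n then h P ^ j * monicSum h (n - j * P.natDegree) else 0 := by
  rw [← Finset.sum_filter]
  have hPj : (P ^ j).natDegree = j * P.natDegree := hP.natDegree_pow j
  split_ifs with hle
  · rw [monicSum, Finset.mul_sum]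
    symm
    refine Finset.sum_bij (fun g _ => P ^ j * g) ?_ ?_ ?_ ?_
    · intro g hg
      obtain ⟨h1, h2⟩ := mem_monics.1 hg
      refine Finset.mem_filter.2 ⟨mem_monics.2 ⟨(hP.pow j).mul h1, ?_⟩, dvd_mul_right _ _⟩
      rw [(hP.pow j).natDegree_mul h1, hPj, h2]
      omega
    · intro a _ b _ hab
      exact mul_left_cancel₀ (hP.pow j).ne_zero hab
    · intro g hg
      obtain ⟨h1, k, rfl⟩ := Finset.mem_filter.1 hg
      obtain ⟨h2, h3⟩ := mem_monics.1 h1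
      have hk := (hP.pow j).of_mul_monic_left h2
      refine ⟨k, mem_monics.2 ⟨hk, ?_⟩, rfl⟩
      rw [(hP.pow j).natDegree_mul hk, hPj] at h3
      omega
    · intro g _
      rw [map_mul, map_pow]
  · refine Finset.sum_eq_zero fun g hg => ?_
    obtain ⟨h1, h2⟩ := Finset.mem_filter.1 hg
    obtain ⟨h3, h4⟩ := mem_monics.1 h1
    have := natDegree_le_of_dvd h2 h3.ne_zero
    omega

/-- The generating series of `monicSum h` has an Euler product, whose logarithmic derivative is
the generating series of `primeSum h`. -/
theorem hasDLog_monicSum (h : F[X] →* R) :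
    HasDLog (PowerSeries.mk (monicSum h)) (PowerSeries.mk (primeSum h)) := by
  classical
  rw [hasDLog_iff]
  intro n
  rw [PowerSeries.coeff_mul, Finset.Nat.sum_antidiagonal_eq_sum_range_succ_mk]
  simp only [PowerSeries.coeff_mk]
  have hL : (n : R) * monicSum h n = ∑ P ∈ irrLE F n, ∑ j ∈ Finset.Icc 1 n,
      if j * P.natDegree ≤ n then
        (P.natDegree : R) * (h P ^ j * monicSum h (n - j * P.natDegree)) else 0 := by
    rw [monicSum, Finset.mul_sum]
    have : ∀ g ∈ monics F n, (n : R) * h g = ∑ P ∈ irrLE F n, ∑ j ∈ Finset.Icc 1 n,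
        (P.natDegree : R) * (if P ^ j ∣ g then h g else 0) := by
      intro g hg
      have h1 := congrArg (Nat.cast (R := R)) (natDegree_eq_sum_pow_dvd hg)
      rw [h1, Nat.cast_sum, Finset.sum_mul]
      refine Finset.sum_congr rfl fun P _ => ?_
      rw [Nat.cast_sum, Finset.sum_mul]
      refine Finset.sum_congr rfl fun j _ => ?_
      split_ifs <;> simp
    rw [Finset.sum_congr rfl this, Finset.sum_comm]
    refine Finset.sum_congr rfl fun P hP => ?_
    rw [Finset.sum_comm]
    refine Finset.sum_congr rfl fun j _ => ?_
    rw [← Finset.mul_sum, sum_filter_dvd_monics h (mem_irrLE.1 hP).1]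
    split_ifs <;> simp
  rw [hL, ← Finset.sum_range_reflect]
  have hR : ∀ k ∈ Finset.range (n + 1),
      monicSum h (n + 1 - 1 - k) * primeSum h (n - (n + 1 - 1 - k)) =
      ∑ P ∈ irrLE F n, if k ≠ 0 ∧ P.natDegree ∣ k then
        (P.natDegree : R) * (h P ^ (k / P.natDegree) * monicSum h (n - k)) else 0 := by
    intro k hk
    rw [Finset.mem_range] at hk
    have e1 : n + 1 - 1 - k = n - k := by omega
    have e2 : n - (n - k) = k := by omega
    rw [e1, e2, ← Finset.sum_filter, primeSum, Finset.mul_sum]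
    have hset : irrDvd F k = (irrLE F n).filter fun P => k ≠ 0 ∧ P.natDegree ∣ k := by
      ext P
      rw [irrDvd, Finset.mem_filter, Finset.mem_filter, mem_irrLE, mem_irrLE]
      constructor
      · rintro ⟨⟨h1, h2, h3⟩, h4⟩
        have := h2.natDegree_pos
        exact ⟨⟨h1, h2, by omega⟩, by omega, h4⟩
      · rintro ⟨⟨h1, h2, h3⟩, h4, h5⟩
        exact ⟨⟨h1, h2, Nat.le_of_dvd (Nat.pos_of_ne_zero h4) h5⟩, h5⟩
    rw [hset]
    refine Finset.sum_congr rfl fun P _ => by ring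
  conv_rhs => rw [Finset.sum_congr rfl hR, Finset.sum_comm]
  refine Finset.sum_congr rfl fun P hP => ?_
  have hpos := (mem_irrLE.1 hP).2.1.natDegree_pos
  rw [← Finset.sum_filter, ← Finset.sum_filter]
  -- The sum over powers `P ^ j` is reindexed by the degree k = j deg P of the power.
  refine Finset.sum_bij (fun j _ => j * P.natDegree) ?_ ?_ ?_ ?_
  · intro j hj
    simp only [Finset.mem_filter, Finset.mem_Icc, Finset.mem_range] at hj ⊢
    refine ⟨by omega, ?_, dvd_mul_left _ _⟩
    have : 0 < j * P.natDegree := Nat.mul_pos (by omega) hpos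
    omega
  · intro i _ j _ hij
    exact Nat.eq_of_mul_eq_mul_right hpos hij
  · intro k hk
    simp only [Finset.mem_filter, Finset.mem_range] at hk
    obtain ⟨hk1, hk2, j, rfl⟩ := hk
    have hj : j ≠ 0 := by rintro rfl; simp at hk2
    refine ⟨j, ?_, mul_comm _ _⟩
    simp only [Finset.mem_filter, Finset.mem_Icc]
    have : j ≤ P.natDegree * j := Nat.le_mul_of_pos_left _ hpos
    rw [mul_comm j]
    omega
  · intro j _
    rw [Nat.mul_div_cancel _ hpos]

/-- If `h` is the product of `χ (g ↦ g a)` and a function that is invariant under the addition of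
multiples of a polynomial `e` of degree less than `n` that does not vanish at `a`, then the sum of
`h` over the monic polynomials of degree `n` is zero. -/
lemma monicSum_eq_zero [NoZeroDivisors R] [CharZero R] (h : F[X] →* R) {n : ℕ} (χ : F → R)
    (hχ : ∑ b, χ b = 0)
    (e : F[X]) (he : e.degree < n) (a : F) (ha : e.eval a ≠ 0) (h' : F[X] → R)
    (hh : ∀ g ∈ monics F n, h g = χ (g.eval a) * h' g)
    (h'e : ∀ g ∈ monics F n, ∀ b : F, h' (g + C b * e) = h' g) :
    monicSum h n = 0 := by
  have hmem : ∀ g ∈ monics F n, ∀ b : F, g + C b * e ∈ monics F n := by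
    intro g hg b
    obtain ⟨h1, h2⟩ := mem_monics.1 hg
    have hlt : (C b * e).degree < g.degree := by
      rw [degree_eq_natDegree h1.ne_zero, h2]
      rw [← smul_eq_C_mul]
      exact lt_of_le_of_lt (degree_smul_le b e) he
    refine mem_monics.2 ⟨h1.add_of_left hlt, ?_⟩
    rw [natDegree_add_eq_left_of_degree_lt hlt, h2]
  have h1 : ∀ b : F, monicSum h n = ∑ g ∈ monics F n, h (g + C b * e) := by
    intro b
    symm
    refine Finset.sum_bij' (fun g _ => g + C b * e) (fun g _ => g + C (-b) * e)
      (fun g hg => hmem g hg b) (fun g hg => hmem g hg (-b)) ?_ ?_ ?_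
    · intro g _
      simp
    · intro g _
      simp
    · intros
      rfl
  -- Average over the translations by `b * e`: for fixed `g` the value of the translate at `a` runs
  -- once through `F`, and χ sums to zero.
  have h2 : (Fintype.card F : R) * monicSum h n = 0 := by
    calc (Fintype.card F : R) * monicSum h n = ∑ b : F, monicSum h n := by simp
      _ = ∑ b : F, ∑ g ∈ monics F n, h (g + C b * e) := Finset.sum_congr rfl fun b _ => h1 b
      _ = ∑ g ∈ monics F n, ∑ b : F, h (g + C b * e) := Finset.sum_comm
      _ = 0 := by
        refine Finset.sum_eq_zero fun g hg => ?_
        have : ∀ b : F, h (g + C b * e) = χ (g.eval a + b * e.eval a) * h' g := by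
          intro b
          rw [hh _ (hmem g hg b), h'e g hg]
          simp
        rw [Finset.sum_congr rfl fun b _ => this b, ← Finset.sum_mul]
        have : ∑ b : F, χ (g.eval a + b * e.eval a) = ∑ b, χ b :=
          Fintype.sum_equiv ((Equiv.mulRight₀ (e.eval a) ha).trans (Equiv.addLeft (g.eval a)))
            _ _ fun b => by simp
        rw [this, hχ, zero_mul]
  exact (mul_eq_zero.1 h2).resolve_left (Nat.cast_ne_zero.2 Fintype.card_ne_zero)

/-- For `g` monic, the product of `z - a` over the roots `z` of `g`. -/
def evalSign (a : F) : F[X] →* F where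
  toFun g := (-1) ^ g.natDegree * g.eval a
  map_one' := by simp
  map_mul' f g := by
    by_cases hf : f = 0
    · simp [hf]
    by_cases hg : g = 0
    · simp [hg]
    rw [natDegree_mul hf hg, eval_mul, pow_add]
    ring

omit [Fintype F] in
lemma evalSign_apply (a : F) (g : F[X]) : evalSign a g = (-1) ^ g.natDegree * g.eval a := rfl

omit [Fintype F] in
lemma evalSign_X_sub_C (a b : F) : evalSign a (X - C b) = b - a := by
  rw [evalSign_apply, natDegree_X_sub_C]
  simp

variable {L : Type*} [Field L] [Fintype L] [Algebra F L]

/-- A monic irreducible `P` of degree dividing [L : F] divides X^|L| - X, so it splits in `L`; it is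
separable because `F` is perfect. It is therefore the minimal polynomial of exactly deg P elements.
-/
lemma sum_minpoly (g : F[X] → R) :
    ∑ x : L, g (minpoly F x) = ∑ P ∈ irrDvd F (Module.finrank F L), (P.natDegree : R) * g P := by
  classical
  have hn : Module.finrank F L ≠ 0 := Module.finrank_pos.ne'
  have hint : ∀ x : L, IsIntegral F x := fun x => Algebra.IsIntegral.isIntegral x
  rw [← Finset.sum_fiberwise_of_maps_to (s := Finset.univ) (t := irrDvd F (Module.finrank F L))
    (g := fun x : L => minpoly F x)]
  · refine Finset.sum_congr rfl fun P hP => ?_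
    obtain ⟨h1, h2, h3⟩ := (mem_irrDvd hn).1 hP
    rw [Finset.sum_congr rfl fun x hx => by rw [(Finset.mem_filter.1 hx).2], Finset.sum_const,
      nsmul_eq_mul]
    congr 2
    have hroots : P.rootSet L = (Finset.univ.filter fun x : L => minpoly F x = P : Finset L) := by
      ext x
      rw [mem_rootSet_of_ne h1.ne_zero, Finset.mem_coe, Finset.mem_filter]
      constructor
      · intro hx
        exact ⟨Finset.mem_univ _, (minpoly.eq_of_irreducible_of_monic h2 hx h1).symm⟩
      · rintro ⟨-, rfl⟩
        exact minpoly.aeval F x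
    have hcard : Fintype.card (P.rootSet L) = P.natDegree := by
      refine card_rootSet_eq_natDegree (PerfectField.separable_of_irreducible h2) ?_
      have hd := (h2.natDegree_dvd_iff_dvd_X_pow_card_pow_sub_X).1 h3
      have hs := (FiniteField.isSplittingField_sub L F).splits
      have hne : (X ^ Fintype.card L - X : F[X]) ≠ 0 :=
        FiniteField.X_pow_card_sub_X_ne_zero _ Fintype.one_lt_card
      rw [Nat.card_eq_fintype_card, ← Module.card_eq_pow_finrank (K := F) (V := L)] at hd
      exact hs.of_dvd (map_ne_zero hne) ((map_dvd_map' _).2 hd)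
    rw [← hcard, ← Set.toFinset_card]
    congr 1
    ext x
    rw [Set.mem_toFinset, hroots, Finset.mem_coe]
  · intro x _
    refine (mem_irrDvd hn).2 ⟨minpoly.monic (hint x), minpoly.irreducible (hint x), ?_⟩
    exact minpoly.degree_dvd (hint x)

-- The norm of x - a from F(x) to F is, up to the sign built into `evalSign`, the minimal polynomial
-- of x at a; the exponent is [L : F(x)]. This turns the terms of `primeSum` into character values
-- of norms.
omit [Fintype F] in
lemma norm_sub_algebraMap (x : L) (a : F) :
    evalSign a (minpoly F x) ^ (Module.finrank F L / (minpoly F x).natDegree) =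
      Algebra.norm F (x - algebraMap F L a) := by
  set y := x - algebraMap F L a with hy
  have hint : ∀ x : L, IsIntegral F x := fun x => Algebra.IsIntegral.isIntegral x
  have hmin : minpoly F y = (minpoly F x).comp (X + C a) := minpoly.sub_algebraMap x a
  have hdeg : (minpoly F y).natDegree = (minpoly F x).natDegree := by
    rw [hmin, natDegree_comp, natDegree_X_add_C, mul_one]
  rw [Algebra.norm_eq_norm_adjoin, ← IntermediateField.adjoin.powerBasis_gen (hint y),
    Algebra.PowerBasis.norm_gen_eq_coeff_zero_minpoly, IntermediateField.adjoin.powerBasis_gen,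
    IntermediateField.adjoin.powerBasis_dim, IntermediateField.minpoly_gen, evalSign_apply, hdeg,
    hmin, coeff_zero_eq_eval_zero, eval_comp]
  have h2 : Module.finrank F (IntermediateField.adjoin F {y}) = (minpoly F x).natDegree := by
    rw [IntermediateField.adjoin.finrank (hint y), hdeg]
  have h3 := Module.finrank_mul_finrank F (IntermediateField.adjoin F {y}) L
  rw [← h3, h2, Nat.mul_div_cancel_left _ (minpoly.natDegree_pos (hint x))]
  simp

end Monic

/-! ### Quadratic character sums -/

open Polynomial

open Classical in
/-- The quadratic character of a finite field. -/
def quadChi (L : Type*) [Field L] [Fintype L] : MulChar L ℤ := quadraticChar L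

section quadChi

variable {L : Type*} [Field L] [Fintype L]

lemma quadChi_sq {a : L} (ha : a ≠ 0) : quadChi L a ^ 2 = 1 := by
  classical
  rw [quadChi]
  exact quadraticChar_sq_one ha

lemma quadChi_mul_self {a : L} (ha : a ≠ 0) : quadChi L a * quadChi L a = 1 := by
  rw [← sq, quadChi_sq ha]

lemma quadChi_sq_mul {a : L} (ha : a ≠ 0) (b : L) : quadChi L (a ^ 2 * b) = quadChi L b := by
  rw [map_mul, map_pow, quadChi_sq ha, one_mul]

@[simp]
lemma quadChi_zero : quadChi L 0 = 0 := MulChar.map_zero _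

lemma sum_quadChi (hL : ringChar L ≠ 2) : ∑ a : L, quadChi L a = 0 := by
  classical
  rw [← quadraticChar_sum_zero hL]
  rfl

lemma quadChi_eq_one_iff {a : L} (ha : a ≠ 0) : quadChi L a = 1 ↔ IsSquare a := by
  classical
  rw [← quadraticChar_one_iff_isSquare ha, quadChi]

lemma quadChi_eq_neg_one_iff {a : L} : quadChi L a = -1 ↔ ¬ IsSquare a := by
  classical
  rw [← quadraticChar_neg_one_iff_not_isSquare, quadChi]

lemma quadChi_eq_pow (hL : ringChar L ≠ 2) (a : L) :
    ((quadChi L a : ℤ) : L) = a ^ (Fintype.card L / 2) := by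
  classical
  rw [← quadraticChar_eq_pow_of_char_ne_two' hL, quadChi]

lemma quadChi_isQuadratic : (quadChi L).IsQuadratic := by
  classical
  rw [quadChi]
  exact quadraticChar_isQuadratic L

/-- Euler's criterion on both sides: the norm is the power with exponent (|L| - 1)/(|F| - 1), and
multiplying this by (|F| - 1)/2 gives (|L| - 1)/2. Equality in `L` suffices because 0, 1 and -1 are
distinct there. -/
lemma quadChi_norm {F : Type*} [Field F] [Fintype F] [Algebra F L] (hF : ringChar F ≠ 2) (x : L) :
    quadChi F (Algebra.norm F x) = quadChi L x := by
  have hchar : ringChar L = ringChar F := (Algebra.ringChar_eq F L).symm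
  have hL : ringChar L ≠ 2 := by rwa [hchar]
  refine quadChi_isQuadratic.eq_of_eq_coe quadChi_isQuadratic hL ?_
  rw [quadChi_eq_pow hL, ← map_intCast (algebraMap F L), quadChi_eq_pow hF, map_pow,
    FiniteField.algebraMap_norm_eq_pow, ← pow_mul, Nat.card_eq_fintype_card,
    Nat.card_eq_fintype_card]
  congr 1
  have h1 : Fintype.card F % 2 = 1 := FiniteField.odd_card_of_char_ne_two hF
  have h2 : Fintype.card L % 2 = 1 := FiniteField.odd_card_of_char_ne_two hL
  have h3 : Fintype.card F - 1 ∣ Fintype.card L - 1 := by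
    rw [Module.card_eq_pow_finrank (K := F) (V := L)]
    simpa using Nat.sub_dvd_pow_sub_pow (Fintype.card F) 1 (Module.finrank F L)
  obtain ⟨k, hk⟩ := h3
  have h4 : 1 < Fintype.card F := Fintype.one_lt_card
  have h5 : 1 < Fintype.card L := Fintype.one_lt_card
  rw [hk, Nat.mul_div_cancel_left _ (by omega)]
  obtain ⟨m, hm⟩ : ∃ m, Fintype.card F = 2 * m + 1 := ⟨Fintype.card F / 2, by omega⟩
  obtain ⟨l, hl⟩ : ∃ l, Fintype.card L = 2 * l + 1 := ⟨Fintype.card L / 2, by omega⟩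
  rw [hm, hl] at hk ⊢
  have e1 : (2 * m + 1) / 2 = m := by omega
  have e2 : (2 * l + 1) / 2 = l := by omega
  rw [e1, e2]
  have : 2 * l = 2 * (m * k) := by
    rw [← mul_assoc]; simpa using hk
  rw [mul_comm k]
  omega

lemma sum_quadChi_add (hL : ringChar L ≠ 2) (c : L) : ∑ a : L, quadChi L (a + c) = 0 := by
  rw [← sum_quadChi hL]
  exact Equiv.sum_comp (Equiv.addRight c) (fun a => quadChi L a)

/-- Removing the square w² replaces w (w + c) by 1 + c/w, which is linear in 1/w. The value at 1/w =
0 is the one that is missing, hence -1. -/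
lemma sum_quadChi_mul_add (hL : ringChar L ≠ 2) {c : L} (hc : c ≠ 0) :
    ∑ w : L, quadChi L (w * (w + c)) = -1 := by
  classical
  have h : ∀ w : L, quadChi L (w * (w + c)) = quadChi L (c * w⁻¹ + 1) - if w = 0 then 1 else 0 := by
    intro w
    split_ifs with hw
    · subst hw
      simp
    · rw [sub_zero, ← quadChi_sq_mul hw (c * w⁻¹ + 1)]
      congr 1
      field_simp
      ring
  rw [Finset.sum_congr rfl fun w _ => h w, Finset.sum_sub_distrib, Finset.sum_ite_eq' Finset.univ]
  have : ∑ w : L, quadChi L (c * w⁻¹ + 1) = ∑ w : L, quadChi L (w + 1) :=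
    Fintype.sum_equiv ((inv_involutive.toPerm (Inv.inv : L → L)).trans (Equiv.mulLeft₀ c hc)) _ _
      fun w => by simp
  rw [this, sum_quadChi_add hL]
  simp

lemma sum_quadChi_mul_self : ∑ w : L, quadChi L (w * w) = Fintype.card L - 1 := by
  classical
  have h : ∀ w : L, quadChi L (w * w) = 1 - if w = 0 then 1 else 0 := by
    intro w
    split_ifs with hw
    · subst hw
      simp
    · rw [map_mul, quadChi_mul_self hw, sub_zero]
  rw [Finset.sum_congr rfl fun w _ => h w, Finset.sum_sub_distrib, Finset.sum_ite_eq' Finset.univ]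
  simp

/-- For fixed b the sum over w is -χ(b), unless b = 1, where the two roots 0 and 1 - b of the
quadratic in w collide and |L| is added. -/
lemma sum_quadChi_triple (hL : ringChar L ≠ 2) :
    ∑ b : L, ∑ w : L, quadChi L (b * w * (b + w - 1)) = Fintype.card L := by
  classical
  have h : ∀ b : L, ∑ w : L, quadChi L (b * w * (b + w - 1)) =
      -quadChi L b + if b = 1 then (Fintype.card L : ℤ) else 0 := by
    intro b
    have h1 : ∀ w : L, quadChi L (b * w * (b + w - 1)) =
        quadChi L b * quadChi L (w * (w + (b - 1))) := by
      intro w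
      rw [← map_mul]
      congr 1
      ring
    rw [Finset.sum_congr rfl fun w _ => h1 w, ← Finset.mul_sum]
    split_ifs with hb
    · subst hb
      simp only [sub_self, add_zero, sum_quadChi_mul_self, map_one]
      ring
    · rw [sum_quadChi_mul_add hL (sub_ne_zero.2 hb)]
      ring
  rw [Finset.sum_congr rfl fun b _ => h b, Finset.sum_add_distrib, Finset.sum_neg_distrib,
    sum_quadChi hL, Finset.sum_ite_eq' Finset.univ]
  simp

end quadChi

/-! ### The character sums of the Legendre curves -/

section Legendre

/-- The character sum of the cubic polynomial `x (x + 1) (x + s)`. -/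
def legSum (L : Type*) [Field L] [Fintype L] (s : L) : ℤ :=
  ∑ x : L, quadChi L (x * (x + 1) * (x + s))

variable {F : Type*} [Field F] [Fintype F]

lemma legSum_zero (hF : ringChar F ≠ 2) : legSum F 0 = -1 := by
  rw [legSum, ← sum_quadChi_mul_add hF (one_ne_zero (α := F))]
  classical
  have h : ∀ x : F, quadChi F (x * (x + 1) * (x + 0)) =
      quadChi F (x + 1) - if x = 0 then 1 else 0 := by
    intro x
    split_ifs with hx
    · subst hx; simp
    · rw [sub_zero, ← quadChi_sq_mul hx (x + 1)]
      congr 1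
      ring
  rw [Finset.sum_congr rfl fun w _ => h w, Finset.sum_sub_distrib, Finset.sum_ite_eq' Finset.univ,
    sum_quadChi_add hF, sum_quadChi_mul_add hF one_ne_zero]
  simp

/-- Without its square factor the cubic is linear, and only the term at the double root x = -1 is
missing. The sign χ(-1) decides whether the node there is split. -/
lemma legSum_one (hF : ringChar F ≠ 2) : legSum F 1 = -quadChi F (-1) := by
  classical
  have h : ∀ x : F, quadChi F (x * (x + 1) * (x + 1)) =
      quadChi F x - if x = -1 then quadChi F (-1) else 0 := by
    intro x
    split_ifs with hx
    · subst hx; simp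
    · have hx' : x + 1 ≠ 0 := fun h => hx (eq_neg_of_add_eq_zero_left h)
      rw [sub_zero, ← quadChi_sq_mul hx' x]
      congr 1
      ring
  rw [legSum, Finset.sum_congr rfl fun w _ => h w, Finset.sum_sub_distrib,
    Finset.sum_ite_eq' Finset.univ, sum_quadChi hF]
  simp

/-- The multiplicative function on `F[X]` attached to the cubic polynomial `x (x + 1) (x + s)`. -/
def legHom (s : F) : F[X] →* ℤ :=
  (quadChi F).toMonoidHom.comp (evalSign 0 * evalSign (-1) * evalSign (-s))

lemma legHom_apply (s : F) (g : F[X]) :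
    legHom s g = quadChi F (evalSign 0 g * evalSign (-1) g * evalSign (-s) g) := rfl

lemma primeSum_legHom (hF : ringChar F ≠ 2) (s : F) (L : Type*) [Field L] [Fintype L]
    [Algebra F L] : primeSum (legHom s) (Module.finrank F L) = legSum L (algebraMap F L s) := by
  rw [primeSum, ← sum_minpoly (L := L)
    (fun P => legHom s P ^ (Module.finrank F L / P.natDegree)), legSum]
  refine Finset.sum_congr rfl fun x _ => ?_
  rw [legHom_apply, ← map_pow, mul_pow, mul_pow, norm_sub_algebraMap, norm_sub_algebraMap,
    norm_sub_algebraMap, ← map_mul, ← map_mul, quadChi_norm hF]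
  simp

lemma legHom_of_mem_monics (s : F) {n : ℕ} {g : F[X]} (hg : g ∈ monics F n) :
    legHom s g = quadChi F ((-1) ^ n) ^ 3 * quadChi F (g.eval 0) * quadChi F (g.eval (-1)) *
      quadChi F (g.eval (-s)) := by
  rw [legHom_apply, evalSign_apply, evalSign_apply, evalSign_apply, (mem_monics.1 hg).2]
  simp only [map_mul]
  ring

lemma monicSum_legHom_one (s : F) : monicSum (legHom s) 1 = legSum F s := by
  rw [monicSum_one, legSum]
  refine Finset.sum_congr rfl fun x _ => ?_
  rw [legHom_apply, evalSign_X_sub_C, evalSign_X_sub_C, evalSign_X_sub_C]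
  simp

lemma monicSum_legHom_two (hF : ringChar F ≠ 2) (s : F) (h0 : s ≠ 0) (h1 : s ≠ 1) :
    monicSum (legHom s) 2 = Fintype.card F := by
  have h1' : 1 - s ≠ 0 := sub_ne_zero.2 (Ne.symm h1)
  rw [monicSum_two, Fintype.sum_prod_type_right, ← sum_quadChi_triple hF,
    ← Equiv.sum_comp (Equiv.mulLeft₀ s h0)]
  refine Finset.sum_congr rfl fun b _ => ?_
  -- The monic quadratics g are parametrized by values: g(0) = s b and g(-1) = (1 - s) w, and then
  -- g(-s) = s (1 - s) (b + w - 1). The product of the three is a square times b w (b + w - 1).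
  rw [← Equiv.sum_comp ((Equiv.mulLeft₀ (1 - s) h1').trans (Equiv.subLeft (1 + s * b)))]
  refine Finset.sum_congr rfl fun w _ => ?_
  have hne : s * (1 - s) ≠ 0 := mul_ne_zero h0 h1'
  have hd : ∀ a b : F, (X ^ 2 + C a * X + C b : F[X]).natDegree = 2 := by
    intro a b
    compute_degree!
  rw [legHom_apply, evalSign_apply, evalSign_apply, evalSign_apply, hd,
    ← quadChi_sq_mul hne (b * w * (b + w - 1))]
  congr 1
  simp
  ring

/-- Adding multiples of X (X + 1) keeps g(0) and g(-1) and moves g(-s) through the whole field. If s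
is 0 or 1, two of the three points coincide and the linear polynomial vanishing at the double point
suffices; this is why the singular case already has no quadratic term. -/
lemma monicSum_legHom_eq_zero (hF : ringChar F ≠ 2) (s : F) {n : ℕ} (hn : 3 ≤ n) :
    monicSum (legHom s) n = 0 := by
  have hlin : ∀ a : F, (X + C a : F[X]).degree < n := fun a => by
    rw [degree_X_add_C]; exact_mod_cast (by omega : 1 < n)
  by_cases h0 : s = 0
  · subst h0
    refine monicSum_eq_zero _ (quadChi F) (sum_quadChi hF) (X + C 0) (hlin 0) (-1) (by simp)
      (fun g => quadChi F ((-1) ^ n) ^ 3 * quadChi F (g.eval 0) * quadChi F (g.eval 0)) ?_ ?_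
    · intro g hg
      rw [legHom_of_mem_monics _ hg, neg_zero]
      ring
    · intro g _ b
      simp
  by_cases h1 : s = 1
  · subst h1
    refine monicSum_eq_zero _ (quadChi F) (sum_quadChi hF) (X + C 1) (hlin 1) 0 (by simp)
      (fun g => quadChi F ((-1) ^ n) ^ 3 * quadChi F (g.eval (-1)) * quadChi F (g.eval (-1))) ?_ ?_
    · intro g hg
      rw [legHom_of_mem_monics _ hg]
      ring
    · intro g _ b
      simp
  refine monicSum_eq_zero _ (quadChi F) (sum_quadChi hF) (X * (X + C 1)) ?_ (-s) ?_
    (fun g => quadChi F ((-1) ^ n) ^ 3 * quadChi F (g.eval 0) * quadChi F (g.eval (-1))) ?_ ?_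
  · rw [degree_mul, degree_X, degree_X_add_C]
    exact_mod_cast (by omega : 2 < n)
  · rw [eval_mul, eval_add, eval_X, eval_C]
    refine mul_ne_zero (neg_ne_zero.2 h0) fun h => h1 ?_
    linear_combination -h
  · intro g hg
    rw [legHom_of_mem_monics _ hg]
    ring
  · intro g _ b
    simp

lemma monicSum_legHom_two_of_singular (hF : ringChar F ≠ 2) (s : F) (hs : s = 0 ∨ s = 1) :
    monicSum (legHom s) 2 = 0 := by
  have hlin : ∀ a : F, (X + C a : F[X]).degree < (2 : ℕ) := fun a => by
    rw [degree_X_add_C]; norm_num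
  rcases hs with rfl | rfl
  · refine monicSum_eq_zero _ (quadChi F) (sum_quadChi hF) (X + C 0) (hlin 0) (-1) (by simp)
      (fun g => quadChi F ((-1) ^ 2) ^ 3 * quadChi F (g.eval 0) * quadChi F (g.eval 0)) ?_ ?_
    · intro g hg
      rw [legHom_of_mem_monics _ hg, neg_zero]
      ring
    · intro g _ b
      simp
  · refine monicSum_eq_zero _ (quadChi F) (sum_quadChi hF) (X + C 1) (hlin 1) 0 (by simp)
      (fun g => quadChi F ((-1) ^ 2) ^ 3 * quadChi F (g.eval (-1)) * quadChi F (g.eval (-1))) ?_ ?_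
    · intro g hg
      rw [legHom_of_mem_monics _ hg]
      ring
    · intro g _ b
      simp

open Classical in
/-- The local `L`-polynomial of `y ^ 2 = x (x + 1) (x + s)` over a finite field. -/
def legPoly (s : F) : ℤ[X] :=
  1 + C (legSum F s) * X + if s = 0 ∨ s = 1 then 0 else C (Fintype.card F : ℤ) * X ^ 2

theorem hasDLog_legPoly (hF : ringChar F ≠ 2) (s : F) :
    HasDLog (legPoly s).toPowerSeries (PowerSeries.mk (primeSum (legHom s))) := by
  convert hasDLog_monicSum (legHom s) using 1
  ext n
  rw [PowerSeries.coeff_mk, Polynomial.coeff_coe, legPoly]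
  rcases n with _ | _ | _ | n
  · rw [monicSum_zero]
    split_ifs <;> simp
  · rw [monicSum_legHom_one]
    split_ifs <;> simp [coeff_one, -eq_intCast, -Int.cast_natCast, -map_natCast]
  · split_ifs with h
    · rw [monicSum_legHom_two_of_singular hF s h]
      simp [coeff_one, -eq_intCast, -Int.cast_natCast, -map_natCast]
    · rw [not_or] at h
      rw [monicSum_legHom_two hF s h.1 h.2]
      simp [coeff_one, -eq_intCast, -Int.cast_natCast, -map_natCast]
  · rw [monicSum_legHom_eq_zero hF s (by omega)]
    split_ifs <;> simp [coeff_one, -eq_intCast, -Int.cast_natCast, -map_natCast]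

end Legendre

/-! ### Jacobi sums -/

section JacobiSum

variable {R : Type*} [CommRing R]

/-- The Jacobi sum of `ψ` and the quadratic character, up to sign. -/
def jacSum {L : Type*} [Field L] [Fintype L] (ψ : MulChar L R) : R :=
  ∑ x : L, ψ x * (quadChi L (x - 1) : R)

section

variable {L : Type*} [Field L] [Fintype L]

omit [Fintype L] in
lemma mulChar_neg_one_sq (ψ : MulChar L R) : ψ (-1) ^ 2 = 1 := by
  rw [← map_pow]; simp

lemma sq_eq_jacSum_sq (ψ : MulChar L R) :
    (∑ x : L, ψ x * (quadChi L (1 - x) : R)) ^ 2 = jacSum ψ ^ 2 := by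
  have h : ∀ x : L, ψ x * (quadChi L (1 - x) : R) =
      (quadChi L (-1) : R) * (ψ x * (quadChi L (x - 1) : R)) := by
    intro x
    rw [show (1 - x) = -1 * (x - 1) by ring, map_mul]
    push_cast
    ring
  rw [Finset.sum_congr rfl fun x _ => h x, ← Finset.mul_sum, mul_pow, ← Int.cast_pow,
    quadChi_sq (neg_ne_zero.2 one_ne_zero), Int.cast_one, one_mul, jacSum]

lemma sq_eq_jacSum_sq' (ψ : MulChar L R) :
    (∑ x : L, ψ x * (quadChi L (x + 1) : R)) ^ 2 = jacSum ψ ^ 2 := by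
  rw [← sq_eq_jacSum_sq, ← Equiv.sum_comp (Equiv.neg L)]
  have h : ∀ x : L, ψ (-x) * (quadChi L (-x + 1) : R) =
      ψ (-1) * (ψ x * (quadChi L (1 - x) : R)) := by
    intro x
    rw [show -x = -1 * x by ring, map_mul, show -1 * x + 1 = 1 - x by ring]
    ring
  simp only [Equiv.neg_apply]
  rw [Finset.sum_congr rfl fun x _ => h x, ← Finset.mul_sum, mul_pow, mulChar_neg_one_sq, one_mul]

/-- The substitution s = x u gives x (x + 1) (x + s) = x² (x + 1) (u + 1), so the double sum
separates into the square of one sum. -/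
theorem sum_mul_legSum (ψ : MulChar L R) :
    ∑ s : L, ψ s * (legSum L s : R) = jacSum ψ ^ 2 := by
  rw [← sq_eq_jacSum_sq']
  set K : R := ∑ x : L, ψ x * (quadChi L (x + 1) : R) with hK
  have h : ∀ x : L, ∑ s : L, ψ s * (quadChi L (x * (x + 1) * (x + s)) : R) =
      ψ x * (quadChi L (x + 1) : R) * K := by
    intro x
    by_cases hx : x = 0
    · subst hx
      simp [MulChar.map_zero ψ]
    rw [hK, Finset.mul_sum, ← Equiv.sum_comp (Equiv.mulLeft₀ x hx)]
    refine Finset.sum_congr rfl fun u _ => ?_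
    rw [Equiv.mulLeft₀_apply, map_mul,
      show x * (x + 1) * (x + x * u) = x ^ 2 * ((x + 1) * (u + 1)) by ring, quadChi_sq_mul hx,
      map_mul]
    push_cast
    ring
  calc ∑ s : L, ψ s * (legSum L s : R)
      = ∑ s : L, ∑ x : L, ψ s * (quadChi L (x * (x + 1) * (x + s)) : R) := by
        refine Finset.sum_congr rfl fun s _ => ?_
        rw [legSum, Int.cast_sum, Finset.mul_sum]
    _ = ∑ x : L, ψ x * (quadChi L (x + 1) : R) * K := by
        rw [Finset.sum_comm]
        exact Finset.sum_congr rfl fun x _ => h x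
    _ = K ^ 2 := by rw [← Finset.sum_mul, sq]

end

variable {F : Type*} [Field F] [Fintype F]

/-- The multiplicative function on `F[X]` attached to the Jacobi sum of `ψ`. -/
def jacHom (ψ : MulChar F R) : F[X] →* R :=
  (ψ.toMonoidHom.comp (evalSign 0)) *
    ((Int.castRingHom R : ℤ →* R).comp ((quadChi F).toMonoidHom.comp (evalSign 1)))

lemma jacHom_apply (ψ : MulChar F R) (g : F[X]) :
    jacHom ψ g = ψ (evalSign 0 g) * (quadChi F (evalSign 1 g) : R) := rfl

variable [IsDomain R] [CharZero R]

/-- The relation of Hasse and Davenport for the Jacobi sums of a character and the quadratic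
character. -/
theorem sum_comp_norm (hF : ringChar F ≠ 2) (ψ : MulChar F R) (L : Type*) [Field L] [Fintype L]
    [Algebra F L] :
    ∑ x : L, ψ (Algebra.norm F x) * (quadChi L (x - 1) : R) =
      -(-jacSum ψ) ^ Module.finrank F L := by
  have h0 : primeSum (jacHom ψ) (Module.finrank F L) =
      ∑ x : L, ψ (Algebra.norm F x) * (quadChi L (x - 1) : R) := by
    rw [primeSum, ← sum_minpoly (L := L)
      (fun P => jacHom ψ P ^ (Module.finrank F L / P.natDegree))]
    refine Finset.sum_congr rfl fun x _ => ?_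
    rw [jacHom_apply, mul_pow, ← map_pow ψ, ← Int.cast_pow, ← map_pow (quadChi F),
      norm_sub_algebraMap, norm_sub_algebraMap, quadChi_norm hF]
    simp
  -- The series is linear: in degree at least 2, adding multiples of X keeps g(0) and moves g(1),
  -- and χ sums to zero. Its logarithmic derivative then consists of powers of one number.
  have h1 : PowerSeries.mk (monicSum (jacHom ψ)) =
      1 - PowerSeries.C (-jacSum ψ) * PowerSeries.X := by
    ext n
    rw [PowerSeries.coeff_mk, map_sub, PowerSeries.coeff_C_mul, PowerSeries.coeff_one,
      PowerSeries.coeff_X]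
    rcases n with _ | _ | n
    · simp [monicSum_zero]
    · rw [monicSum_one]
      simp only [jacHom_apply, evalSign_X_sub_C]
      simp [jacSum]
    · rw [if_neg (by omega), if_neg (by omega), mul_zero, sub_zero]
      have hs : ∑ b : F, (quadChi F b : R) = 0 := by
        rw [← Int.cast_sum, sum_quadChi hF, Int.cast_zero]
      refine monicSum_eq_zero _ (fun b => (quadChi F b : R)) hs X ?_ 1 (by simp)
        (fun g => (quadChi F ((-1) ^ (n + 2)) : R) * ψ ((-1) ^ (n + 2) * g.eval 0)) ?_ ?_
      · rw [degree_X]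
        exact_mod_cast (by omega : 1 < n + 2)
      · intro g hg
        rw [jacHom_apply, evalSign_apply, evalSign_apply, (mem_monics.1 hg).2, map_mul (quadChi F)]
        push_cast
        ring
      · intro g _ b
        simp
  have h2 := hasDLog_monicSum (jacHom ψ)
  rw [h1] at h2
  have h3 := hasDLog_one_sub_C_mul_X (-jacSum ψ)
  have h4 : (1 - PowerSeries.C (-jacSum ψ) * PowerSeries.X : R⟦X⟧) ≠ 0 := by
    intro h
    have := congrArg PowerSeries.constantCoeff h
    simp at this
  have h5 := mul_left_cancel₀ h4 (h2.symm.trans h3)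
  have h6 := congrArg (PowerSeries.coeff (Module.finrank F L)) h5
  rw [PowerSeries.coeff_mk, map_neg, PowerSeries.coeff_mk, if_neg Module.finrank_pos.ne', h0] at h6
  exact h6

end JacobiSum

/-! ### Counting points on Weierstrass curves -/

section PointCount

open WeierstrassCurve

variable {k : Type*} [Field k] [Fintype k]

lemma card_sq_eq (hk : ringChar k ≠ 2) (a : k) :
    (Nat.card {y : k // y ^ 2 = a} : ℤ) = quadChi k a + 1 := by
  classical
  have h := quadraticChar_card_sqrts hk a
  rw [quadChi, ← h, Set.toFinset_card, Nat.card_eq_fintype_card]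
  rfl

/-- The affine points of an elliptic curve and the solutions of its equation. -/
def pointEquiv (W : WeierstrassCurve k) (hW : W.Δ ≠ 0) :
    W.toAffine.Point ≃ Option (Σ x : k, {y : k // W.toAffine.Equation x y}) where
  toFun
    | .zero => none
    | .some x y h => some ⟨x, y, h.1⟩
  invFun
    | none => .zero
    | some ⟨x, y, h⟩ => .some x y ((Affine.equation_iff_nonsingular_of_Δ_ne_zero hW).1 h)
  left_inv P := by cases P <;> rfl
  right_inv P := by rcases P with _ | ⟨x, y, h⟩ <;> rfl

/-- Completing the square: 2 y + a₁ x + a₃ runs over the square roots of the cubic in the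
b-invariants. -/
lemma card_point (hk : ringChar k ≠ 2) (W : WeierstrassCurve k) (hW : W.Δ ≠ 0) :
    (Nat.card W.toAffine.Point : ℤ) = Fintype.card k + 1 +
      ∑ x : k, quadChi k (4 * x ^ 3 + W.b₂ * x ^ 2 + 2 * W.b₄ * x + W.b₆) := by
  have h2 : (2 : k) ≠ 0 := Ring.two_ne_zero hk
  have hfib : ∀ x : k, (Nat.card {y : k // W.toAffine.Equation x y} : ℤ) =
      quadChi k (4 * x ^ 3 + W.b₂ * x ^ 2 + 2 * W.b₄ * x + W.b₆) + 1 := by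
    intro x
    rw [← card_sq_eq hk]
    congr 1
    refine Nat.card_congr (Equiv.subtypeEquiv
      ((Equiv.mulLeft₀ 2 h2).trans (Equiv.addRight (W.a₁ * x + W.a₃))) fun y => ?_)
    rw [Affine.equation_iff, Equiv.trans_apply, Equiv.mulLeft₀_apply, Equiv.coe_addRight,
      WeierstrassCurve.b₂, WeierstrassCurve.b₄, WeierstrassCurve.b₆]
    have h4 : (4 : k) ≠ 0 := by
      rw [show (4 : k) = 2 * 2 by norm_num]; exact mul_ne_zero h2 h2
    constructor
    · intro h
      linear_combination 4 * h
    · intro h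
      refine mul_left_cancel₀ h4 ?_
      linear_combination h
  rw [Nat.card_congr (pointEquiv W hW), Finite.card_option, Nat.card_sigma]
  push_cast
  rw [Finset.sum_congr rfl fun x _ => hfib x, Finset.sum_add_distrib]
  simp
  ring

end PointCount

/-! ### Minimal models over discrete valuation rings -/

section Local

open WeierstrassCurve IsLocalRing Polynomial

variable {R : Type*} [CommRing R] [IsDomain R] [IsDiscreteValuationRing R] {K : Type*}
  [Field K] [Algebra R K] [IsFractionRing R K]

/-- An integral model `E` whose invariants `c₄` and `Δ` are not both too divisible is related to
any minimal model by a change of variables over the discrete valuation ring. -/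
theorem exists_unit_integralModel_minimal (W : WeierstrassCurve K) (E : WeierstrassCurve R)
    (hW : ∃ C : VariableChange K, C • W = E.map (algebraMap R K)) (hΔ : E.Δ ≠ 0)
    (hE : ∀ a ∈ maximalIdeal R, a ^ 4 ∣ E.c₄ → ¬ a ^ 12 ∣ E.Δ) (h2 : IsUnit (2 : R)) :
    ∃ (u : Rˣ) (r : R),
      u ^ 2 * (integralModel R (W.minimal R)).b₂ = E.b₂ + 12 * r ∧
      u ^ 4 * (integralModel R (W.minimal R)).b₄ = E.b₄ + r * E.b₂ + 6 * r ^ 2 ∧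
      u ^ 6 * (integralModel R (W.minimal R)).b₆ =
        E.b₆ + 2 * r * E.b₄ + r ^ 2 * E.b₂ + 4 * r ^ 3 ∧
      u ^ 4 * (integralModel R (W.minimal R)).c₄ = E.c₄ ∧
      u ^ 6 * (integralModel R (W.minimal R)).c₆ = E.c₆ ∧
      u ^ 12 * (integralModel R (W.minimal R)).Δ = E.Δ := by
  obtain ⟨C₀, hC₀⟩ := hW
  set M := W.minimal R with hM
  set I := integralModel R M with hI
  have hinj : Function.Injective (algebraMap R K) := IsFractionRing.injective R K
  obtain ⟨D, hD⟩ : ∃ D : VariableChange K, D • E.map (algebraMap R K) = M := by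
    refine ⟨(W.exists_isMinimal R).choose * C₀⁻¹, ?_⟩
    rw [← hC₀, mul_smul, inv_smul_smul]
    rfl
  have huu : (D.u : K) * ((D.u⁻¹ : Kˣ) : K) = 1 := D.u.mul_inv
  have hDΔ : algebraMap R K I.Δ = ((D.u⁻¹ : Kˣ) : K) ^ 12 * algebraMap R K E.Δ := by
    rw [hI, integralModel_Δ_eq, ← hD, variableChange_Δ, map_Δ]
  have hDc₄ : algebraMap R K I.c₄ = ((D.u⁻¹ : Kˣ) : K) ^ 4 * algebraMap R K E.c₄ := by
    rw [hI, integralModel_c₄_eq, ← hD, variableChange_c₄, map_c₄]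
  have hDc₆ : algebraMap R K I.c₆ = ((D.u⁻¹ : Kˣ) : K) ^ 6 * algebraMap R K E.c₆ := by
    rw [hI, integralModel_c₆_eq, ← hD, variableChange_c₆, map_c₆]
  have hDb₂ : algebraMap R K I.b₂ = ((D.u⁻¹ : Kˣ) : K) ^ 2 * (algebraMap R K E.b₂ + 12 * D.r) := by
    rw [hI, integralModel_b₂_eq, ← hD, variableChange_b₂, map_b₂]
  have hDb₄ : algebraMap R K I.b₄ = ((D.u⁻¹ : Kˣ) : K) ^ 4 *
      (algebraMap R K E.b₄ + D.r * algebraMap R K E.b₂ + 6 * D.r ^ 2) := by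
    rw [hI, integralModel_b₄_eq, ← hD, variableChange_b₄, map_b₂, map_b₄]
  have hDb₆ : algebraMap R K I.b₆ = ((D.u⁻¹ : Kˣ) : K) ^ 6 *
      (algebraMap R K E.b₆ + 2 * D.r * algebraMap R K E.b₄ + D.r ^ 2 * algebraMap R K E.b₂ +
        4 * D.r ^ 3) := by
    rw [hI, integralModel_b₆_eq, ← hD, variableChange_b₆, map_b₂, map_b₄, map_b₆]
  obtain ⟨u, hu⟩ : ∃ u : Rˣ, algebraMap R K u = D.u := by
    -- The scaling factor or its inverse is integral. If the factor is a nonunit `a`, then `a ^ 4`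
    -- and `a ^ 12` divide the invariants of `E`, contrary to `hE`. If the inverse is a nonunit, the
    -- discriminant of `E` is less divisible than that of `M`, contrary to minimality.
    rcases ValuationRing.isInteger_or_isInteger R (D.u : K) with ⟨a, ha⟩ | ⟨b, hb⟩
    · by_cases hau : IsUnit a
      · exact ⟨hau.unit, ha⟩
      · exfalso
        refine hE a ((mem_maximalIdeal a).2 hau) ⟨I.c₄, hinj ?_⟩ ⟨I.Δ, hinj ?_⟩
        · rw [map_mul, map_pow, ha, hDc₄, ← mul_assoc, ← mul_pow, huu, one_pow, one_mul]
        · rw [map_mul, map_pow, ha, hDΔ, ← mul_assoc, ← mul_pow, huu, one_pow, one_mul]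
    · by_cases hbu : IsUnit b
      · refine ⟨hbu.unit⁻¹, ?_⟩
        have h1 : algebraMap R K (hbu.unit⁻¹ : Rˣ) * algebraMap R K b = 1 := by
          rw [← map_mul, IsUnit.val_inv_mul, map_one]
        rw [hb] at h1
        rw [eq_inv_of_mul_eq_one_left h1, inv_inv]
      · exfalso
        have hmax := (IsMinimal.val_Δ_maximal (R := R) (W := M)).2
        have hD' : D⁻¹ • M = E.map (algebraMap R K) := by rw [← hD, inv_smul_smul]
        have hint : IsIntegral R (D⁻¹ • M) := by
          rw [hD']; exact ⟨⟨E, rfl⟩⟩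
        have hb' : algebraMap R K b = ((D.u⁻¹ : Kˣ) : K) := by rw [hb]; simp
        set v := (IsDiscreteValuationRing.maximalIdeal R).valuation K with hv
        have hvb : v (algebraMap R K b) < 1 :=
          (IsDedekindDomain.HeightOneSpectrum.valuation_lt_one_iff_mem _ _).2
            ((mem_maximalIdeal b).2 hbu)
        have hvΔ : v (algebraMap R K E.Δ) ≠ 0 := by
          rw [Valuation.ne_zero_iff]
          exact fun h => hΔ (hinj (by rw [h, map_zero]))
        have h1 : ((valuation_Δ_aux R ((1 : VariableChange K) • M) : _) :
            WithZero (Multiplicative ℤ)) = v (algebraMap R K I.Δ) := by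
          rw [one_smul, valuation_Δ_aux_eq_of_isIntegral, hI, integralModel_Δ_eq]
        have h2 : ((valuation_Δ_aux R (D⁻¹ • M) : _) :
            WithZero (Multiplicative ℤ)) = v (algebraMap R K E.Δ) := by
          rw [valuation_Δ_aux_eq_of_isIntegral, hD', map_Δ]
        have hlt : v (algebraMap R K I.Δ) < v (algebraMap R K E.Δ) := by
          rw [hDΔ, ← hb', map_mul, map_pow]
          refine mul_lt_of_lt_one_left (zero_lt_iff.2 hvΔ) ?_
          exact pow_lt_one₀ zero_le hvb (by norm_num)
        have := hmax hint (by
          rw [← Subtype.coe_le_coe, h1, h2]; exact hlt.le)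
        rw [← Subtype.coe_le_coe, h1, h2] at this
        exact absurd hlt (not_lt.2 this)
  obtain ⟨h, hh⟩ := h2.exists_right_inv
  have hhK : (2 : K) * algebraMap R K h = 1 := by
    rw [← map_ofNat (algebraMap R K) 2, ← map_mul, hh, map_one]
  -- The transformation rule for b₆, divided by 4, is a monic cubic equation for the translation
  -- `D.r` with coefficients in `R`; here `h` is 1/2.
  obtain ⟨r, hr⟩ : ∃ r : R, algebraMap R K r = D.r := by
    refine IsIntegrallyClosed.isIntegral_iff.1 ?_
    refine ⟨X ^ 3 + C (h ^ 2 * E.b₂) * X ^ 2 + C (h * E.b₄) * X +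
      C (h ^ 2 * (E.b₆ - u ^ 6 * I.b₆)), ?_, ?_⟩
    · monicity!
    · simp only [eval₂_add, eval₂_sub, eval₂_mul, eval₂_pow, eval₂_X, eval₂_C, map_mul, map_pow, map_sub, hDb₆,
        hu]
      rw [← mul_assoc ((D.u : K) ^ 6), ← mul_pow, huu]
      set hK := algebraMap R K h
      linear_combination (-D.r * algebraMap R K E.b₄ * hK
        - (2 * hK + 1) * D.r ^ 3) * hhK
  refine ⟨u, r, hinj ?_, hinj ?_, hinj ?_, hinj ?_, hinj ?_, hinj ?_⟩ <;>
    simp only [map_mul, map_pow, map_add, map_ofNat, hu, hr, hDΔ, hDc₄, hDc₆, hDb₂, hDb₄, hDb₆] <;>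
    rw [← mul_assoc ((D.u : K) ^ _), ← mul_pow, huu, one_pow, one_mul]

variable [Fintype (ResidueField R)]

omit [Fintype (ResidueField R)] in
lemma hasGoodReduction_minimal_iff (W : WeierstrassCurve K) :
    (W.minimal R).HasGoodReduction R ↔ IsUnit (integralModel R (W.minimal R)).Δ := by
  rw [hasGoodReduction_iff_isElliptic_reduction, isElliptic_iff, reduction, map_Δ,
    isUnit_iff_ne_zero, ne_eq, residue_eq_zero_iff, mem_maximalIdeal, mem_nonunits_iff, not_not]

omit [Fintype (ResidueField R)] in
lemma hasMultiplicativeReduction_minimal_iff (W : WeierstrassCurve K) :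
    (W.minimal R).HasMultiplicativeReduction R ↔
      ¬ IsUnit (integralModel R (W.minimal R)).Δ ∧ IsUnit (integralModel R (W.minimal R)).c₄ := by
  have hM : IsMinimal R (W.minimal R) := inferInstance
  rw [hasMultiplicativeReduction_iff, and_iff_right hM, ← integralModel_Δ_eq R,
    ← integralModel_c₄_eq R, IsDedekindDomain.HeightOneSpectrum.valuation_lt_one_iff_mem,
    IsDedekindDomain.HeightOneSpectrum.valuation_eq_one_iff_notMem]
  change _ ∈ maximalIdeal R ∧ _ ∉ maximalIdeal R ↔ _
  rw [mem_maximalIdeal, mem_maximalIdeal, mem_nonunits_iff, mem_nonunits_iff, not_not]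

lemma splits_quadratic_iff {k : Type*} [Field k] (h2 : (2 : k) ≠ 0) {a b c : k} (ha : a ≠ 0) :
    (C a * X ^ 2 + C b * X + C c : k[X]).Splits ↔ IsSquare (b ^ 2 - 4 * a * c) := by
  have hdeg : (C a * X ^ 2 + C b * X + C c : k[X]).natDegree = 2 := natDegree_quadratic ha
  have h4 : (4 : k) ≠ 0 := by
    rw [show (4 : k) = 2 * 2 by norm_num]; exact mul_ne_zero h2 h2
  constructor
  · intro h
    obtain ⟨x, hx⟩ := h.exists_eval_eq_zero (by
      rw [degree_eq_natDegree (by intro h0; rw [h0] at hdeg; simp at hdeg), hdeg]; norm_num)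
    simp only [eval_add, eval_mul, eval_C, eval_pow, eval_X] at hx
    exact ⟨2 * a * x + b, by linear_combination -4 * a * hx⟩
  · rintro ⟨s, hs⟩
    have : (C a * X ^ 2 + C b * X + C c : k[X]) =
        C a * ((X - C ((-b + s) / (2 * a))) * (X - C ((-b - s) / (2 * a)))) := by
      have e1 : b = -(a * ((-b + s) / (2 * a) + (-b - s) / (2 * a))) := by
        field_simp
        ring
      have e2 : c = a * ((-b + s) / (2 * a) * ((-b - s) / (2 * a))) := by
        field_simp
        linear_combination -hs
      conv_lhs => rw [e1, e2]
      simp only [map_neg, map_mul, map_add]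
      ring
    rw [this]
    exact (Splits.C a).mul ((Splits.X_sub_C _).mul (Splits.X_sub_C _))

/-- The local polynomial in terms of an integral model that is minimal by the criterion
of `exists_unit_integralModel_minimal`. -/
theorem localPolynomial_eq (W : WeierstrassCurve K) (E : WeierstrassCurve R)
    (hW : ∃ C : VariableChange K, C • W = E.map (algebraMap R K)) (hΔ : E.Δ ≠ 0)
    (hE : ∀ a ∈ maximalIdeal R, a ^ 4 ∣ E.c₄ → ¬ a ^ 12 ∣ E.Δ)
    (hk : ringChar (ResidueField R) ≠ 2) :
    (IsUnit E.Δ → W.localPolynomial R =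
      1 + C (∑ x : ResidueField R, quadChi (ResidueField R) (4 * x ^ 3 + residue R E.b₂ * x ^ 2 +
          2 * residue R E.b₄ * x + residue R E.b₆)) * X +
        C (Fintype.card (ResidueField R) : ℤ) * X ^ 2) ∧
    (¬ IsUnit E.Δ → W.localPolynomial R =
      1 - C (quadChi (ResidueField R) (residue R (-E.c₄ * E.c₆))) * X) := by
  classical
  have h2k : (2 : ResidueField R) ≠ 0 := Ring.two_ne_zero hk
  have h2 : IsUnit (2 : R) := by
    by_contra h
    refine h2k ?_
    rw [← map_ofNat (residue R), residue_eq_zero_iff]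
    exact (mem_maximalIdeal _).2 h
  obtain ⟨u, r, hb₂, hb₄, hb₆, hc₄, hc₆, hΔ'⟩ := exists_unit_integralModel_minimal W E hW hΔ hE h2
  set I := integralModel R (W.minimal R) with hI
  have hu : residue R u ≠ 0 := ((Units.isUnit u).map (residue R)).ne_zero
  have hΔu : IsUnit I.Δ ↔ IsUnit E.Δ := by
    rw [← hΔ', ← Units.val_pow_eq_pow_val, Units.isUnit_units_mul]
  have hc₄u : IsUnit I.c₄ ↔ IsUnit E.c₄ := by
    rw [← hc₄, ← Units.val_pow_eq_pow_val, Units.isUnit_units_mul]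
  constructor
  · intro hE
    have hgood := (hasGoodReduction_minimal_iff W).2 (hΔu.2 hE)
    rw [localPolynomial, if_pos hgood]
    have hred : ((W.minimal R).reduction R).Δ ≠ 0 := by
      rw [reduction, map_Δ]
      exact ((hΔu.2 hE).map (residue R)).ne_zero
    rw [card_point hk _ hred, Nat.card_eq_fintype_card]
    have hsum : ∑ x : ResidueField R, quadChi (ResidueField R) (4 * x ^ 3 +
          ((W.minimal R).reduction R).b₂ * x ^ 2 + 2 * ((W.minimal R).reduction R).b₄ * x +
          ((W.minimal R).reduction R).b₆) =
        ∑ x : ResidueField R, quadChi (ResidueField R) (4 * x ^ 3 + residue R E.b₂ * x ^ 2 +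
          2 * residue R E.b₄ * x + residue R E.b₆) := by
      -- The substitution x ↦ u² x + r turns the cubic of `E` into u⁶ times that of the minimal
      -- model, and u⁶ is a square.
      conv_rhs => rw [← Equiv.sum_comp ((Equiv.mulLeft₀ (residue R u ^ 2)
        (pow_ne_zero 2 hu)).trans (Equiv.addRight (residue R r)))]
      refine Finset.sum_congr rfl fun x _ => ?_
      rw [← quadChi_sq_mul (pow_ne_zero 3 hu)]
      congr 1
      rw [reduction, map_b₂, map_b₄, map_b₆, ← hI, Equiv.trans_apply, Equiv.mulLeft₀_apply,
        Equiv.coe_addRight]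
      have h1 := congrArg (residue R) hb₂
      have h2 := congrArg (residue R) hb₄
      have h3 := congrArg (residue R) hb₆
      simp only [map_mul, map_pow, map_add, map_ofNat] at h1 h2 h3
      linear_combination (residue R u ^ 4 * x ^ 2) * h1 + (2 * residue R u ^ 2 * x) * h2 + h3
    rw [hsum]
    simp only [map_sub, map_add, map_one]
    ring
  · intro hE
    have hbad : ¬ (W.minimal R).HasGoodReduction R := fun h =>
      hE (hΔu.1 ((hasGoodReduction_minimal_iff W).1 h))
    rw [localPolynomial, if_neg hbad]
    have hmult : (W.minimal R).HasMultiplicativeReduction R ↔ IsUnit E.c₄ := by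
      rw [hasMultiplicativeReduction_minimal_iff, ← hI, hΔu, hc₄u, and_iff_right hE]
    by_cases hc : IsUnit E.c₄
    · have hm := hmult.2 hc
      have hE₄ : residue R E.c₄ ≠ 0 := (hc.map (residue R)).ne_zero
      have hI₄ : residue R I.c₄ ≠ 0 := ((hc₄u.2 hc).map (residue R)).ne_zero
      have h1728 : E.c₆ ^ 2 = E.c₄ ^ 3 - 1728 * E.Δ := by
        have := E.c_relation
        linear_combination this
      have hE₆ : residue R E.c₆ ≠ 0 := by
        intro h
        have h1 := congrArg (residue R) h1728
        have h2 : residue R E.Δ = 0 := by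
          rw [residue_eq_zero_iff]; exact (mem_maximalIdeal _).2 hE
        rw [map_pow, map_sub, map_mul, h2, h, map_pow] at h1
        refine pow_ne_zero 3 hE₄ ?_
        linear_combination -h1
      have hne : residue R (-E.c₄ * E.c₆) ≠ 0 := by
        rw [map_mul, map_neg]
        exact mul_ne_zero (neg_ne_zero.2 hE₄) hE₆
      -- The quadratic defining split reduction has discriminant -c₄ c₆, and passing to `E`
      -- multiplies this by the square of u⁵.
      have hsplit : (W.minimal R).HasSplitMultiplicativeReduction R ↔
          quadChi (ResidueField R) (residue R (-E.c₄ * E.c₆)) = 1 := by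
        rw [hasSplitMultiplicativeReduction_iff, exists_prop_of_true hm, quadChi_eq_one_iff hne]
        rw [← hI, Polynomial.map_sub, Polynomial.map_add, Polynomial.map_mul, Polynomial.map_mul,
          Polynomial.map_pow, Polynomial.map_X, Polynomial.map_C, Polynomial.map_C,
          Polynomial.map_C, sub_eq_add_neg, ← C_neg]
        refine (splits_quadratic_iff h2k hI₄).trans ?_
        have e1 := congrArg (residue R) hc₄
        have e2 := congrArg (residue R) hc₆
        rw [map_mul, map_pow] at e1 e2
        have key : ∀ a : ResidueField R, a = -(residue R I.c₄ * residue R I.c₆) →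
            (IsSquare a ↔ IsSquare (residue R (-E.c₄ * E.c₆))) := by
          rintro a rfl
          have : residue R (-E.c₄ * E.c₆) =
              (residue R u ^ 5) ^ 2 * -(residue R I.c₄ * residue R I.c₆) := by
            rw [map_mul, map_neg, ← e1, ← e2]
            ring
          have hI₆ : residue R I.c₆ ≠ 0 := by
            intro h
            rw [h, mul_zero] at e2
            exact hE₆ e2.symm
          rw [← quadChi_eq_one_iff hne, this, quadChi_sq_mul (pow_ne_zero 5 hu),
            quadChi_eq_one_iff (neg_ne_zero.2 (mul_ne_zero hI₄ hI₆))]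
        refine key _ ?_
        change (residue R _) ^ 2 - 4 * residue R _ * -(residue R _) = _
        rw [← map_ofNat (residue R), ← map_pow, ← map_neg, ← map_mul, ← map_mul, ← map_mul,
          ← map_sub, ← map_neg]
        congr 1
        simp only [WeierstrassCurve.c₄, WeierstrassCurve.c₆, WeierstrassCurve.b₂,
          WeierstrassCurve.b₄, WeierstrassCurve.b₆]
        ring
      by_cases hs : (W.minimal R).HasSplitMultiplicativeReduction R
      · rw [if_pos hs, hsplit.1 hs]
        simp
      · rw [if_neg hs, if_pos hm]
        have : quadChi (ResidueField R) (residue R (-E.c₄ * E.c₆)) = -1 := by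
          rw [quadChi_eq_neg_one_iff, ← quadChi_eq_one_iff hne, ← hsplit]
          exact hs
        rw [this]
        simp
    · have hm : ¬ (W.minimal R).HasMultiplicativeReduction R := fun h => hc (hmult.1 h)
      have hs : ¬ (W.minimal R).HasSplitMultiplicativeReduction R :=
        fun h => hm h.toHasMultiplicativeReduction
      rw [if_neg hs, if_neg hm]
      -- In the additive case c₄ reduces to 0, so χ(0) = 0 makes the same formula give 1.
      have : residue R (-E.c₄ * E.c₆) = 0 := by
        rw [residue_eq_zero_iff]
        exact Ideal.mul_mem_right _ _ (neg_mem ((mem_maximalIdeal _).2 hc))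
      rw [this, quadChi_zero]
      simp

end Local

/-! ### Local polynomials of Legendre curves -/

section LegendreLocal

open WeierstrassCurve IsLocalRing Polynomial

/-- The curve `y ^ 2 = x (x + 1) (x + s)`. -/
def legendreModel {R : Type*} [CommRing R] (s : R) : WeierstrassCurve R where
  a₁ := 0
  a₂ := 1 + s
  a₃ := 0
  a₄ := s
  a₆ := 0

section

variable {R : Type*} [CommRing R] (s : R)

lemma legendreModel_b₂ : (legendreModel s).b₂ = 4 * (1 + s) := by
  simp [legendreModel, WeierstrassCurve.b₂]

lemma legendreModel_b₄ : (legendreModel s).b₄ = 2 * s := by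
  simp [legendreModel, WeierstrassCurve.b₄]

lemma legendreModel_b₆ : (legendreModel s).b₆ = 0 := by
  simp [legendreModel, WeierstrassCurve.b₆]

lemma legendreModel_c₄ : (legendreModel s).c₄ = 16 * (s ^ 2 - s + 1) := by
  rw [WeierstrassCurve.c₄, legendreModel_b₂, legendreModel_b₄]
  ring

lemma legendreModel_c₆ : (legendreModel s).c₆ = -32 * ((1 + s) * (2 * s ^ 2 - 5 * s + 2)) := by
  rw [WeierstrassCurve.c₆, legendreModel_b₂, legendreModel_b₄, legendreModel_b₆]
  ring

lemma legendreModel_Δ : (legendreModel s).Δ = 16 * (s ^ 2 * (1 - s) ^ 2) := by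
  simp only [legendreModel, WeierstrassCurve.Δ, WeierstrassCurve.b₂, WeierstrassCurve.b₄,
    WeierstrassCurve.b₆, WeierstrassCurve.b₈]
  ring

end

variable {R : Type*} [CommRing R] [IsDomain R] [IsDiscreteValuationRing R] {K : Type*}
  [Field K] [Algebra R K] [IsFractionRing R K] [Fintype (ResidueField R)]

/-- The Legendre model always meets the minimality criterion: Δ is a unit unless s reduces to 0 or
1, and then c₄ = 16 (s² - s + 1) is a unit. In these two cases -c₄ c₆ reduces to 32² times 1 or -1,
in agreement with `legSum_zero` and `legSum_one`. -/
theorem localPolynomial_legendre (W : WeierstrassCurve K) (s : R)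
    (hW : ∃ C : VariableChange K, C • W = (legendreModel s).map (algebraMap R K))
    (hs0 : s ≠ 0) (hs1 : s ≠ 1) (hk : ringChar (ResidueField R) ≠ 2) :
    W.localPolynomial R = legPoly (residue R s) := by
  have h2k : (2 : ResidueField R) ≠ 0 := Ring.two_ne_zero hk
  have hunit : ∀ x : R, IsUnit x ↔ residue R x ≠ 0 := fun x => by
    rw [Ne, residue_eq_zero_iff, mem_maximalIdeal, mem_nonunits_iff, not_not]
  have h2 : IsUnit (2 : R) := by
    rw [hunit, map_ofNat]; exact h2k
  have h16 : IsUnit (16 : R) := by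
    rw [show (16 : R) = 2 ^ 4 by norm_num]; exact h2.pow 4
  have h16k : (16 : ResidueField R) ≠ 0 := by
    rw [show (16 : ResidueField R) = 2 ^ 4 by norm_num]; exact pow_ne_zero 4 h2k
  have hΔ : (legendreModel s).Δ ≠ 0 := by
    rw [legendreModel_Δ]
    exact mul_ne_zero h16.ne_zero (mul_ne_zero (pow_ne_zero 2 hs0)
      (pow_ne_zero 2 (sub_ne_zero.2 (Ne.symm hs1))))
  have hΔu : IsUnit (legendreModel s).Δ ↔ ¬ (residue R s = 0 ∨ residue R s = 1) := by
    rw [hunit, legendreModel_Δ, not_or]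
    simp only [map_mul, map_pow, map_sub, map_one, map_ofNat, ne_eq, mul_eq_zero, not_or, h16k,
      not_false_eq_true, true_and, OfNat.ofNat_ne_zero, pow_eq_zero_iff, sub_eq_zero]
    rw [eq_comm (a := (1 : ResidueField R))]
  have hc₄u : residue R s = 0 ∨ residue R s = 1 → IsUnit (legendreModel s).c₄ := by
    intro h
    rw [hunit, legendreModel_c₄]
    rcases h with h | h <;> simpa [h] using h16
  have hE : ∀ a ∈ maximalIdeal R, a ^ 4 ∣ (legendreModel s).c₄ → ¬ a ^ 12 ∣ (legendreModel s).Δ := by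
    intro a ha h4 h12
    rw [mem_maximalIdeal, mem_nonunits_iff] at ha
    by_cases h : residue R s = 0 ∨ residue R s = 1
    · exact ha ((isUnit_pow_iff (by norm_num)).1 (isUnit_of_dvd_unit h4 (hc₄u h)))
    · exact ha ((isUnit_pow_iff (by norm_num)).1 (isUnit_of_dvd_unit h12 (hΔu.2 h)))
  obtain ⟨hgood, hbad⟩ := localPolynomial_eq W (legendreModel s) hW hΔ hE hk
  by_cases h : residue R s = 0 ∨ residue R s = 1
  · rw [hbad (by rw [hΔu, not_not]; exact h), legPoly, if_pos h, add_zero, sub_eq_add_neg,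
      ← neg_mul, ← C_neg]
    congr 3
    have h32 : (32 : ResidueField R) ≠ 0 := by
      rw [show (32 : ResidueField R) = 2 ^ 5 by norm_num]; exact pow_ne_zero 5 h2k
    rw [legendreModel_c₄, legendreModel_c₆]
    rcases h with h | h
    · have e : residue R (-(16 * (s ^ 2 - s + 1)) * (-32 * ((1 + s) * (2 * s ^ 2 - 5 * s + 2)))) =
          32 ^ 2 * 1 := by
        simp only [map_mul, map_add, map_sub, map_pow, map_one, map_ofNat, map_neg, h]
        ring
      rw [e, h, legSum_zero hk, quadChi_sq_mul h32, map_one]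
    · have e : residue R (-(16 * (s ^ 2 - s + 1)) * (-32 * ((1 + s) * (2 * s ^ 2 - 5 * s + 2)))) =
          32 ^ 2 * -1 := by
        simp only [map_mul, map_add, map_sub, map_pow, map_one, map_ofNat, map_neg, h]
        ring
      rw [e, h, legSum_one hk, quadChi_sq_mul h32]
  · rw [hgood (hΔu.2 h), legPoly, if_neg h, legSum]
    congr 4
    refine Finset.sum_congr rfl fun x _ => ?_
    rw [← quadChi_sq_mul h2k (x * (x + 1) * (x + residue R s))]
    congr 1
    rw [legendreModel_b₂, legendreModel_b₄, legendreModel_b₆]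
    simp only [map_mul, map_add, map_one, map_ofNat, map_zero]
    ring

end LegendreLocal

/-! ### The places of `F(t)` -/

section Places

open WeierstrassCurve IsLocalRing Polynomial IsDedekindDomain

/-- The monic irreducible polynomials. -/
abbrev MonicIrr (F : Type*) [Field F] : Type _ := {P : F[X] // P.Monic ∧ Irreducible P}

variable {F : Type*} [Field F]

/-- The maximal ideal of `F[t]` generated by a monic irreducible polynomial. -/
abbrev MonicIrr.toPrime (P : MonicIrr F) : HeightOneSpectrum F[X] where
  asIdeal := Ideal.span {P.1}
  isPrime := (Ideal.span_singleton_prime P.2.2.ne_zero).2 P.2.2.prime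
  ne_bot := by
    rw [Ne, Ideal.span_singleton_eq_bot]
    exact P.2.2.ne_zero

lemma MonicIrr.mem_toPrime (P : MonicIrr F) (f : F[X]) : f ∈ P.toPrime.asIdeal ↔ P.1 ∣ f :=
  Ideal.mem_span_singleton

/-- The place of `F(t)` attached to a monic irreducible polynomial. -/
def finitePlace (P : MonicIrr F) : Place (RatFunc F) :=
  ⟨(P.toPrime.valuation (RatFunc F)).valuationSubring,
    (P.toPrime.valuation (RatFunc F)).valuationSubring_isDiscreteValuationRing⟩

open Classical in
/-- The place at infinity of `F(t)`. -/
def inftyPlace (F : Type*) [Field F] : Place (RatFunc F) :=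
  ⟨(RatFunc.inftyValuation F).valuationSubring,
    (RatFunc.inftyValuation F).valuationSubring_isDiscreteValuationRing⟩

/-- Polynomials are integral at the finite places. -/
def polyHom (P : MonicIrr F) : F[X] →+* (finitePlace P).1 :=
  (algebraMap F[X] (RatFunc F)).codRestrict (finitePlace P).1.toSubring fun f =>
    (Valuation.mem_valuationSubring_iff _ _).2 (P.toPrime.valuation_le_one f)

lemma coe_polyHom (P : MonicIrr F) (f : F[X]) :
    (polyHom P f : RatFunc F) = algebraMap F[X] (RatFunc F) f := rfl

/-- The reduction of polynomials at a finite place. -/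
def polyResidue (P : MonicIrr F) : F[X] →+* ResidueField (finitePlace P).1 :=
  (residue _).comp (polyHom P)

lemma polyResidue_eq_zero_iff (P : MonicIrr F) (f : F[X]) : polyResidue P f = 0 ↔ P.1 ∣ f := by
  rw [polyResidue, RingHom.comp_apply, residue_eq_zero_iff]
  refine (Valuation.mem_maximalIdeal_iff (RatFunc F) (P.toPrime.valuation (RatFunc F))).trans ?_
  rw [← MonicIrr.mem_toPrime]
  exact P.toPrime.valuation_lt_one_iff_mem f

/-- An integral element has a denominator prime to `P`, which by Bézout has a polynomial inverse
modulo `P`. -/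
lemma polyResidue_surjective (P : MonicIrr F) : Function.Surjective (polyResidue P) := by
  intro y
  obtain ⟨x, rfl⟩ := residue_surjective y
  obtain ⟨n, ⟨d, hd⟩, hnd⟩ := P.toPrime.exists_primeCompl_mul_eq_of_integer (x : RatFunc F)
    ((Valuation.mem_valuationSubring_iff _ _).1 x.2)
  have hdP : ¬ P.1 ∣ d := fun h => hd ((P.mem_toPrime d).2 h)
  obtain ⟨a, b, hab⟩ := (P.2.2.coprime_iff_not_dvd).2 hdP
  have h1 : x * polyHom P d = polyHom P n := Subtype.ext hnd
  have h2 := congrArg (residue _) h1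
  rw [map_mul] at h2
  have h3 := congrArg (polyResidue P) hab
  rw [map_add, map_mul, map_mul, map_one, (polyResidue_eq_zero_iff P P.1).2 dvd_rfl, mul_zero,
    zero_add] at h3
  refine ⟨n * b, ?_⟩
  rw [map_mul]
  change residue _ x * polyResidue P d = polyResidue P n at h2
  rw [← h2]
  linear_combination (residue _ x) * h3

/-- If `P` does not divide `Q`, then 1/Q is integral at `P` but not at `Q`. -/
lemma finitePlace_injective : Function.Injective (finitePlace (F := F)) := by
  intro P Q h
  have h1 : P.1 ∣ Q.1 := by
    by_contra hn
    have hv : P.toPrime.valuation (RatFunc F) (algebraMap F[X] (RatFunc F) Q.1)⁻¹ ≤ 1 := by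
      rw [map_inv₀]
      have : P.toPrime.valuation (RatFunc F) (algebraMap F[X] (RatFunc F) Q.1) = 1 :=
        P.toPrime.valuation_eq_one_iff_notMem.2 fun hm => hn ((P.mem_toPrime _).1 hm)
      rw [this, inv_one]
    have hQ : (algebraMap F[X] (RatFunc F) Q.1)⁻¹ ∈ (finitePlace Q).1 := by
      rw [← h]
      exact (Valuation.mem_valuationSubring_iff _ _).2 hv
    have h2 := (Valuation.mem_valuationSubring_iff _ _).1 hQ
    have h3 : Q.toPrime.valuation (RatFunc F) (algebraMap F[X] (RatFunc F) Q.1) < 1 :=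
      (Q.toPrime.valuation_lt_one_iff_mem _).2 ((Q.mem_toPrime _).2 dvd_rfl)
    have hne : (algebraMap F[X] (RatFunc F) Q.1) ≠ 0 := by
      rw [Ne, FaithfulSMul.algebraMap_eq_zero_iff]
      exact Q.2.2.ne_zero
    rw [map_inv₀] at h2
    have h4 : Q.toPrime.valuation (RatFunc F) (algebraMap F[X] (RatFunc F) Q.1) ≠ 0 :=
      (Valuation.ne_zero_iff _).2 hne
    exact absurd ((inv_le_one₀ (zero_lt_iff.2 h4)).1 h2) (not_le.2 h3)
  refine Subtype.ext (eq_of_monic_of_associated P.2.1 Q.2.1 ?_)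
  exact (Irreducible.associated_of_dvd P.2.2 Q.2.2 h1)

lemma X_mem_finitePlace (P : MonicIrr F) : RatFunc.X ∈ (finitePlace P).1 := by
  rw [← RatFunc.algebraMap_X]
  exact (polyHom P X).2

lemma X_notMem_inftyPlace : RatFunc.X ∉ (inftyPlace F).1 := by
  classical
  rw [inftyPlace]
  intro h
  have := (Valuation.mem_valuationSubring_iff _ _).1 h
  rw [RatFunc.inftyValuation.X] at this
  exact absurd this (by simp [← WithZero.exp_zero])

variable [Fintype F]

lemma eq_inftyPlace (v : Place (RatFunc F)) (hv : RatFunc.X ∉ v.1) : v = inftyPlace F := by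
  classical
  have hlt : 1 < v.1.valuation RatFunc.X := by
    rw [← not_le, ValuationSubring.valuation_le_one_iff]
    exact hv
  have h := RatFunc.valuation_isEquiv_inftyValuation_of_one_lt_valuation_X hlt
  rw [Valuation.isEquiv_iff_valuationSubring, ValuationSubring.valuationSubring_valuation] at h
  refine Subtype.ext (h.trans ?_)
  rw [inftyPlace]

/-- Every valuation is trivial on the finite field of constants, so integrality of t is enough. -/
lemma algebraMap_mem_place (v : Place (RatFunc F)) (hv : RatFunc.X ∈ v.1) (f : F[X]) :
    algebraMap F[X] (RatFunc F) f ∈ v.1 := by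
  induction f using Polynomial.induction_on' with
  | add f g hf hg =>
    rw [map_add]
    exact add_mem hf hg
  | monomial n a =>
    rw [← C_mul_X_pow_eq_monomial, map_mul, map_pow, RatFunc.algebraMap_X, RatFunc.algebraMap_C]
    refine mul_mem ?_ (pow_mem hv n)
    rw [← ValuationSubring.valuation_le_one_iff]
    by_cases ha : a = 0
    · simp [ha]
    · exact (Valuation.IsTrivialOn.eq_one (v := v.1.valuation) a ha).le

/-- The polynomials in the maximal ideal of `v` form a prime ideal, nonzero because otherwise `v`
would be all of F(t). Its monic generator `P` has its local ring inside `v`, and a discrete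
valuation ring is a maximal proper subring of its fraction field. -/
lemma exists_eq_finitePlace (v : Place (RatFunc F)) (hv : RatFunc.X ∈ v.1) :
    ∃ P, v = finitePlace P := by
  classical
  set φ : F[X] →+* v.1 := (algebraMap F[X] (RatFunc F)).codRestrict v.1.toSubring
    (algebraMap_mem_place v hv) with hφ
  have hφc : ∀ f, (φ f : RatFunc F) = algebraMap F[X] (RatFunc F) f := fun f => rfl
  set I := (maximalIdeal v.1).comap φ with hI
  have hIp : I.IsPrime := Ideal.IsPrime.comap φ
  have hunit : ∀ f, f ∉ I → (algebraMap F[X] (RatFunc F) f)⁻¹ ∈ v.1 := by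
    intro f hf
    rw [hI, Ideal.mem_comap, mem_maximalIdeal, mem_nonunits_iff, not_not] at hf
    obtain ⟨w, hw⟩ := hf.exists_right_inv
    have : (algebraMap F[X] (RatFunc F) f)⁻¹ = w := by
      refine inv_eq_of_mul_eq_one_right ?_
      rw [← hφc]
      exact congrArg Subtype.val hw
    rw [this]
    exact w.2
  have htop : v.1 ≠ ⊤ := by
    intro h
    refine IsDiscreteValuationRing.not_isField v.1 ?_
    refine ⟨⟨0, 1, zero_ne_one⟩, mul_comm, fun {a} ha => ⟨⟨(a : RatFunc F)⁻¹, ?_⟩, ?_⟩⟩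
    · exact h.symm.le (ValuationSubring.mem_top (a : RatFunc F)⁻¹)
    · refine Subtype.ext (mul_inv_cancel₀ ?_)
      intro h0
      exact ha (Subtype.ext h0)
  have hI0 : I ≠ ⊥ := by
    intro h
    refine htop (top_le_iff.1 fun x _ => ?_)
    obtain ⟨a, b, hb, rfl⟩ := IsFractionRing.div_surjective (A := F[X]) x
    rw [div_eq_mul_inv]
    refine mul_mem (algebraMap_mem_place v hv a) (hunit b ?_)
    rw [h, Ideal.mem_bot]
    exact nonZeroDivisors.ne_zero hb
  set g := Submodule.IsPrincipal.generator I with hg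
  have hgI : Ideal.span {g} = I := Ideal.span_singleton_generator I
  have hg0 : g ≠ 0 := by
    intro h
    rw [h, Ideal.span_singleton_eq_bot.2 rfl] at hgI
    exact hI0 hgI.symm
  have hgirr : Irreducible g :=
    (Submodule.IsPrincipal.prime_generator_of_isPrime I hI0).irreducible
  have hass : Associated (normalize g) g := normalize_associated g
  let P : MonicIrr F := ⟨normalize g, monic_normalize hg0, hass.symm.irreducible hgirr⟩
  have hP : P.toPrime.asIdeal = I := by
    rw [← hgI]
    exact Ideal.span_singleton_eq_span_singleton.2 hass
  refine ⟨P, ?_⟩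
  symm
  refine Subtype.ext (ValuationSubring.eq_of_le_of_ne_top _ ?_ htop)
  intro x hx
  obtain ⟨n, ⟨d, hd⟩, hnd⟩ := P.toPrime.exists_primeCompl_mul_eq_of_integer x
    ((Valuation.mem_valuationSubring_iff _ _).1 hx)
  have hdI : d ∉ I := by
    rw [← hP]; exact hd
  have hd0 : algebraMap F[X] (RatFunc F) d ≠ 0 := by
    rw [Ne, FaithfulSMul.algebraMap_eq_zero_iff]
    rintro rfl
    exact hdI (zero_mem I)
  have : x = algebraMap F[X] (RatFunc F) n * (algebraMap F[X] (RatFunc F) d)⁻¹ := by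
    rw [← hnd, mul_inv_cancel_right₀ hd0]
  rw [this]
  exact mul_mem (algebraMap_mem_place v hv n) (hunit d hdI)

/-- The places of `F(t)` are those attached to the monic irreducible polynomials and the place
at infinity. -/
def placeEquiv (F : Type*) [Field F] [Fintype F] : Option (MonicIrr F) ≃ Place (RatFunc F) :=
  Equiv.ofBijective (fun o => o.elim (inftyPlace F) finitePlace) <| by
    constructor
    · rintro (_ | P) (_ | Q) h
      · rfl
      · exact absurd (X_mem_finitePlace Q)
          ((show inftyPlace F = finitePlace Q from h) ▸ X_notMem_inftyPlace)
      · exact absurd (X_mem_finitePlace P)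
          ((show finitePlace P = inftyPlace F from h) ▸ X_notMem_inftyPlace)
      · exact congrArg some (finitePlace_injective h)
    · intro v
      by_cases hv : RatFunc.X ∈ v.1
      · obtain ⟨P, rfl⟩ := exists_eq_finitePlace v hv
        exact ⟨some P, rfl⟩
      · exact ⟨none, (eq_inftyPlace v hv).symm⟩

end Places

/-! ### The Euler factors of the Legendre curves -/

section EulerFactors

open WeierstrassCurve IsLocalRing Polynomial IsDedekindDomain

lemma ringChar_ne_two_of_ringHom {k l : Type*} [Field k] [Field l] (φ : k →+* l)
    (hk : ringChar k ≠ 2) : ringChar l ≠ 2 := by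
  let _ := φ.toAlgebra
  rwa [← Algebra.ringChar_eq k l]

lemma toPowerSeries_expand (m : ℕ) (hm : m ≠ 0) (p : ℤ[X]) :
    (Polynomial.expand ℤ m p).toPowerSeries = PowerSeries.expand m hm p.toPowerSeries := by
  ext n
  rw [Polynomial.coeff_coe, PowerSeries.coeff_expand, Polynomial.coeff_coe,
    Polynomial.coeff_expand (Nat.pos_of_ne_zero hm)]

lemma constantCoeff_eulerFactor {K : Type*} [Field K] (q : ℕ) (W : WeierstrassCurve K)
    (v : Place K) : PowerSeries.constantCoeff (eulerFactor q W v) = 1 := by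
  rw [eulerFactor, PowerSeries.constantCoeff_invOfUnit, inv_one, Units.val_one]

lemma hasDLog_eulerFactor {K : Type*} [Field K] (q : ℕ) (W : WeierstrassCurve K)
    (v : Place K) {m : ℕ} (hv : v.deg q = m) (hm : m ≠ 0) {σ : ℤ⟦X⟧} (h0 : (W.localPolynomial v.1).coeff 0 = 1)
    (h : HasDLog (W.localPolynomial v.1).toPowerSeries σ) :
    HasDLog (eulerFactor q W v) (-((m : ℤ⟦X⟧) * PowerSeries.expand m hm σ)) := by
  subst hv
  have h1 := h.expand (v.deg q) hm
  rw [← toPowerSeries_expand] at h1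
  refine h1.of_mul_eq_one ?_
  rw [eulerFactor]
  refine PowerSeries.mul_invOfUnit _ 1 ?_
  rw [← PowerSeries.coeff_zero_eq_constantCoeff_apply, Polynomial.coeff_coe,
    Polynomial.coeff_expand (Nat.pos_of_ne_zero hm), if_pos (dvd_zero _), Nat.zero_div, h0,
    Units.val_one]

lemma legPoly_coeff_zero {k : Type*} [Field k] [Fintype k] (s : k) : (legPoly s).coeff 0 = 1 := by
  rw [legPoly]
  split_ifs <;> simp

variable {F : Type*} [Field F] [Fintype F]

lemma natCard_residueField_finitePlace (P : MonicIrr F) :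
    Nat.card (ResidueField (finitePlace P).1) = Fintype.card F ^ P.1.natDegree := by
  have hker : RingHom.ker (polyResidue P) = Ideal.span {P.1} := by
    ext f
    rw [RingHom.mem_ker, polyResidue_eq_zero_iff, Ideal.mem_span_singleton]
  have e := RingHom.quotientKerEquivOfSurjective (polyResidue_surjective P)
  have hfin : Module.Finite F (F[X] ⧸ Ideal.span {P.1}) :=
    P.2.1.finite_quotient
  rw [← Nat.card_congr ((Ideal.quotEquivOfEq hker.symm).trans e).toEquiv, Module.natCard_eq_pow_finrank (K := F),
    finrank_quotient_span_eq_natDegree, Nat.card_eq_fintype_card]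

instance (P : MonicIrr F) : Fintype (ResidueField (finitePlace P).1) :=
  have : Finite (ResidueField (finitePlace P).1) := Nat.finite_of_card_ne_zero (by
    rw [natCard_residueField_finitePlace]
    exact pow_ne_zero _ Fintype.card_ne_zero)
  Fintype.ofFinite _

lemma card_residueField_finitePlace (P : MonicIrr F) :
    Fintype.card (ResidueField (finitePlace P).1) = Fintype.card F ^ P.1.natDegree := by
  rw [← Nat.card_eq_fintype_card, natCard_residueField_finitePlace]

lemma deg_finitePlace (P : MonicIrr F) :
    (finitePlace P).deg (Fintype.card F) = P.1.natDegree := by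
  rw [Place.deg, natCard_residueField_finitePlace]
  exact Nat.log_pow Fintype.one_lt_card _

omit [Fintype F] in
lemma ringChar_residueField_finitePlace (hF : ringChar F ≠ 2) (P : MonicIrr F) :
    ringChar (ResidueField (finitePlace P).1) ≠ 2 :=
  ringChar_ne_two_of_ringHom ((polyResidue P).comp C) hF

/-- The logarithmic derivative of the local polynomial of `E_d` at a finite place. -/
def finiteSeries (d : ℕ) (P : MonicIrr F) : ℤ⟦X⟧ :=
  PowerSeries.mk (primeSum (legHom (polyResidue P (X ^ d))))

theorem hasDLog_eulerFactor_finitePlace (hF : ringChar F ≠ 2) {d : ℕ} (hd : d ≠ 0)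
    (P : MonicIrr F) :
    HasDLog (eulerFactor (Fintype.card F) (legendreCurve F d) (finitePlace P))
      (-((P.1.natDegree : ℤ⟦X⟧) *
        PowerSeries.expand P.1.natDegree P.2.2.natDegree_pos.ne' (finiteSeries d P))) := by
  have hcoe : ((polyHom P (X ^ d) : (finitePlace P).1) : RatFunc F) = RatFunc.X ^ d := by
    rw [coe_polyHom, map_pow, RatFunc.algebraMap_X]
  have hW : ∃ C : VariableChange (RatFunc F), C • legendreCurve F d =
      (legendreModel (polyHom P (X ^ d))).map (algebraMap (finitePlace P).1 (RatFunc F)) := by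
    refine ⟨1, ?_⟩
    rw [one_smul]
    have h : algebraMap (finitePlace P).1 (RatFunc F) (polyHom P (X ^ d)) = RatFunc.X ^ d := hcoe
    ext <;> simp only [legendreCurve, legendreModel, map_a₁, map_a₂, map_a₃, map_a₄, map_a₆,
      map_zero, map_add, map_one, h]
  have hs0 : polyHom P (X ^ d) ≠ 0 := by
    intro h
    have h1 := congrArg (Subtype.val) h
    rw [hcoe] at h1
    exact pow_ne_zero d RatFunc.X_ne_zero h1
  have hs1 : polyHom P (X ^ d) ≠ 1 := by
    intro h
    have h1 := congrArg (Subtype.val) h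
    rw [coe_polyHom] at h1
    have h2 : (X ^ d : F[X]) = 1 := by
      apply IsFractionRing.injective F[X] (RatFunc F)
      rw [h1, map_one]
      rfl
    have h3 := congrArg natDegree h2
    rw [natDegree_X_pow, natDegree_one] at h3
    exact hd h3
  have hloc := localPolynomial_legendre (legendreCurve F d) (polyHom P (X ^ d)) hW hs0 hs1
    (ringChar_residueField_finitePlace hF P)
  have h := hasDLog_eulerFactor (Fintype.card F) (legendreCurve F d) (finitePlace P)
    (deg_finitePlace P) P.2.2.natDegree_pos.ne'
    (σ := finiteSeries d P)
    (by rw [hloc, legPoly_coeff_zero])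
    (by
      rw [hloc]
      exact hasDLog_legPoly (ringChar_residueField_finitePlace hF P) _)
  exact h

/-- Sending t to x embeds the residue field at `P` into `L`, with degree [L : F] / deg P, and
carries the reduction of t^d to x^d. -/
theorem coeff_finiteSeries (hF : ringChar F ≠ 2) (d : ℕ) (P : MonicIrr F) {L : Type*} [Field L]
    [Fintype L] [Algebra F L] (x : L) (hx : aeval x P.1 = 0) :
    PowerSeries.coeff (Module.finrank F L / P.1.natDegree) (finiteSeries d P) =
      legSum L (x ^ d) := by
  have hker : RingHom.ker (polyResidue P) ≤ RingHom.ker (aeval x : F[X] →ₐ[F] L).toRingHom := by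
    intro f hf
    obtain ⟨g, rfl⟩ := (polyResidue_eq_zero_iff P f).1 hf
    rw [RingHom.mem_ker]
    change aeval x (P.1 * g) = 0
    rw [map_mul, hx, zero_mul]
  set θ : ResidueField (finitePlace P).1 →+* L := RingHom.liftOfSurjective (polyResidue P)
    (polyResidue_surjective P) ⟨(aeval x : F[X] →ₐ[F] L).toRingHom, hker⟩ with hθ
  have hθx : θ (polyResidue P (X ^ d)) = x ^ d := by
    have h := RingHom.liftOfRightInverse_comp_apply (polyResidue P)
      (Function.surjInv (polyResidue_surjective P))
      (Function.rightInverse_surjInv (polyResidue_surjective P))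
      ⟨(aeval x : F[X] →ₐ[F] L).toRingHom, hker⟩ (X ^ d)
    rw [hθ]
    refine h.trans ?_
    change aeval x (X ^ d) = x ^ d
    simp
  let _ := θ.toAlgebra
  have hfin : Module.finrank F L / P.1.natDegree =
      Module.finrank (ResidueField (finitePlace P).1) L := by
    have h1 := Module.card_eq_pow_finrank (K := F) (V := L)
    have h2 := Module.card_eq_pow_finrank (K := ResidueField (finitePlace P).1) (V := L)
    rw [card_residueField_finitePlace, ← pow_mul, h1] at h2
    rw [Nat.pow_right_injective Fintype.one_lt_card h2,
      Nat.mul_div_cancel_left _ P.2.2.natDegree_pos]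
  rw [hfin, finiteSeries, PowerSeries.coeff_mk,
    primeSum_legHom (ringChar_residueField_finitePlace hF P)]
  congr 1

end EulerFactors

/-! ### The place at infinity and the reduction of `E_d` there. -/

section Infinity

open WeierstrassCurve IsLocalRing Polynomial IsDedekindDomain

variable {F : Type*} [Field F]

lemma mem_inftyPlace {x : RatFunc F} (hx : x ≠ 0) : x ∈ (inftyPlace F).1 ↔ x.intDegree ≤ 0 := by
  classical
  rw [inftyPlace]
  refine (Valuation.mem_valuationSubring_iff _ _).trans ?_
  rw [RatFunc.inftyValuation_apply, RatFunc.inftyValuation_of_nonzero _ hx]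
  rw [← WithZero.exp_zero, WithZero.exp_le_exp]

lemma residue_inftyPlace_eq_zero_iff (x : (inftyPlace F).1) (hx : (x : RatFunc F) ≠ 0) :
    residue (inftyPlace F).1 x = 0 ↔ (x : RatFunc F).intDegree < 0 := by
  classical
  rw [residue_eq_zero_iff]
  have h : x ∈ maximalIdeal (inftyPlace F).1 ↔ RatFunc.inftyValuation F (x : RatFunc F) < 1 := by
    exact Valuation.mem_maximalIdeal_iff (RatFunc F) (RatFunc.inftyValuation F)
  rw [h, RatFunc.inftyValuation_apply, RatFunc.inftyValuation_of_nonzero _ hx,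
    ← WithZero.exp_zero, WithZero.exp_lt_exp]

/-- Constants are integral at infinity. -/
def constHom (F : Type*) [Field F] : F →+* (inftyPlace F).1 :=
  (RatFunc.C : F →+* RatFunc F).codRestrict (inftyPlace F).1.toSubring fun c => by
    by_cases hc : c = 0
    · rw [hc, map_zero]; exact zero_mem _
    · have hc' : (RatFunc.C c : RatFunc F) ≠ 0 := by
        rw [Ne, map_eq_zero]; exact hc
      refine (mem_inftyPlace hc').2 ?_
      rw [RatFunc.intDegree_C]

/-- A unit at infinity is a quotient of polynomials of equal degree; it is congruent to the quotient
of their leading coefficients. -/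
lemma residue_constHom_surjective :
    Function.Surjective ((residue (inftyPlace F).1).comp (constHom F)) := by
  intro y
  obtain ⟨x, rfl⟩ := residue_surjective y
  by_cases h0 : residue (inftyPlace F).1 x = 0
  · exact ⟨0, by rw [map_zero, h0]⟩
  have hx0 : (x : RatFunc F) ≠ 0 := by
    intro h
    have : x = 0 := Subtype.ext h
    rw [this, map_zero] at h0
    exact h0 rfl
  have hle := (mem_inftyPlace hx0).1 x.2
  have hge := mt (residue_inftyPlace_eq_zero_iff x hx0).2 h0
  have hdeg : (x : RatFunc F).intDegree = 0 := le_antisymm hle (not_lt.1 hge)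
  obtain ⟨a, b, hb, hab⟩ := IsFractionRing.div_surjective (A := F[X]) (x : RatFunc F)
  have hb0 : b ≠ 0 := nonZeroDivisors.ne_zero hb
  have hbK : algebraMap F[X] (RatFunc F) b ≠ 0 := by
    rwa [Ne, FaithfulSMul.algebraMap_eq_zero_iff]
  have ha0 : a ≠ 0 := by
    rintro rfl
    rw [map_zero, zero_div] at hab
    exact hx0 hab.symm
  have haK : algebraMap F[X] (RatFunc F) a ≠ 0 := by
    rwa [Ne, FaithfulSMul.algebraMap_eq_zero_iff]
  have hd : a.natDegree = b.natDegree := by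
    rw [← hab, RatFunc.intDegree_div haK hbK, RatFunc.intDegree_polynomial,
      RatFunc.intDegree_polynomial] at hdeg
    omega
  set c := a.leadingCoeff / b.leadingCoeff with hc
  have hlb : b.leadingCoeff ≠ 0 := leadingCoeff_ne_zero.2 hb0
  have hc0 : c ≠ 0 := div_ne_zero (leadingCoeff_ne_zero.2 ha0) hlb
  refine ⟨c, ?_⟩
  rw [RingHom.comp_apply, ← sub_eq_zero, ← map_sub]
  by_cases hz : ((constHom F c - x : (inftyPlace F).1) : RatFunc F) = 0
  · rw [show constHom F c - x = 0 from Subtype.ext hz, map_zero]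
  rw [residue_inftyPlace_eq_zero_iff _ hz]
  have hxe : ((constHom F c - x : (inftyPlace F).1) : RatFunc F) =
      algebraMap F[X] (RatFunc F) (C c * b - a) / algebraMap F[X] (RatFunc F) b := by
    rw [map_sub, map_mul, RatFunc.algebraMap_C, sub_div, mul_div_cancel_right₀ _ hbK, hab]
    rfl
  rw [hxe] at hz ⊢
  have hn0 : algebraMap F[X] (RatFunc F) (C c * b - a) ≠ 0 := by
    intro h
    rw [h, zero_div] at hz
    exact hz rfl
  have hn0' : C c * b - a ≠ 0 := by
    intro h
    rw [h, map_zero] at hn0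
    exact hn0 rfl
  rw [RatFunc.intDegree_div hn0 hbK, RatFunc.intDegree_polynomial, RatFunc.intDegree_polynomial]
  have hlt : (C c * b - a).degree < (C c * b).degree := by
    refine degree_sub_lt_left ?_ (mul_ne_zero (C_ne_zero.2 hc0) hb0) ?_
    · rw [degree_C_mul hc0, degree_eq_natDegree hb0, degree_eq_natDegree ha0, hd]
    · rw [leadingCoeff_mul, leadingCoeff_C, hc, div_mul_cancel₀ _ hlb]
  rw [degree_C_mul hc0] at hlt
  have := natDegree_lt_natDegree hn0' hlt
  omega

variable [Fintype F]

lemma natCard_residueField_inftyPlace :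
    Nat.card (ResidueField (inftyPlace F).1) = Fintype.card F := by
  rw [← Nat.card_eq_fintype_card]
  exact (Nat.card_congr (Equiv.ofBijective _ ⟨RingHom.injective _,
    residue_constHom_surjective (F := F)⟩)).symm

instance : Fintype (ResidueField (inftyPlace F).1) :=
  have : Finite (ResidueField (inftyPlace F).1) := Nat.finite_of_card_ne_zero (by
    rw [natCard_residueField_inftyPlace]
    exact Fintype.card_ne_zero)
  Fintype.ofFinite _

lemma deg_inftyPlace : (inftyPlace F).deg (Fintype.card F) = 1 := by
  rw [Place.deg, natCard_residueField_inftyPlace]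
  simpa using Nat.log_pow (Fintype.one_lt_card (α := F)) 1

omit [Fintype F] in
lemma ringChar_residueField_inftyPlace (hF : ringChar F ≠ 2) :
    ringChar (ResidueField (inftyPlace F).1) ≠ 2 :=
  ringChar_ne_two_of_ringHom ((residue (inftyPlace F).1).comp (constHom F)) hF

/-- The uniformizer `t⁻¹` at infinity. -/
def inftyUnif (F : Type*) [Field F] : (inftyPlace F).1 :=
  ⟨RatFunc.X⁻¹, (mem_inftyPlace (inv_ne_zero RatFunc.X_ne_zero)).2 (by
    rw [RatFunc.intDegree_inv, RatFunc.intDegree_X]; norm_num)⟩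

omit [Fintype F] in
lemma inftyUnif_ne_zero : inftyUnif F ≠ 0 := fun h =>
  inv_ne_zero RatFunc.X_ne_zero (congrArg Subtype.val h)

omit [Fintype F] in
lemma residue_inftyUnif : residue (inftyPlace F).1 (inftyUnif F) = 0 := by
  rw [residue_inftyPlace_eq_zero_iff _ (inv_ne_zero RatFunc.X_ne_zero)]
  change (RatFunc.X⁻¹ : RatFunc F).intDegree < 0
  rw [RatFunc.intDegree_inv, RatFunc.intDegree_X]
  norm_num

omit [Fintype F] in
lemma inftyUnif_dvd {x : (inftyPlace F).1} (hx : x ∈ maximalIdeal (inftyPlace F).1) :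
    inftyUnif F ∣ x := by
  by_cases h0 : (x : RatFunc F) = 0
  · rw [show x = 0 from Subtype.ext h0]; exact dvd_zero _
  have h1 := (residue_inftyPlace_eq_zero_iff x h0).1 ((residue_eq_zero_iff x).2 hx)
  refine ⟨⟨RatFunc.X * (x : RatFunc F), (mem_inftyPlace (mul_ne_zero RatFunc.X_ne_zero h0)).2 ?_⟩, ?_⟩
  · rw [RatFunc.intDegree_mul RatFunc.X_ne_zero h0, RatFunc.intDegree_X]
    omega
  · refine Subtype.ext ?_
    change (x : RatFunc F) = RatFunc.X⁻¹ * (RatFunc.X * (x : RatFunc F))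
    rw [inv_mul_cancel_left₀ RatFunc.X_ne_zero]

/-- Scaling by t^(d/2) gives the Legendre model with parameter t^(-d), which reduces to s = 0, a
split node. -/
lemma localPolynomial_inftyPlace_of_even (hF : ringChar F ≠ 2) {d : ℕ} (hd : d ≠ 0)
    (hev : Even d) :
    (legendreCurve F d).localPolynomial (inftyPlace F).1 = 1 - X := by
  obtain ⟨m, rfl⟩ := hev
  have hX := RatFunc.X_ne_zero (K := F)
  have hu : algebraMap (inftyPlace F).1 (RatFunc F) (inftyUnif F) = RatFunc.X⁻¹ := rfl
  have hW : ∃ C : VariableChange (RatFunc F), C • legendreCurve F (m + m) =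
      (legendreModel (inftyUnif F ^ (m + m))).map (algebraMap (inftyPlace F).1 (RatFunc F)) := by
    refine ⟨⟨(Units.mk0 RatFunc.X hX) ^ m, 0, 0, 0⟩, ?_⟩
    ext <;> simp only [variableChange_def, legendreCurve, legendreModel, map_a₁, map_a₂, map_a₃,
      map_a₄, map_a₆, map_zero, map_add, map_one, map_pow, hu] <;> simp
    · field_simp
      ring
    · field_simp
      ring
  have hs1 : inftyUnif F ^ (m + m) ≠ 1 := by
    intro h
    have := congrArg (residue (inftyPlace F).1) h
    rw [map_pow, residue_inftyUnif, zero_pow hd, map_one] at this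
    exact zero_ne_one this
  rw [localPolynomial_legendre _ _ hW (pow_ne_zero _ inftyUnif_ne_zero) hs1
    (ringChar_residueField_inftyPlace hF), map_pow, residue_inftyUnif, zero_pow hd, legPoly,
    if_pos (Or.inl rfl), legSum_zero (ringChar_residueField_inftyPlace hF)]
  simp
  ring

/-- Scaling by t^((d+1)/2) gives an integral model with c₄ equal to the square of the uniformizer
times a unit. No fourth power of a nonunit divides it, so the criterion holds, and the reduction is
additive. -/
lemma localPolynomial_inftyPlace_of_odd (hF : ringChar F ≠ 2) {d : ℕ} (hodd : Odd d) :
    (legendreCurve F d).localPolynomial (inftyPlace F).1 = 1 := by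
  obtain ⟨m, rfl⟩ := hodd
  have hX := RatFunc.X_ne_zero (K := F)
  have hk := ringChar_residueField_inftyPlace hF
  set u := inftyUnif F with hu'
  have hu : algebraMap (inftyPlace F).1 (RatFunc F) u = RatFunc.X⁻¹ := rfl
  have hu0 : u ≠ 0 := inftyUnif_ne_zero
  have hur : residue (inftyPlace F).1 u = 0 := residue_inftyUnif
  have hunit : ∀ x : (inftyPlace F).1, IsUnit x ↔ residue (inftyPlace F).1 x ≠ 0 := fun x => by
    rw [Ne, residue_eq_zero_iff, mem_maximalIdeal, mem_nonunits_iff, not_not]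
  have h2k : (2 : ResidueField (inftyPlace F).1) ≠ 0 := Ring.two_ne_zero hk
  let E : WeierstrassCurve (inftyPlace F).1 :=
    ⟨0, u ^ (2 * m + 2) + u, 0, u ^ (2 * m + 3), 0⟩
  have hW : ∃ C : VariableChange (RatFunc F), C • legendreCurve F (2 * m + 1) =
      E.map (algebraMap (inftyPlace F).1 (RatFunc F)) := by
    refine ⟨⟨(Units.mk0 RatFunc.X hX) ^ (m + 1), 0, 0, 0⟩, ?_⟩
    ext <;> simp only [E, variableChange_def, legendreCurve, map_a₁, map_a₂, map_a₃,
      map_a₄, map_a₆, map_zero, map_add, map_pow, hu] <;> simp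
    · field_simp
      ring
    · field_simp
      ring
  have hc₄ : E.c₄ = u ^ 2 * (16 * ((u ^ (2 * m + 1) + 1) ^ 2 - 3 * u ^ (2 * m + 1))) := by
    simp only [E, WeierstrassCurve.c₄, WeierstrassCurve.b₂, WeierstrassCurve.b₄]
    ring
  have hΔ : E.Δ = u ^ 6 * (16 * (u ^ (2 * m + 1)) ^ 2 * (1 - u ^ (2 * m + 1)) ^ 2) := by
    simp only [E, WeierstrassCurve.Δ, WeierstrassCurve.b₂, WeierstrassCurve.b₄,
      WeierstrassCurve.b₆, WeierstrassCurve.b₈]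
    ring
  have h16 : IsUnit (16 : (inftyPlace F).1) := by
    rw [hunit, map_ofNat, show (16 : ResidueField (inftyPlace F).1) = 2 ^ 4 by norm_num]
    exact pow_ne_zero 4 h2k
  have hw : IsUnit (16 * ((u ^ (2 * m + 1) + 1) ^ 2 - 3 * u ^ (2 * m + 1))) := by
    refine h16.mul ?_
    rw [hunit]
    simp [hur]
  have h1u : IsUnit (1 - u ^ (2 * m + 1)) := by
    rw [hunit]
    simp [hur]
  have hΔ0 : E.Δ ≠ 0 := by
    rw [hΔ]
    exact mul_ne_zero (pow_ne_zero _ hu0) (mul_ne_zero (mul_ne_zero h16.ne_zero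
      (pow_ne_zero _ (pow_ne_zero _ hu0))) (pow_ne_zero _ h1u.ne_zero))
  have hE : ∀ a ∈ maximalIdeal (inftyPlace F).1, a ^ 4 ∣ E.c₄ → ¬ a ^ 12 ∣ E.Δ := by
    intro a ha h4
    exfalso
    obtain ⟨b, rfl⟩ := inftyUnif_dvd ha
    obtain ⟨k, hk⟩ := h4
    rw [hc₄] at hk
    have h5 : 16 * ((u ^ (2 * m + 1) + 1) ^ 2 - 3 * u ^ (2 * m + 1)) = u * (u * b ^ 4 * k) := by
      refine mul_left_cancel₀ (pow_ne_zero 2 hu0) ?_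
      rw [hk]
      ring
    have h6 : IsUnit u := isUnit_of_dvd_unit ⟨_, h5⟩ hw
    exact (hunit u).1 h6 hur
  have hbad : ¬ IsUnit E.Δ := by
    rw [hunit, hΔ, not_not, map_mul, map_pow, hur, zero_pow (by norm_num), zero_mul]
  have h46 : residue (inftyPlace F).1 (-E.c₄ * E.c₆) = 0 := by
    rw [map_mul, map_neg, hc₄, map_mul, map_pow, hur, zero_pow two_ne_zero, zero_mul, neg_zero,
      zero_mul]
  rw [(localPolynomial_eq _ E hW hΔ0 hE hk).2 hbad, h46, quadChi_zero]
  simp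

theorem hasDLog_eulerFactor_inftyPlace (hF : ringChar F ≠ 2) {d : ℕ} (hd : d ≠ 0) :
    HasDLog (eulerFactor (Fintype.card F) (legendreCurve F d) (inftyPlace F))
      (PowerSeries.mk fun n => if Even d ∧ n ≠ 0 then 1 else 0) := by
  by_cases hev : Even d
  · have hloc := localPolynomial_inftyPlace_of_even hF hd hev
    have h1 := hasDLog_one_sub_C_mul_X (1 : ℤ)
    have h := hasDLog_eulerFactor (Fintype.card F) (legendreCurve F d) (inftyPlace F) deg_inftyPlace one_ne_zero
      (by rw [hloc]; simp)
      (σ := -PowerSeries.mk fun n => if n = 0 then 0 else 1 ^ n) (by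
        rw [hloc]
        convert h1 using 1
        simp)
    convert h using 1
    ext n
    simp [hev]
  · have hloc := localPolynomial_inftyPlace_of_odd hF (Nat.not_even_iff_odd.1 hev)
    have h := hasDLog_eulerFactor (Fintype.card F) (legendreCurve F d) (inftyPlace F) deg_inftyPlace one_ne_zero
      (by rw [hloc]; simp) (σ := 0) (by
        rw [hloc]
        convert HasDLog.one
        simp)
    convert h using 1
    ext n
    simp [hev]

end Infinity

/-! ### Powers of an injective character of a finite field -/

section InjectiveChar

variable {L : Type*} [Field L] [Fintype L] {R : Type*} [Field R] [CharZero R]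
  {ω : MulChar L R}

omit [CharZero R] in
lemma orderOf_apply_eq_of_injective (hω : Function.Injective ω) :
    ∃ g : Lˣ, orderOf (ω g) = Fintype.card L - 1 := by
  classical
  obtain ⟨g, hg⟩ := IsCyclic.exists_generator (α := Lˣ)
  refine ⟨g, ?_⟩
  have h1 : orderOf (ω (g : L)) = orderOf (g : L) :=
    orderOf_injective (ω.toMonoidHom : L →* R) hω (g : L)
  rw [h1, orderOf_units, orderOf_eq_card_of_forall_mem_zpowers hg, Nat.card_eq_fintype_card,
    Fintype.card_units]

omit [CharZero R] in
lemma sum_pow_mulChar (hω : Function.Injective ω) (n : ℕ) [Decidable (Fintype.card L - 1 ∣ n)] :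
    ∑ x : L, (ω ^ n) x = if Fintype.card L - 1 ∣ n then ((Fintype.card L - 1 : ℕ) : R) else 0 := by
  classical
  split_ifs with h
  · obtain ⟨k, rfl⟩ := h
    rw [pow_mul, ← Fintype.card_units, MulChar.pow_card_eq_one, one_pow,
      MulChar.sum_one_eq_card_units]
  · refine MulChar.sum_eq_zero_of_ne_one fun h1 => h ?_
    obtain ⟨g, hg⟩ := orderOf_apply_eq_of_injective hω
    rw [← hg, orderOf_dvd_iff_pow_eq_one, ← MulChar.pow_apply_coe, h1, MulChar.one_apply_coe]

omit [CharZero R] in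
lemma sum_apply_pow (hω : Function.Injective ω) {y : L} (hy : y ≠ 0) [Decidable (y = 1)] :
    ∑ e ∈ Finset.range (Fintype.card L - 1), ω y ^ e =
      if y = 1 then ((Fintype.card L - 1 : ℕ) : R) else 0 := by
  split_ifs with h
  · simp [h]
  · have h1 : ω y ≠ 1 := fun h2 => h (hω (h2.trans (map_one ω).symm))
    have h3 : ω y ^ (Fintype.card L - 1) = 1 := by
      rw [← map_pow, FiniteField.pow_card_sub_one_eq_one y hy, map_one]
    have h4 := geom_sum_mul (ω y) (Fintype.card L - 1)
    rw [h3, sub_self] at h4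
    exact (mul_eq_zero.1 h4).resolve_right (sub_ne_zero.2 h1)

-- The double sum of ω^e(s) ω^(de)(x) over e and x is computed in both orders. Over x first, the
-- exponents with |L| - 1 ∣ d e survive; over e first, the x with s x^d = 1 survive, and these are
-- the inverses of the solutions.
open Classical in
lemma sum_pow_apply_eq_card (hω : Function.Injective ω) {d : ℕ} (hd : d ≠ 0) {s : L} (hs : s ≠ 0) :
    ∑ e ∈ (Finset.range (Fintype.card L - 1)).filter (fun e => Fintype.card L - 1 ∣ d * e),
      (ω ^ e) s = ((Finset.univ.filter fun x : L => x ^ d = s).card : R) := by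
  set N := Fintype.card L - 1 with hN
  have hN0 : (N : R) ≠ 0 := by
    have := Fintype.one_lt_card (α := L)
    exact_mod_cast (by omega : N ≠ 0)
  have happ : ∀ (e : ℕ) {y : L}, y ≠ 0 → (ω ^ e) y = ω y ^ e := fun e y hy =>
    MulChar.pow_apply_coe ω e (Units.mk0 y hy)
  have hinner : ∀ x : L, ∑ e ∈ Finset.range N, (ω ^ e) s * (ω ^ (d * e)) x =
      if x⁻¹ ^ d = s then (N : R) else 0 := by
    intro x
    by_cases hx : x = 0
    · subst hx
      rw [if_neg (by rw [inv_zero, zero_pow hd]; exact hs.symm)]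
      exact Finset.sum_eq_zero fun e _ => by rw [MulChar.map_zero, mul_zero]
    have hsx : s * x ^ d ≠ 0 := mul_ne_zero hs (pow_ne_zero d hx)
    have h1 : ∀ e, (ω ^ e) s * (ω ^ (d * e)) x = ω (s * x ^ d) ^ e := fun e => by
      rw [happ e hs, happ _ hx, map_mul, map_pow, mul_pow, pow_mul]
    rw [Finset.sum_congr rfl fun e _ => h1 e, sum_apply_pow hω hsx]
    have h2 : s * x ^ d = 1 ↔ x⁻¹ ^ d = s := by
      rw [inv_pow, mul_eq_one_iff_eq_inv₀ (pow_ne_zero d hx), eq_comm]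
    simp only [h2, hN]
  have h1 : ∑ e ∈ Finset.range N, ∑ x : L, (ω ^ e) s * (ω ^ (d * e)) x =
      (N : R) * ∑ e ∈ (Finset.range N).filter (fun e => N ∣ d * e), (ω ^ e) s := by
    rw [Finset.sum_filter, Finset.mul_sum]
    refine Finset.sum_congr rfl fun e _ => ?_
    rw [← Finset.mul_sum, sum_pow_mulChar hω]
    split_ifs
    · rw [mul_comm]
    · simp
  rw [Finset.sum_comm, Finset.sum_congr rfl fun x _ => hinner x] at h1
  refine mul_left_cancel₀ hN0 (h1.symm.trans ?_)
  rw [← Equiv.sum_comp (Equiv.inv L)]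
  simp only [Equiv.inv_apply, inv_inv]
  rw [← Finset.sum_filter, Finset.sum_const, nsmul_eq_mul, mul_comm]

lemma natCast_mul_eq_self_iff {d : ℕ} [NeZero d] {Q : ℕ} (hQ : Q ≠ 0) (m : ZMod d) :
    (Q : ZMod d) * m = m ↔ d ∣ (Q - 1) * m.val := by
  rw [← ZMod.natCast_eq_zero_iff, Nat.cast_mul, ZMod.natCast_zmod_val,
    Nat.cast_sub (Nat.one_le_iff_ne_zero.2 hQ), Nat.cast_one, sub_mul, one_mul, sub_eq_zero]

-- The exponents of the characters of order dividing d are the (Q - 1) m / d with Q m = m, which is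
-- exactly the condition for this division to be exact.
open Classical in
lemma sum_filter_dvd_eq {A : Type*} [AddCommMonoid A] {d : ℕ} [NeZero d] {Q : ℕ} (hQ : 1 < Q)
    (f : ℕ → A) :
    ∑ e ∈ (Finset.range (Q - 1)).filter (fun e => Q - 1 ∣ d * e), f e =
      ∑ m ∈ Finset.univ.filter (fun m : ZMod d => (Q : ZMod d) * m = m),
        f ((Q - 1) * m.val / d) := by
  have hd : 0 < d := Nat.pos_of_ne_zero (NeZero.ne d)
  have hN : 0 < Q - 1 := by omega
  symm
  refine Finset.sum_nbij' (fun m => (Q - 1) * m.val / d) (fun e => ((d * e / (Q - 1) : ℕ) : ZMod d))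
    ?_ ?_ ?_ ?_ ?_
  · intro m hm
    rw [Finset.mem_filter, natCast_mul_eq_self_iff (by omega)] at hm
    rw [Finset.mem_filter, Finset.mem_range, Nat.mul_div_cancel' hm.2]
    refine ⟨?_, dvd_mul_right _ _⟩
    rw [Nat.div_lt_iff_lt_mul hd]
    exact Nat.mul_lt_mul_of_pos_left (ZMod.val_lt m) hN
  · intro e he
    rw [Finset.mem_filter, Finset.mem_range] at he
    rw [Finset.mem_filter]
    refine ⟨Finset.mem_univ _, ?_⟩
    have h : (((Q - 1) * (d * e / (Q - 1)) : ℕ) : ZMod d) = 0 := by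
      rw [Nat.mul_div_cancel' he.2, Nat.cast_mul, ZMod.natCast_self, zero_mul]
    rw [Nat.cast_mul, Nat.cast_sub hQ.le, Nat.cast_one, sub_mul, one_mul, sub_eq_zero] at h
    exact h
  · intro m hm
    rw [Finset.mem_filter, natCast_mul_eq_self_iff (by omega)] at hm
    rw [Nat.mul_div_cancel' hm.2, Nat.mul_div_cancel_left _ hN, ZMod.natCast_zmod_val]
  · intro e he
    rw [Finset.mem_filter, Finset.mem_range] at he
    have hlt : d * e / (Q - 1) < d := by
      rw [Nat.div_lt_iff_lt_mul hN]
      exact Nat.mul_lt_mul_of_pos_left he.1 hd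
    rw [ZMod.val_natCast_of_lt hlt, Nat.mul_div_cancel' he.2, Nat.mul_div_cancel_left _ hd]
  · intro m _
    rfl

-- Group x by s = x^d. The value s = 0 has one preimage and is killed by every ω^e, also for e = 0,
-- so it yields the separate term `legSum L 0`.
open Classical in
theorem sum_legSum_pow (hω : Function.Injective ω) (d : ℕ) [NeZero d] :
    ((∑ x : L, legSum L (x ^ d) : ℤ) : R) = (legSum L 0 : R) +
      ∑ m ∈ Finset.univ.filter (fun m : ZMod d => (Fintype.card L : ZMod d) * m = m),
        jacSum (ω ^ ((Fintype.card L - 1) * m.val / d)) ^ 2 := by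
  have hd := NeZero.ne d
  rw [← sum_filter_dvd_eq Fintype.one_lt_card (fun e => jacSum (ω ^ e) ^ 2)]
  have h1 : ∀ s : L, ((Finset.univ.filter fun x : L => x ^ d = s).card : R) =
      (if s = 0 then 1 else 0) + ∑ e ∈ (Finset.range (Fintype.card L - 1)).filter
        (fun e => Fintype.card L - 1 ∣ d * e), (ω ^ e) s := by
    intro s
    split_ifs with h
    · subst h
      have : (Finset.univ.filter fun x : L => x ^ d = 0) = {0} := by
        ext x
        simp [hd]
      rw [this, Finset.sum_eq_zero fun e _ => MulChar.map_zero _]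
      simp
    · rw [sum_pow_apply_eq_card hω hd h, zero_add]
  have h2 : ((∑ x : L, legSum L (x ^ d) : ℤ) : R) =
      ∑ s : L, ((Finset.univ.filter fun x : L => x ^ d = s).card : R) * (legSum L s : R) := by
    push_cast
    rw [← Finset.sum_fiberwise_of_maps_to (t := Finset.univ) (g := fun x : L => x ^ d)
      fun _ _ => Finset.mem_univ _]
    refine Finset.sum_congr rfl fun s _ => ?_
    rw [← nsmul_eq_mul, ← Finset.sum_const]
    exact Finset.sum_congr rfl fun x hx => by rw [(Finset.mem_filter.1 hx).2]
  rw [h2]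
  simp only [h1, add_mul, Finset.sum_add_distrib, Finset.sum_mul]
  congr 1
  · simp
  · rw [Finset.sum_comm]
    exact Finset.sum_congr rfl fun e _ => sum_mul_legSum _

omit [CharZero R] in
lemma jacSum_one_sq (hL : ringChar L ≠ 2) : jacSum (1 : MulChar L R) ^ 2 = 1 := by
  classical
  have h : jacSum (1 : MulChar L R) = -(quadChi L (-1) : R) := by
    have h1 : ∀ x : L, (1 : MulChar L R) x * (quadChi L (x - 1) : R) =
        ((quadChi L (x + -1) - if x = 0 then quadChi L (-1) else 0 : ℤ) : R) := by
      intro x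
      split_ifs with hx
      · subst hx; simp [MulChar.map_zero]
      · rw [MulChar.one_apply (isUnit_iff_ne_zero.2 hx), ← sub_eq_add_neg]; simp
    rw [jacSum, Finset.sum_congr rfl fun x _ => h1 x, ← Int.cast_sum, Finset.sum_sub_distrib,
      sum_quadChi_add hL]
    simp
  rw [h, neg_sq, ← Int.cast_pow, quadChi_sq (neg_ne_zero.2 one_ne_zero), Int.cast_one]

omit [CharZero R] in
lemma pow_half_apply (hω : Function.Injective ω) (hL : ringChar L ≠ 2) (x : L) :
    (ω ^ ((Fintype.card L - 1) / 2)) x = (quadChi L x : R) := by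
  have hodd : Fintype.card L % 2 = 1 := FiniteField.odd_card_of_char_ne_two hL
  have hhalf : (Fintype.card L - 1) / 2 = Fintype.card L / 2 := by omega
  rw [hhalf]
  by_cases hx : x = 0
  · subst hx; simp [MulChar.map_zero]
  have happ : (ω ^ (Fintype.card L / 2)) x = ω (x ^ (Fintype.card L / 2)) := by
    rw [map_pow]
    exact MulChar.pow_apply_coe ω _ (Units.mk0 x hx)
  have hm1 : ω (-1) = -1 := by
    have h1 : ω (-1) ^ 2 = 1 := by rw [← map_pow]; simp
    refine (sq_eq_one_iff.1 h1).resolve_left fun h => ?_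
    have := hω (h.trans (map_one ω).symm)
    exact (Ring.neg_one_ne_one_of_char_ne_two hL) this
  rw [happ, ← quadChi_eq_pow hL]
  rcases sq_eq_one_iff.1 (quadChi_sq hx) with h | h
  · rw [h]; simp
  · rw [h]; simp [hm1]

-- The power (|L| - 1)/2 of ω is the quadratic character itself, so the Jacobi sum is the sum of χ(x
-- (x - 1)), which is -1.
omit [CharZero R] in
lemma jacSum_pow_half_sq (hω : Function.Injective ω) (hL : ringChar L ≠ 2) :
    jacSum (ω ^ ((Fintype.card L - 1) / 2)) ^ 2 = 1 := by
  have h : jacSum (ω ^ ((Fintype.card L - 1) / 2)) = -1 := by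
    have h1 : ∀ x : L, (ω ^ ((Fintype.card L - 1) / 2)) x * (quadChi L (x - 1) : R) =
        ((quadChi L (x * (x + -1)) : ℤ) : R) := fun x => by
      rw [pow_half_apply hω hL, map_mul, ← sub_eq_add_neg, Int.cast_mul]
    rw [jacSum, Finset.sum_congr rfl fun x _ => h1 x, ← Int.cast_sum,
      sum_quadChi_mul_add hL (neg_ne_zero.2 one_ne_zero)]
    simp
  rw [h]
  simp

-- Frobenius permutes `L`, and χ is unchanged by an odd power. This gives the invariance of J under
-- multiplication of m by q.
omit [CharZero R] in
lemma jacSum_pow_of_ringEquiv (ψ : MulChar L R) {q : ℕ} (hq : Odd q) (φ : L ≃+* L)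
    (hφ : ∀ x, φ x = x ^ q) : jacSum (ψ ^ q) = jacSum ψ := by
  rw [jacSum, jacSum]
  symm
  rw [← Equiv.sum_comp φ.toEquiv]
  symm
  refine Finset.sum_congr rfl fun x _ => ?_
  have h1 : quadChi L (x ^ q - 1) = quadChi L (x - 1) := by
    have h0 : x ^ q - 1 = (x - 1) ^ q := by
      rw [← hφ, ← hφ, map_sub, map_one]
    rw [h0, map_pow]
    obtain ⟨j, rfl⟩ := hq
    by_cases hx : x - 1 = 0
    · simp [hx]
    · rw [pow_succ, pow_mul, quadChi_sq hx, one_pow, one_mul]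
  have h2 : (ψ ^ q) x = ψ (x ^ q) := by
    rw [map_pow]
    exact MulChar.pow_apply' ψ hq.pos.ne' x
  change _ = ψ (φ x) * (quadChi L (φ x - 1) : R)
  rw [h2, hφ, h1]

/-- The norm is the power with exponent `N`, so ω'^(eN) is ω^e composed with the norm and
Hasse–Davenport applies. Squaring removes its signs. -/
theorem jacSum_pow_of_algebra (hL : ringChar L ≠ 2) (ω : MulChar L R) {L' : Type*} [Field L']
    [Fintype L'] [Algebra L L'] (ω' : MulChar L' R) (h : ∀ x : L, ω' (algebraMap L L' x) = ω x)
    (e : ℕ) {N : ℕ} (hN : N * (Fintype.card L - 1) = Fintype.card L' - 1) :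
    jacSum (ω' ^ (e * N)) ^ 2 = (jacSum (ω ^ e) ^ 2) ^ Module.finrank L L' := by
  have hL1 : 0 < Fintype.card L - 1 := by
    have := Fintype.one_lt_card (α := L); omega
  have h1 := sum_comp_norm hL (ω ^ e) L'
  have h2 : jacSum (ω' ^ (e * N)) = -(-jacSum (ω ^ e)) ^ Module.finrank L L' := by
    rw [← h1, jacSum]
    refine Finset.sum_congr rfl fun x _ => ?_
    congr 1
    by_cases hx : x = 0
    · subst hx
      rw [MulChar.map_zero, Algebra.norm_zero, MulChar.map_zero]
    have hnx : Algebra.norm L x ≠ 0 := by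
      rwa [Ne, Algebra.norm_eq_zero_iff]
    have h3 : (ω ^ e) (Algebra.norm L x) = ω (Algebra.norm L x) ^ e :=
      MulChar.pow_apply_coe ω e (Units.mk0 _ hnx)
    have h4 : (ω' ^ (e * N)) x = ω' x ^ (e * N) :=
      MulChar.pow_apply_coe ω' _ (Units.mk0 _ hx)
    have hN' : (Nat.card L' - 1) / (Nat.card L - 1) = N := by
      rw [Nat.card_eq_fintype_card, Nat.card_eq_fintype_card, ← hN, Nat.mul_div_cancel _ hL1]
    rw [h3, h4, ← h, FiniteField.algebraMap_norm_eq_pow, hN', map_pow, ← pow_mul, mul_comm]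
  rw [h2, neg_sq, ← pow_mul, mul_comm, pow_mul, neg_sq]

end InjectiveChar

/-! ### The finite subfields of an algebraically closed extension of a finite field -/

section FiniteSubfields

variable (F : Type*) [Field F] [Fintype F] (k : Type*) [Field k] [Algebra F k]

/-- The extension of `F` of degree `n` inside `k`. -/
def extension (n : ℕ) : IntermediateField F k :=
  (AlgHom.equalizer ((FiniteField.frobeniusAlgHom F k) ^ n) (AlgHom.id F k)).toIntermediateField
    fun x hx => by
      rw [AlgHom.mem_equalizer] at hx ⊢
      rw [map_inv₀, hx, map_inv₀]

variable {F k}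

lemma mem_extension {n : ℕ} {x : k} : x ∈ extension F k n ↔ x ^ (Fintype.card F ^ n) = x := by
  change ((FiniteField.frobeniusAlgHom F k) ^ n) x = x ↔ _
  rw [AlgHom.coe_pow, FiniteField.coe_frobeniusAlgHom, pow_iterate]

lemma coe_extension (n : ℕ) :
    (extension F k n : Set k) = finiteSubfield k (Fintype.card F ^ n) := by
  ext x
  exact mem_extension

lemma extension_le {a n : ℕ} (h : a ∣ n) : extension F k a ≤ extension F k n := by
  obtain ⟨b, rfl⟩ := h
  intro x hx
  rw [mem_extension] at hx ⊢
  induction b with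
  | zero => simp
  | succ b ih => rw [mul_add, mul_one, pow_add, pow_mul, ih, hx]

variable [IsAlgClosed k]

lemma natCard_extension (n : ℕ) (hn : n ≠ 0) :
    Nat.card (extension F k n) = Fintype.card F ^ n := by
  classical
  have hQ : 1 < Fintype.card F ^ n := Nat.one_lt_pow hn Fintype.one_lt_card
  obtain ⟨p, _, r, hp, hc⟩ := FiniteField.card' F
  have : CharP k p := charP_of_injective_algebraMap' F p
  have hsep : (Polynomial.X ^ (Fintype.card F ^ n) - Polynomial.X : k[X]).Separable :=
    galois_poly_separable p _ (dvd_pow (hc ▸ dvd_pow_self p r.2.ne') hn)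
  have h0 := FiniteField.X_pow_card_sub_X_ne_zero k hQ
  rw [← FiniteField.X_pow_card_sub_X_natDegree_eq k hQ,
    ← Polynomial.card_rootSet_eq_natDegree (K := k) hsep (IsAlgClosed.splits _),
    ← Nat.card_eq_fintype_card]
  refine Nat.card_congr (Equiv.subtypeEquivRight fun x => ?_)
  rw [mem_extension, Polynomial.mem_rootSet_of_ne h0]
  simp [sub_eq_zero]

instance (n : ℕ) [NeZero n] : Fintype (extension F k n) :=
  have : Finite (extension F k n) := Nat.finite_of_card_ne_zero (by
    rw [natCard_extension n (NeZero.ne n)]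
    exact pow_ne_zero _ Fintype.card_ne_zero)
  Fintype.ofFinite _

lemma card_extension (n : ℕ) [NeZero n] :
    Fintype.card (extension F k n) = Fintype.card F ^ n := by
  rw [← Nat.card_eq_fintype_card, natCard_extension n (NeZero.ne n)]

lemma finrank_extension (n : ℕ) [NeZero n] : Module.finrank F (extension F k n) = n := by
  have h := Module.card_eq_pow_finrank (K := F) (V := extension F k n)
  rw [card_extension] at h
  exact (Nat.pow_right_injective Fintype.one_lt_card h).symm

omit [IsAlgClosed k] in
lemma ringChar_extension (hF : ringChar F ≠ 2) (n : ℕ) : ringChar (extension F k n) ≠ 2 :=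
  ringChar_ne_two_of_ringHom (algebraMap F _) hF

variable {Ω : Type*} [Field Ω]

/-- The restriction of a multiplicative map to a finite subfield. -/
def extChar (F : Type*) [Field F] [Fintype F] [Algebra F k] (τ : k →*₀ Ω) (n : ℕ) :
    MulChar (extension F k n) Ω where
  toFun x := τ (x : k)
  map_one' := map_one τ
  map_mul' x y := map_mul τ (x : k) (y : k)
  map_nonunit' x hx := by
    rw [isUnit_iff_ne_zero, not_not] at hx
    subst hx
    exact map_zero τ

omit [IsAlgClosed k] in
lemma extChar_injective {τ : k →*₀ Ω} (hτ : Function.Injective τ) (n : ℕ) :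
    Function.Injective (extChar F τ n) := fun _ _ h => Subtype.ext (hτ h)

/-- The square of the Jacobi sum of `τ ^ ((q ^ n - 1) m / d)` over the extension of degree `n`. -/
def jacSq (F : Type*) [Field F] [Fintype F] [Algebra F k] (τ : k →*₀ Ω) (n : ℕ) [NeZero n] {d : ℕ}
    (m : ZMod d) : Ω :=
  jacSum (extChar F τ n ^ ((Fintype.card F ^ n - 1) * m.val / d)) ^ 2

lemma jacSq_congr (τ : k →*₀ Ω) {a b : ℕ} [NeZero a] [NeZero b] (h : a = b) {d : ℕ} (m : ZMod d) :
    jacSq F τ a m = jacSq F τ b m := by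
  subst h
  rfl

variable {d : ℕ} [NeZero d]

lemma pow_mul_eq_self_iff (n : ℕ) (m : ZMod d) :
    (Fintype.card F : ZMod d) ^ n * m = m ↔ d ∣ (Fintype.card F ^ n - 1) * m.val := by
  rw [← Nat.cast_pow, natCast_mul_eq_self_iff (pow_ne_zero _ Fintype.card_ne_zero)]

lemma jacSq_mul (hF : ringChar F ≠ 2) (τ : k →*₀ Ω) (n : ℕ) [NeZero n] (m : ZMod d)
    (hm : (Fintype.card F : ZMod d) ^ n * m = m) :
    jacSq F τ n ((Fintype.card F : ZMod d) * m) = jacSq F τ n m := by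
  have hd : 0 < d := Nat.pos_of_ne_zero (NeZero.ne d)
  set q := Fintype.card F with hq
  have hm' : (q : ZMod d) ^ n * ((q : ZMod d) * m) = (q : ZMod d) * m := by
    rw [mul_left_comm, hm]
  obtain ⟨e, he⟩ := (pow_mul_eq_self_iff (F := F) n m).1 hm
  obtain ⟨e', he'⟩ := (pow_mul_eq_self_iff (F := F) n _).1 hm'
  rw [← hq] at he he'
  have hval : q * m.val = ((q : ZMod d) * m).val + d * (q * m.val / d) := by
    have h := Nat.mod_add_div (q * m.val) d
    rw [← ZMod.val_natCast, Nat.cast_mul, ZMod.natCast_zmod_val] at h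
    exact h.symm
  set c := q * m.val / d
  -- Reducing q m modulo d changes the exponent only by a multiple of q^n - 1, which is a period of
  -- the powers of the character.
  have hee : e * q = e' + (q ^ n - 1) * c := by
    refine Nat.eq_of_mul_eq_mul_left hd ?_
    calc d * (e * q) = (q ^ n - 1) * (q * m.val) := by rw [← mul_assoc, ← he]; ring
      _ = d * (e' + (q ^ n - 1) * c) := by rw [hval, mul_add, he']; ring
  rw [jacSq, jacSq, he, he', Nat.mul_div_cancel_left _ hd, Nat.mul_div_cancel_left _ hd]
  have hχ : extChar F τ n ^ e' = (extChar F τ n ^ e) ^ q := by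
    have h1 : extChar F τ n ^ (q ^ n - 1) = 1 := by
      classical
      rw [← card_extension (F := F) (k := k) n, ← Fintype.card_units, MulChar.pow_card_eq_one]
    rw [← pow_mul, hee, pow_add, pow_mul, h1, one_pow, mul_one]
  have hodd : Odd q := Nat.odd_iff.2 (FiniteField.odd_card_of_char_ne_two hF)
  rw [hχ, jacSum_pow_of_ringEquiv _ hodd (RingEquiv.ofBijective
    (FiniteField.frobeniusAlgHom F (extension F k n))
    (Finite.injective_iff_bijective.1 (RingHom.injective
      (FiniteField.frobeniusAlgHom F (extension F k n)).toRingHom))) fun x => rfl]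

variable [CharZero Ω]

lemma jacSq_of_dvd (hF : ringChar F ≠ 2) (τ : k →*₀ Ω) {a n : ℕ} [NeZero a] [NeZero n] (h : a ∣ n)
    (m : ZMod d) (hm : (Fintype.card F : ZMod d) ^ a * m = m) :
    jacSq F τ n m = jacSq F τ a m ^ (n / a) := by
  have hd : 0 < d := Nat.pos_of_ne_zero (NeZero.ne d)
  let _ : Algebra (extension F k a) (extension F k n) :=
    (IntermediateField.inclusion (extension_le h)).toRingHom.toAlgebra
  have hfin : Module.finrank (extension F k a) (extension F k n) = n / a := by
    have h1 := Module.card_eq_pow_finrank (K := extension F k a) (V := extension F k n)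
    rw [card_extension, card_extension, ← pow_mul] at h1
    exact (Nat.div_eq_of_eq_mul_right (Nat.pos_of_ne_zero (NeZero.ne a))
      (Nat.pow_right_injective Fintype.one_lt_card h1)).symm
  obtain ⟨e, he⟩ := (pow_mul_eq_self_iff (F := F) a m).1 hm
  obtain ⟨b, rfl⟩ := h
  obtain ⟨N, hN⟩ : Fintype.card F ^ a - 1 ∣ Fintype.card F ^ (a * b) - 1 := by
    rw [pow_mul]
    exact Nat.sub_one_dvd_pow_sub_one _ _
  have he' : (Fintype.card F ^ (a * b) - 1) * m.val / d = e * N := by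
    rw [hN, mul_right_comm, he, mul_assoc, Nat.mul_div_cancel_left _ hd]
  rw [jacSq, jacSq, he', he, Nat.mul_div_cancel_left _ hd, ← hfin]
  refine jacSum_pow_of_algebra (ringChar_extension hF a) _ _ (fun x => rfl) e ?_
  rw [card_extension, card_extension, hN, mul_comm]

open Classical in
/-- The sum over the extension of degree `n` in terms of Jacobi sums. -/
theorem sum_legSum_extension (hF : ringChar F ≠ 2) {τ : k →*₀ Ω} (hτ : Function.Injective τ)
    (hd : 2 ≤ d) (n : ℕ) [NeZero n] :
    ((∑ x : extension F k n, legSum _ (x ^ d) : ℤ) : Ω) = (if Even d then 1 else 0) +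
      ∑ m ∈ (Z d).filter (fun m => (Fintype.card F : ZMod d) ^ n * m = m), jacSq F τ n m := by
  have hL := ringChar_extension (k := k) hF n
  have hodd : Fintype.card (extension F k n) % 2 = 1 := FiniteField.odd_card_of_char_ne_two hL
  rw [sum_legSum_pow (extChar_injective hτ n), legSum_zero hL]
  rw [← Finset.sum_filter_add_sum_filter_not _ (fun m => m ∈ Z d)]
  have hsub : (Finset.univ.filter fun m : ZMod d =>
      (Fintype.card (extension F k n) : ZMod d) * m = m).filter (fun m => m ∈ Z d) =
      (Z d).filter (fun m => (Fintype.card F : ZMod d) ^ n * m = m) := by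
    ext m
    simp only [Finset.mem_filter, Finset.mem_univ, true_and, card_extension, Nat.cast_pow]
    exact and_comm
  have hmain : ∀ m : ZMod d, jacSum (extChar F τ n ^
      ((Fintype.card (extension F k n) - 1) * m.val / d)) ^ 2 = jacSq F τ n m := fun m => by
    rw [jacSq, card_extension]
  have h0 : jacSum (extChar F τ n ^
      ((Fintype.card (extension F k n) - 1) * (0 : ZMod d).val / d)) ^ 2 = 1 := by
    rw [ZMod.val_zero, mul_zero, Nat.zero_div, pow_zero, jacSum_one_sq hL]
  -- The indices outside `Z d` contribute 1 for m = 0, which cancels `legSum` at 0, and 1 for m =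
  -- d/2 when d is even; that index is fixed because the field has odd cardinality.
  have hrest : ∑ m ∈ (Finset.univ.filter fun m : ZMod d =>
      (Fintype.card (extension F k n) : ZMod d) * m = m).filter (fun m => ¬ m ∈ Z d),
      jacSum (extChar F τ n ^ ((Fintype.card (extension F k n) - 1) * m.val / d)) ^ 2 =
      1 + if Even d then 1 else 0 := by
    by_cases hev : Even d
    · obtain ⟨c, hc⟩ := hev
      have hc2 : d / 2 = c := by omega
      have hlt : c < d := by omega
      have hval : ((c : ℕ) : ZMod d).val = c := ZMod.val_natCast_of_lt hlt
      have hne : (0 : ZMod d) ≠ (c : ZMod d) := by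
        intro h
        have := congrArg ZMod.val h
        rw [hval, ZMod.val_zero] at this
        omega
      have hset : (Finset.univ.filter fun m : ZMod d =>
          (Fintype.card (extension F k n) : ZMod d) * m = m).filter (fun m => ¬ m ∈ Z d) =
          {0, (c : ZMod d)} := by
        ext m
        simp only [Finset.mem_filter, Finset.mem_univ, true_and, Z, hc2, Finset.mem_insert,
          Finset.mem_singleton]
        constructor
        · rintro ⟨-, h⟩
          by_contra! h2
          exact h ⟨h2.1, fun h3 => h2.2 h3.2⟩
        · rintro (rfl | rfl)
          · simp
          · refine ⟨?_, fun h => h.2 ⟨⟨c, hc⟩, rfl⟩⟩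
            rw [natCast_mul_eq_self_iff (by omega), hval]
            refine ⟨(Fintype.card (extension F k n) - 1) / 2, ?_⟩
            have h4 : Fintype.card (extension F k n) - 1 =
              2 * ((Fintype.card (extension F k n) - 1) / 2) := by omega
            conv_lhs => rw [h4]
            conv_rhs => rw [hc]
            ring
      have hhalf : (Fintype.card (extension F k n) - 1) * c / d =
          (Fintype.card (extension F k n) - 1) / 2 := by
        rw [hc, ← two_mul, Nat.mul_div_mul_right _ _ (by omega)]
      rw [hset, Finset.sum_pair hne, h0, hval, hhalf,
        jacSum_pow_half_sq (extChar_injective hτ n) hL, if_pos ⟨c, hc⟩]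
    · have hset : (Finset.univ.filter fun m : ZMod d =>
          (Fintype.card (extension F k n) : ZMod d) * m = m).filter (fun m => ¬ m ∈ Z d) = {0} := by
        ext m
        simp only [Finset.mem_filter, Finset.mem_univ, true_and, Z, Finset.mem_singleton]
        constructor
        · rintro ⟨-, h⟩
          by_contra h2
          exact h ⟨h2, fun h3 => hev h3.1⟩
        · rintro rfl
          simp
      rw [hset, Finset.sum_singleton, h0, if_neg hev, add_zero]
  rw [hsub, hrest, Finset.sum_congr rfl fun m _ => hmain m]
  push_cast
  ring

end FiniteSubfields

/-! ### Orbits of multiplication by q on ℤ/dℤ. -/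

section Orbits

variable {q d : ℕ} [NeZero d]

omit [NeZero d] in
lemma iterate_natCast_mul (m : ZMod d) (n : ℕ) :
    (fun x : ZMod d => (q : ZMod d) * x)^[n] m = (q : ZMod d) ^ n * m := by
  rw [mul_left_iterate]

lemma mem_orbit {m x : ZMod d} : x ∈ orbit q m ↔ ∃ k : ℕ, x = (q : ZMod d) ^ k * m := by
  classical
  simp only [orbit, Finset.mem_filter, Finset.mem_univ, true_and]

lemma mem_orbit_self (m : ZMod d) : m ∈ orbit q m := mem_orbit.2 ⟨0, by rw [pow_zero, one_mul]⟩

lemma mem_periodicPts (hdq : d.Coprime q) (m : ZMod d) :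
    m ∈ Function.periodicPts (fun x : ZMod d => (q : ZMod d) * x) :=
  Function.Injective.mem_periodicPts (((ZMod.isUnit_iff_coprime q d).2 hdq.symm).mul_right_injective)
    m

lemma card_orbit (hdq : d.Coprime q) (m : ZMod d) :
    (orbit q m).card = Function.minimalPeriod (fun x : ZMod d => (q : ZMod d) * x) m := by
  classical
  set f := fun x : ZMod d => (q : ZMod d) * x with hf
  have h : orbit q m = (Finset.range (Function.minimalPeriod f m)).image fun k => f^[k] m := by
    ext x
    rw [mem_orbit, Finset.mem_image]
    constructor
    · rintro ⟨k, rfl⟩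
      refine ⟨k % Function.minimalPeriod f m, Finset.mem_range.2 (Nat.mod_lt _
        (Function.minimalPeriod_pos_of_mem_periodicPts (mem_periodicPts hdq m))), ?_⟩
      rw [Function.iterate_mod_minimalPeriod_eq, hf, iterate_natCast_mul]
    · rintro ⟨k, -, rfl⟩
      exact ⟨k, iterate_natCast_mul m k⟩
  rw [h, Finset.card_image_of_injOn, Finset.card_range]
  rw [Finset.coe_range]
  exact Function.iterate_injOn_Iio_minimalPeriod

lemma card_orbit_pos (m : ZMod d) : 0 < (orbit q m).card :=
  Finset.card_pos.2 ⟨m, mem_orbit_self m⟩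

instance (m : ZMod d) : NeZero (orbit q m).card := ⟨(card_orbit_pos m).ne'⟩

lemma card_orbit_dvd_iff (hdq : d.Coprime q) (m : ZMod d) (n : ℕ) :
    (orbit q m).card ∣ n ↔ (q : ZMod d) ^ n * m = m := by
  rw [card_orbit hdq, ← Function.isPeriodicPt_iff_minimalPeriod_dvd, Function.IsPeriodicPt,
    Function.IsFixedPt, iterate_natCast_mul]

lemma orbit_eq_of_mem (hdq : d.Coprime q) {m x : ZMod d} (hx : x ∈ orbit q m) :
    orbit q x = orbit q m := by
  obtain ⟨k, rfl⟩ := mem_orbit.1 hx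
  have hper := (card_orbit_dvd_iff hdq m _).1 (dvd_mul_right (orbit q m).card k)
  have hle : k ≤ (orbit q m).card * k := Nat.le_mul_of_pos_left _ (card_orbit_pos m)
  ext y
  rw [mem_orbit, mem_orbit]
  constructor
  · rintro ⟨j, rfl⟩
    exact ⟨j + k, by rw [pow_add, mul_assoc]⟩
  · rintro ⟨j, rfl⟩
    -- Advancing by a multiple of the orbit length minus k undoes k steps.
    refine ⟨j + ((orbit q m).card * k - k), ?_⟩
    rw [← mul_assoc, ← pow_add, add_assoc, Nat.sub_add_cancel hle, pow_add, mul_assoc, hper]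

lemma mul_mem_Z (hdq : d.Coprime q) (hq : Odd q) {m : ZMod d} (hm : m ∈ Z d) :
    (q : ZMod d) * m ∈ Z d := by
  have hu : IsUnit (q : ZMod d) := (ZMod.isUnit_iff_coprime q d).2 hdq.symm
  rw [Z, Finset.mem_filter] at hm ⊢
  refine ⟨Finset.mem_univ _, ?_, ?_⟩
  · rw [Ne, hu.mul_right_eq_zero]
    exact hm.2.1
  · rintro ⟨⟨c, hc⟩, h⟩
    refine hm.2.2 ⟨⟨c, hc⟩, hu.mul_right_injective ?_⟩
    simp only
    rw [h]
    obtain ⟨j, rfl⟩ := hq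
    have hc2 : d / 2 = c := by omega
    rw [hc2]
    have h2 : ((c + c : ℕ) : ZMod d) = 0 := by rw [← hc, ZMod.natCast_self]
    push_cast at h2 ⊢
    linear_combination (-(j : ZMod d)) * h2

lemma mem_Z_of_mem_orbit (hdq : d.Coprime q) (hq : Odd q) {m x : ZMod d} (hm : m ∈ Z d)
    (hx : x ∈ orbit q m) : x ∈ Z d := by
  obtain ⟨k, rfl⟩ := mem_orbit.1 hx
  clear hx
  induction k with
  | zero => simpa using hm
  | succ k ih =>
    rw [pow_succ', mul_assoc]
    exact mul_mem_Z hdq hq ih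

end Orbits

/-! ### The residue field of `𝔓` and the Teichmüller character -/

section Reduction

/-- The quotient w of x and y is an N-th root of unity reducing to 1. If w ≠ 1, then 1 + w + ... +
w^(N-1) = 0 reduces to N = 0. -/
lemma pow_inj_of_pow_eq_one {A k : Type*} [CommRing A] [IsDomain A] [Field k] (π : A →+* k)
    {N : ℕ} (hN : (N : k) ≠ 0) {x y : A} (hx : x ^ N = 1) (hy : y ^ N = 1) (h : π x = π y) :
    x = y := by
  have hN0 : N ≠ 0 := by
    rintro rfl
    exact hN Nat.cast_zero
  obtain ⟨n, rfl⟩ := Nat.exists_eq_succ_of_ne_zero hN0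
  set w := x * y ^ n with hw
  have hwN : w ^ (n + 1) = 1 := by
    rw [hw, mul_pow, hx, ← pow_mul, mul_comm n, pow_mul, hy, one_pow, one_mul]
  have hπw : π w = 1 := by
    rw [hw, map_mul, map_pow, h, ← pow_succ', ← map_pow, hy, map_one]
  have hw1 : w = 1 := by
    have h1 := geom_sum_mul w (n + 1)
    rw [hwN, sub_self] at h1
    rcases mul_eq_zero.1 h1 with h2 | h2
    · exfalso
      have h3 := congrArg π h2
      rw [map_sum, map_zero, Finset.sum_congr rfl fun i _ => by rw [map_pow, hπw, one_pow]] at h3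
      rw [Finset.sum_const, Finset.card_range, nsmul_eq_mul, mul_one] at h3
      exact hN h3
    · exact sub_eq_zero.1 h2
  calc x = x * y ^ (n + 1) := by rw [hy, mul_one]
    _ = w * y := by rw [hw, pow_succ, mul_assoc]
    _ = y := by rw [hw1, one_mul]

lemma orderOf_ne_zero_of_coprime {G : Type*} [Monoid G] {p : ℕ} (hp : p.Prime) {x : G}
    (hx : (orderOf x).Coprime p) : orderOf x ≠ 0 := by
  intro h
  rw [h, Nat.coprime_zero_left] at hx
  exact hp.one_lt.ne' hx

/-- Reduction modulo `p` is injective on the roots of unity of order prime to `p`. -/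
lemma injOn_orderOf_coprime {A k : Type*} [CommRing A] [IsDomain A] [Field k] (π : A →+* k)
    (p : ℕ) (hp : p.Prime) [CharP k p] : Set.InjOn π {ζ : A | (orderOf ζ).Coprime p} := by
  intro x hx y hy h
  have hxy : (orderOf x * orderOf y).Coprime p := Nat.Coprime.mul_left hx hy
  refine pow_inj_of_pow_eq_one π (N := orderOf x * orderOf y) ?_ ?_ ?_ h
  · rw [Ne, CharP.cast_eq_zero_iff k p]
    exact (Nat.Prime.coprime_iff_not_dvd hp).1 hxy.symm
  · rw [pow_mul, pow_orderOf_eq_one, one_pow]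
  · rw [mul_comm, pow_mul, pow_orderOf_eq_one, one_pow]

/-- Every root of unity of the residue field lifts to a root of unity of the same order. -/
lemma exists_lift_of_pow_eq_one {A k : Type*} [CommRing A] [IsDomain A] [Field k] (π : A →+* k)
    {N : ℕ} (hN : 0 < N) {ζ : A} (hζ : IsPrimitiveRoot ζ N) {x : k} (hx : x ^ N = 1) :
    ∃ y : A, y ^ N = 1 ∧ π y = x := by
  -- Since X^N - 1 is the product of the X - y over the N-th roots of unity y of `A`, evaluating its
  -- reduction at x forces some y to reduce to x.
  have h := congrArg (Polynomial.eval₂ π x) (Polynomial.X_pow_sub_one_eq_prod hN hζ)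
  rw [Polynomial.eval₂_sub, Polynomial.eval₂_pow, Polynomial.eval₂_X, Polynomial.eval₂_one, hx,
    sub_self, Polynomial.eval₂_finsetProd, eq_comm, Finset.prod_eq_zero_iff] at h
  obtain ⟨y, hy, h⟩ := h
  rw [Polynomial.eval₂_sub, Polynomial.eval₂_X, Polynomial.eval₂_C, sub_eq_zero] at h
  exact ⟨y, (Polynomial.mem_nthRootsFinset hN 1).1 hy, h.symm⟩

/-- The element generates a finite field over 𝔽_p, so its order divides a number of the form p^r - 1
with r > 0. -/
lemma orderOf_coprime_of_isIntegral {k : Type*} [Field k] (p : ℕ) [hp : Fact p.Prime] [CharP k p]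
    {x : k} (hx : IsIntegral ℤ x) (h0 : x ≠ 0) : (orderOf x).Coprime p := by
  let _ : Algebra (ZMod p) k := ZMod.algebra k p
  have hx' : IsIntegral (ZMod p) x := hx.tower_top
  have hfd := IntermediateField.adjoin.finiteDimensional hx'
  have hfin : Finite (IntermediateField.adjoin (ZMod p) {x}) := Module.finite_of_finite (ZMod p)
  have := Fintype.ofFinite (IntermediateField.adjoin (ZMod p) {x})
  set y : IntermediateField.adjoin (ZMod p) {x} :=
    ⟨x, IntermediateField.mem_adjoin_simple_self (ZMod p) x⟩ with hy
  have hy0 : y ≠ 0 := fun h => h0 (congrArg Subtype.val h)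
  have h1 := FiniteField.pow_card_sub_one_eq_one y hy0
  have h2 : x ^ (Fintype.card (IntermediateField.adjoin (ZMod p) {x}) - 1) = 1 :=
    congrArg Subtype.val h1
  refine Nat.Coprime.coprime_dvd_left (orderOf_dvd_of_pow_eq_one h2) ?_
  rw [Nat.coprime_comm, Nat.Prime.coprime_iff_not_dvd hp.out]
  intro h3
  have h4 : p ∣ Fintype.card (IntermediateField.adjoin (ZMod p) {x}) := by
    rw [Module.card_eq_pow_finrank (K := ZMod p), ZMod.card]
    exact dvd_pow_self p Module.finrank_pos.ne'
  have h5 := (Nat.dvd_sub_iff_right (Fintype.card_pos) h4).1 h3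
  exact hp.out.one_lt.ne' (Nat.dvd_one.1 h5)

/-- A monic polynomial lifts to a monic polynomial over the algebraic integers; a root of the lift
is again an algebraic integer and can be reduced. -/
lemma isAlgClosed_of_surjective {Ω k : Type*} [Field Ω] [IsAlgClosed Ω] [Field k]
    (π : integralClosure ℤ Ω →+* k) (hπ : Function.Surjective π) : IsAlgClosed k := by
  refine IsAlgClosed.of_exists_root _ fun f hf hirr => ?_
  obtain ⟨g, hg, hdeg, hmon⟩ := Polynomial.lifts_and_degree_eq_and_monic
    (Polynomial.mem_lifts_of_surjective hπ f) hf
  have hne : (g.map (algebraMap (integralClosure ℤ Ω) Ω)).degree ≠ 0 := by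
    rw [hmon.degree_map, hdeg]
    exact hirr.degree_pos.ne'
  obtain ⟨x, hx⟩ := IsAlgClosed.exists_root _ hne
  have hint : IsIntegral (integralClosure ℤ Ω) x := ⟨g, hmon, by
    rwa [Polynomial.IsRoot, Polynomial.eval_map] at hx⟩
  have hx' : x ∈ integralClosure ℤ Ω := isIntegral_trans x hint
  refine ⟨π ⟨x, hx'⟩, ?_⟩
  rw [← hg, Polynomial.eval_map, Polynomial.eval₂_hom]
  convert map_zero π
  apply Subtype.ext
  rw [Polynomial.IsRoot, Polynomial.eval_map] at hx
  have h := Polynomial.hom_eval₂ g (RingHom.id _) (algebraMap (integralClosure ℤ Ω) Ω) ⟨x, hx'⟩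
  rw [RingHom.comp_id] at h
  exact h.trans hx

end Reduction

section Teichmuller

variable {Ω : Type*} [Field Ω] [Algebra ℚ Ω] [IsAlgClosure ℚ Ω] (p : ℕ) [hp : Fact p.Prime]
  (𝔓 : Ideal (integralClosure ℤ Ω)) [hprime : 𝔓.IsPrime] [hlies : 𝔓.LiesOver (Ideal.span {(p : ℤ)})]

omit [Algebra ℚ Ω] [IsAlgClosure ℚ Ω] in
include hp hlies in
lemma isMaximal_of_liesOver : 𝔓.IsMaximal := by
  have hmax : (Ideal.span {(p : ℤ)}).IsMaximal :=
    PrincipalIdealRing.isMaximal_of_irreducible (Nat.prime_iff_prime_int.1 hp.out).irreducible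
  refine Ideal.isMaximal_of_isIntegral_of_isMaximal_comap (R := ℤ) 𝔓 ?_
  rw [← Ideal.under_def, ← hlies.over]
  exact hmax

omit [Algebra ℚ Ω] [IsAlgClosure ℚ Ω] hprime hp in
include hlies in
lemma intCast_mem_iff (n : ℤ) : (n : integralClosure ℤ Ω) ∈ 𝔓 ↔ (p : ℤ) ∣ n := by
  rw [← Ideal.mem_span_singleton, hlies.over, Ideal.under_def, Ideal.mem_comap]
  rfl

omit [Algebra ℚ Ω] [IsAlgClosure ℚ Ω] hprime hp in
include hlies in
lemma charP_quotient : CharP (integralClosure ℤ Ω ⧸ 𝔓) p := by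
  refine ⟨fun n => ?_⟩
  have h := intCast_mem_iff p 𝔓 n
  rw [Int.natCast_dvd_natCast] at h
  rw [← h, ← Ideal.Quotient.eq_zero_iff_mem]
  simp

include hp hlies in
/-- The residue field of `𝔓`. -/
abbrev quotientField : Field (integralClosure ℤ Ω ⧸ 𝔓) :=
  have := isMaximal_of_liesOver p 𝔓
  Ideal.Quotient.field 𝔓

omit [Algebra ℚ Ω] [IsAlgClosure ℚ Ω] in
include hp hlies in
lemma orderOf_coprime {x : integralClosure ℤ Ω ⧸ 𝔓} (hx : x ≠ 0) : (orderOf x).Coprime p := by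
  let _ := quotientField p 𝔓
  have := charP_quotient p 𝔓
  refine orderOf_coprime_of_isIntegral p ?_ hx
  obtain ⟨a, rfl⟩ := Ideal.Quotient.mk_surjective x
  exact (integralClosure.isIntegral a).map (Ideal.Quotient.mkₐ ℤ 𝔓)

lemma surjOn_orderOf_coprime {x : integralClosure ℤ Ω ⧸ 𝔓} (hx : x ≠ 0) :
    ∃ ζ ∈ {ζ : integralClosure ℤ Ω | (orderOf ζ).Coprime p}, Ideal.Quotient.mk 𝔓 ζ = x := by
  let _ := quotientField p 𝔓
  have hcop := orderOf_coprime p 𝔓 hx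
  have hN := Nat.pos_of_ne_zero (orderOf_ne_zero_of_coprime hp.out hcop)
  have : IsAlgClosed Ω := IsAlgClosure.isAlgClosed ℚ
  have : CharZero Ω := algebraRat.charZero Ω
  have : NeZero (orderOf x) := ⟨hN.ne'⟩
  obtain ⟨ζ, hζ⟩ := HasEnoughRootsOfUnity.exists_primitiveRoot Ω (orderOf x)
  have hint : ζ ∈ integralClosure ℤ Ω := hζ.isIntegral hN
  have hζ' : IsPrimitiveRoot (⟨ζ, hint⟩ : integralClosure ℤ Ω) (orderOf x) :=
    IsPrimitiveRoot.of_map_of_injective (f := algebraMap (integralClosure ℤ Ω) Ω) hζ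
      Subtype.val_injective
  obtain ⟨y, hy, hyx⟩ := exists_lift_of_pow_eq_one (Ideal.Quotient.mk 𝔓) hN hζ'
    (pow_orderOf_eq_one x)
  exact ⟨y, Nat.Coprime.coprime_dvd_left (orderOf_dvd_of_pow_eq_one hy) hcop, hyx⟩

/-- The Teichmüller lift, with values in the ring of algebraic integers. -/
def teichInt (x : integralClosure ℤ Ω ⧸ 𝔓) : integralClosure ℤ Ω :=
  Function.invFunOn (Ideal.Quotient.mk 𝔓) {ζ : integralClosure ℤ Ω | (orderOf ζ).Coprime p} x

lemma teichInt_mem {x : integralClosure ℤ Ω ⧸ 𝔓} (hx : x ≠ 0) :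
    (orderOf (teichInt p 𝔓 x)).Coprime p :=
  Function.invFunOn_mem (surjOn_orderOf_coprime p 𝔓 hx)

lemma mk_teichInt {x : integralClosure ℤ Ω ⧸ 𝔓} (hx : x ≠ 0) :
    Ideal.Quotient.mk 𝔓 (teichInt p 𝔓 x) = x :=
  Function.invFunOn_eq (surjOn_orderOf_coprime p 𝔓 hx)

lemma teichInt_eq {x : integralClosure ℤ Ω ⧸ 𝔓} (hx : x ≠ 0) {ζ : integralClosure ℤ Ω}
    (hζ : (orderOf ζ).Coprime p) (h : Ideal.Quotient.mk 𝔓 ζ = x) : teichInt p 𝔓 x = ζ := by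
  let _ := quotientField p 𝔓
  have := charP_quotient p 𝔓
  exact injOn_orderOf_coprime (Ideal.Quotient.mk 𝔓) p hp.out (teichInt_mem p 𝔓 hx) hζ
    ((mk_teichInt p 𝔓 hx).trans h.symm)

open Classical in
/-- The Teichmüller lift extended by `0` at `0`, as a multiplicative map. -/
def teichHom : (integralClosure ℤ Ω ⧸ 𝔓) →*₀ Ω where
  toFun x := if x = 0 then 0 else teichmuller p 𝔓 x
  map_zero' := if_pos rfl
  map_one' := by
    have h1 : (1 : integralClosure ℤ Ω ⧸ 𝔓) ≠ 0 :=
      (Ideal.Quotient.zero_ne_one_iff.2 hprime.ne_top).symm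
    rw [if_neg h1]
    change ((teichInt p 𝔓 1 : integralClosure ℤ Ω) : Ω) = 1
    rw [teichInt_eq p 𝔓 h1 (ζ := 1) (by rw [orderOf_one]; exact Nat.coprime_one_left p)
      (map_one _)]
    rfl
  map_mul' x y := by
    by_cases hx : x = 0
    · simp [hx]
    by_cases hy : y = 0
    · simp [hy]
    have hxy : x * y ≠ 0 := mul_ne_zero hx hy
    rw [if_neg hx, if_neg hy, if_neg hxy]
    change ((teichInt p 𝔓 (x * y) : integralClosure ℤ Ω) : Ω) =
      (teichInt p 𝔓 x : integralClosure ℤ Ω) * (teichInt p 𝔓 y : integralClosure ℤ Ω)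
    rw [teichInt_eq p 𝔓 hxy (ζ := teichInt p 𝔓 x * teichInt p 𝔓 y)]
    · rfl
    · exact Nat.Coprime.coprime_dvd_left (Commute.orderOf_mul_dvd_mul_orderOf (Commute.all _ _))
        (Nat.Coprime.mul_left (teichInt_mem p 𝔓 hx) (teichInt_mem p 𝔓 hy))
    · rw [map_mul, mk_teichInt p 𝔓 hx, mk_teichInt p 𝔓 hy]

lemma teichHom_apply {x : integralClosure ℤ Ω ⧸ 𝔓} (hx : x ≠ 0) :
    teichHom p 𝔓 x = teichmuller p 𝔓 x := if_neg hx

lemma teichHom_injective : Function.Injective (teichHom p 𝔓) := by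
  have h0 : ∀ x, x ≠ 0 → teichHom p 𝔓 x ≠ 0 := by
    intro x hx h
    rw [teichHom_apply p 𝔓 hx] at h
    have h1 : teichInt p 𝔓 x = 0 := Subtype.ext h
    have h2 := mk_teichInt p 𝔓 hx
    rw [h1, map_zero] at h2
    exact hx h2.symm
  intro x y h
  by_cases hx : x = 0
  · subst hx
    by_contra hy
    rw [map_zero] at h
    exact h0 y (Ne.symm hy) h.symm
  by_cases hy : y = 0
  · subst hy
    rw [map_zero] at h
    exact absurd h (h0 x hx)
  rw [teichHom_apply p 𝔓 hx, teichHom_apply p 𝔓 hy] at h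
  have h1 : teichInt p 𝔓 x = teichInt p 𝔓 y := Subtype.ext h
  rw [← mk_teichInt p 𝔓 hx, h1, mk_teichInt p 𝔓 hy]

end Teichmuller

/-! ### The Jacobi sums `J(m)` -/

section JacobiSums

attribute [local instance] Ideal.Quotient.field

variable {Ω : Type*} [Field Ω] [Algebra ℚ Ω] [IsAlgClosure ℚ Ω] (p : ℕ) [hp : Fact p.Prime]
  (𝔓 : Ideal (integralClosure ℤ Ω)) [𝔓.IsMaximal] [𝔓.LiesOver (Ideal.span {(p : ℤ)})]
  {F : Type*} [Field F] [Fintype F] [Algebra F (integralClosure ℤ Ω ⧸ 𝔓)]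
  [IsAlgClosed (integralClosure ℤ Ω ⧸ 𝔓)]
  {d : ℕ} [NeZero d]

omit [Algebra ℚ Ω] [IsAlgClosure ℚ Ω] in
lemma quadChar_eq {k : Type*} [Field k] [Algebra F k] [IsAlgClosed k] (n : ℕ) [NeZero n]
    (x : extension F k n) :
    quadChar (Ω := Ω) (Fintype.card F ^ n) (x : k) = (quadChi (extension F k n) x : Ω) := by
  rw [quadChar]
  by_cases hx : x = 0
  · subst hx
    simp
  have hxk : (x : k) ≠ 0 := fun h => hx (Subtype.ext h)
  rw [if_neg hxk]
  split_ifs with h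
  · obtain ⟨y, hy, hyx⟩ := h
    have hy' : y ∈ extension F k n := mem_extension.2 hy
    rw [(quadChi_eq_one_iff hx).2 ⟨⟨y, hy'⟩, Subtype.ext hyx.symm⟩, Int.cast_one]
  · rw [quadChi_eq_neg_one_iff.2 ?_, Int.cast_neg, Int.cast_one]
    rintro ⟨y, hy⟩
    exact h ⟨y, mem_extension.1 y.2, (congrArg Subtype.val hy).symm⟩

omit [IsAlgClosed (integralClosure ℤ Ω ⧸ 𝔓)] in
lemma teichmullerChar_eq (m : ZMod d)
    (x : extension F (integralClosure ℤ Ω ⧸ 𝔓) (orbit (Fintype.card F) m).card) :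
    teichmullerChar p 𝔓 (Fintype.card F) m (x : integralClosure ℤ Ω ⧸ 𝔓) =
      (extChar F (teichHom p 𝔓) (orbit (Fintype.card F) m).card ^
        ((Fintype.card F ^ (orbit (Fintype.card F) m).card - 1) * m.val / d)) x := by
  rw [teichmullerChar]
  by_cases hx : x = 0
  · subst hx
    rw [MulChar.map_zero]
    exact if_pos rfl
  have hxk : (x : integralClosure ℤ Ω ⧸ 𝔓) ≠ 0 := fun h => hx (Subtype.ext h)
  rw [if_neg hxk, ← teichHom_apply p 𝔓 hxk]
  exact (MulChar.pow_apply_coe (extChar F (teichHom p 𝔓) _) _ (Units.mk0 x hx)).symm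

/-- J is formed with 1 - x and `jacSum` with x - 1; the factor χ(-1) disappears on squaring. -/
theorem J_sq (m : ZMod d) :
    J p 𝔓 (Fintype.card F) m ^ 2 =
      jacSq F (teichHom p 𝔓) (orbit (Fintype.card F) m).card m := by
  rw [jacSq, ← sq_eq_jacSum_sq, J, ← coe_extension, ← finsum_set_coe_eq_finsum_mem]
  congr 1
  refine (finsum_eq_sum_of_fintype (α := extension F (integralClosure ℤ Ω ⧸ 𝔓)
    (orbit (Fintype.card F) m).card) _).trans (Finset.sum_congr rfl fun x _ => ?_)
  rw [teichmullerChar_eq, ← quadChar_eq]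
  rfl

theorem J_sq_eq_of_mem_orbit (hF : ringChar F ≠ 2) (hdq : d.Coprime (Fintype.card F))
    {m x : ZMod d} (hx : x ∈ orbit (Fintype.card F) m) :
    J p 𝔓 (Fintype.card F) x ^ 2 = J p 𝔓 (Fintype.card F) m ^ 2 := by
  rw [J_sq, J_sq, jacSq_congr (teichHom p 𝔓) (congrArg Finset.card (orbit_eq_of_mem hdq hx)) x]
  obtain ⟨j, rfl⟩ := mem_orbit.1 hx
  clear hx
  induction j with
  | zero => rw [pow_zero, one_mul]
  | succ j ih =>
    rw [← ih, pow_succ', mul_assoc]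
    refine jacSq_mul hF _ _ _ ?_
    rw [mul_left_comm, (card_orbit_dvd_iff hdq m _).1 dvd_rfl]

-- An index is fixed by q^n exactly when its orbit size divides n. On such an orbit `jacSq_of_dvd`
-- makes all terms the same power of J².
open Classical in
theorem sum_jacSq (hF : ringChar F ≠ 2) (hdq : d.Coprime (Fintype.card F)) (n : ℕ) [NeZero n]
    (c : Finset (ZMod d) → Ω)
    (hc : ∀ m ∈ Z d, J p 𝔓 (Fintype.card F) m ^ 2 = c (orbit (Fintype.card F) m)) :
    ∑ m ∈ (Z d).filter (fun m => (Fintype.card F : ZMod d) ^ n * m = m),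
        jacSq F (teichHom p 𝔓) n m =
      ∑ o ∈ orbits (Fintype.card F) (Z d),
        if o.card ∣ n then (o.card : Ω) * c o ^ (n / o.card) else 0 := by
  have hodd : Odd (Fintype.card F) := Nat.odd_iff.2 (FiniteField.odd_card_of_char_ne_two hF)
  have : CharZero Ω := algebraRat.charZero Ω
  rw [← Finset.sum_fiberwise_of_maps_to (t := orbits (Fintype.card F) (Z d))
    (g := orbit (Fintype.card F)) fun m hm =>
      Finset.mem_image_of_mem _ (Finset.mem_filter.1 hm).1]
  refine Finset.sum_congr rfl fun o ho => ?_
  obtain ⟨m₀, hm₀, rfl⟩ := Finset.mem_image.1 ho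
  split_ifs with hdvd
  · have hset : ((Z d).filter (fun m => (Fintype.card F : ZMod d) ^ n * m = m)).filter
        (fun m => orbit (Fintype.card F) m = orbit (Fintype.card F) m₀) =
        orbit (Fintype.card F) m₀ := by
      ext x
      rw [Finset.mem_filter, Finset.mem_filter]
      constructor
      · rintro ⟨-, h⟩
        rw [← h]
        exact mem_orbit_self x
      · intro h
        have h1 := orbit_eq_of_mem hdq h
        refine ⟨⟨mem_Z_of_mem_orbit hdq hodd hm₀ h, ?_⟩, h1⟩
        rw [← card_orbit_dvd_iff hdq, h1]
        exact hdvd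
    rw [hset, Finset.sum_congr rfl (g := fun _ => c (orbit (Fintype.card F) m₀) ^
      (n / (orbit (Fintype.card F) m₀).card)), Finset.sum_const, nsmul_eq_mul]
    intro x hx
    have h1 := orbit_eq_of_mem hdq hx
    rw [jacSq_of_dvd hF (teichHom p 𝔓) (a := (orbit (Fintype.card F) x).card)
      (by rw [h1]; exact hdvd) x ((card_orbit_dvd_iff hdq x _).1 dvd_rfl), ← J_sq, h1,
      hc x (mem_Z_of_mem_orbit hdq hodd hm₀ hx), h1]
  · refine Finset.sum_eq_zero fun x hx => absurd ?_ hdvd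
    rw [Finset.mem_filter, Finset.mem_filter] at hx
    rw [← hx.2, card_orbit_dvd_iff hdq]
    exact hx.1.2

end JacobiSums

/-! ### The special value -/

section SpecialValue

open Polynomial

lemma one_sub_C_mul_X_eq {K : Type*} [Field K] {a : K} (ha : a ≠ 0) :
    (1 - C a * X : K[X]) = C (-a) * (X - C a⁻¹) := by
  rw [mul_sub, ← C_mul, neg_mul, mul_inv_cancel₀ ha]
  simp
  ring

/-- Root multiplicity and polynomial division are unchanged by extension of the field, so a
factorization over Ω determines ρ and the value over ℚ. -/
lemma specialValue_eq {Ω : Type*} [Field Ω] [Algebra ℚ Ω] {q : ℕ} (hq : q ≠ 0) (L : ℤ[X]) {r : ℕ}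
    {G : Polynomial Ω} (hL : L.map (Int.castRingHom Ω) = (1 - C (q : Ω) * X) ^ r * G)
    (hG : G.eval (q : Ω)⁻¹ ≠ 0) :
    algebraMap ℚ Ω (specialValue q L) = G.eval (q : Ω)⁻¹ := by
  have : CharZero Ω := algebraRat.charZero Ω
  have hq0 : (q : Ω) ≠ 0 := Nat.cast_ne_zero.2 hq
  set P : ℚ[X] := L.map (Int.castRingHom ℚ) with hP
  have hPΩ : P.map (algebraMap ℚ Ω) = (1 - C (q : Ω) * X) ^ r * G := by
    rw [hP, Polynomial.map_map, ← hL]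
    congr 1
    exact RingHom.ext_int _ _
  have hlin0 : (1 - C (q : Ω) * X : Polynomial Ω) ≠ 0 := by
    rw [one_sub_C_mul_X_eq hq0]
    exact mul_ne_zero (C_ne_zero.2 (neg_ne_zero.2 hq0)) (X_sub_C_ne_zero _)
  have hinv : algebraMap ℚ Ω (q : ℚ)⁻¹ = (q : Ω)⁻¹ := by simp
  have hr : P.rootMultiplicity (q : ℚ)⁻¹ = r := by
    rw [eq_rootMultiplicity_map (algebraMap ℚ Ω).injective, hinv, hPΩ, one_sub_C_mul_X_eq hq0,
      mul_pow, ← C_pow, mul_right_comm, mul_comm]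
    have h1 : C ((-(q : Ω)) ^ r) * G ≠ 0 := by
      refine mul_ne_zero (C_ne_zero.2 (pow_ne_zero _ (neg_ne_zero.2 hq0))) ?_
      rintro rfl
      simp at hG
    rw [rootMultiplicity_mul (mul_ne_zero (pow_ne_zero _ (X_sub_C_ne_zero _)) h1),
      rootMultiplicity_X_sub_C_pow, rootMultiplicity_eq_zero, add_zero]
    rw [IsRoot, eval_mul, eval_C]
    exact mul_ne_zero (pow_ne_zero _ (neg_ne_zero.2 hq0)) hG
  rw [specialValue]
  rw [← hP, hr, ← hinv, ← Polynomial.eval_map_apply, Polynomial.map_div, hPΩ]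
  rw [Polynomial.map_pow, Polynomial.map_sub, Polynomial.map_one, Polynomial.map_mul,
    Polynomial.map_C, Polynomial.map_X, map_natCast (algebraMap ℚ Ω)]
  rw [mul_div_cancel_left₀ _ (pow_ne_zero r hlin0)]

end SpecialValue

/-! ### The logarithmic derivative of the global Euler product. -/

section EulerProduct

variable {R : Type*} [CommRing R]

lemma hasDLog_one_sub_C_mul_X_pow (c : R) {a : ℕ} (ha : a ≠ 0) :
    HasDLog (1 - PowerSeries.C c * PowerSeries.X ^ a)
      (PowerSeries.mk fun n => if n ≠ 0 ∧ a ∣ n then -((a : R) * c ^ (n / a)) else 0) := by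
  have h := (hasDLog_one_sub_C_mul_X c).expand a ha
  convert h using 1
  · rw [map_sub, map_one, map_mul, PowerSeries.expand_C, PowerSeries.expand_X]
  · ext n
    rw [PowerSeries.coeff_mk, ← map_natCast (PowerSeries.C (R := R)), PowerSeries.coeff_C_mul,
      PowerSeries.coeff_expand]
    by_cases hdvd : a ∣ n
    · obtain ⟨b, rfl⟩ := hdvd
      by_cases hb : b = 0
      · simp [hb]
      · simp [ha, hb, Nat.mul_div_cancel_left b (Nat.pos_of_ne_zero ha)]
    · simp [hdvd]

lemma HasDLog.coeff_zero {A s : R⟦X⟧} (h : HasDLog A s) (h0 : PowerSeries.constantCoeff A = 1) :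
    PowerSeries.coeff 0 s = 0 := by
  have h1 := congrArg PowerSeries.constantCoeff h
  rw [map_mul, map_mul, h0, PowerSeries.constantCoeff_X, zero_mul, one_mul] at h1
  rw [PowerSeries.coeff_zero_eq_constantCoeff_apply, ← h1]

variable (F : Type*) [Field F] [Fintype F] (d : ℕ)

/-- The logarithmic derivatives of the Euler factors of `E_d`. -/
def eulerSeries : Option (MonicIrr F) → ℤ⟦X⟧
  | none => PowerSeries.mk fun n => if Even d ∧ n ≠ 0 then 1 else 0
  | some P => -((P.1.natDegree : ℤ⟦X⟧) *
      PowerSeries.expand P.1.natDegree P.2.2.natDegree_pos.ne' (finiteSeries d P))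

open Classical in
/-- The places of `F(t)` of degree at most `n`, and the place at infinity. -/
def placesLE (n : ℕ) : Finset (Option (MonicIrr F)) :=
  Finset.insertNone ((irrLE F n).subtype fun P => P.Monic ∧ Irreducible P)

variable {F d}

lemma hasDLog_eulerSeries (hF : ringChar F ≠ 2) (hd : d ≠ 0) (i : Option (MonicIrr F)) :
    HasDLog (eulerFactor (Fintype.card F) (legendreCurve F d) (placeEquiv F i))
      (eulerSeries F d i) := by
  cases i with
  | none => exact hasDLog_eulerFactor_inftyPlace hF hd
  | some P => exact hasDLog_eulerFactor_finitePlace hF hd P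

lemma coeff_eulerSeries_some (P : MonicIrr F) (n : ℕ) :
    PowerSeries.coeff n (eulerSeries F d (some P)) =
      if P.1.natDegree ∣ n then -((P.1.natDegree : ℤ) *
        PowerSeries.coeff (n / P.1.natDegree) (finiteSeries d P)) else 0 := by
  rw [eulerSeries, map_neg, ← map_natCast (PowerSeries.C (R := ℤ)), PowerSeries.coeff_C_mul,
    PowerSeries.coeff_expand]
  split_ifs <;> simp

lemma coeff_eulerSeries_eq_zero (hF : ringChar F ≠ 2) (hd : d ≠ 0) {n : ℕ}
    {i : Option (MonicIrr F)} (hi : i ∉ placesLE F n) {j : ℕ} (hj : j ≤ n) :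
    PowerSeries.coeff j (eulerSeries F d i) = 0 := by
  classical
  cases i with
  | none => exact absurd Finset.none_mem_insertNone hi
  | some P =>
    by_cases hj0 : j = 0
    · rw [hj0]
      exact (hasDLog_eulerSeries hF hd (some P)).coeff_zero (constantCoeff_eulerFactor _ _ _)
    rw [coeff_eulerSeries_some, if_neg]
    intro hdvd
    refine hi (Finset.some_mem_insertNone.2 (Finset.mem_subtype.2 (mem_irrLE.2 ⟨P.2.1, P.2.2, ?_⟩)))
    exact (Nat.le_of_dvd (Nat.pos_of_ne_zero hj0) hdvd).trans hj

/-- Grouping the elements of `L` by minimal polynomial, the place of `P` occurs deg P times, which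
is the factor from substituting T^(deg P) in its Euler factor. -/
theorem sum_coeff_eulerSeries (hF : ringChar F ≠ 2) (n : ℕ) [NeZero n] {L : Type*} [Field L]
    [Fintype L] [Algebra F L] (hL : Module.finrank F L = n) :
    ∑ i ∈ placesLE F n, PowerSeries.coeff n (eulerSeries F d i) =
      (if Even d then 1 else 0) - ∑ x : L, legSum L (x ^ d) := by
  classical
  let g : F[X] → ℤ := fun P => if h : P.Monic ∧ Irreducible P then
    PowerSeries.coeff (n / P.natDegree) (finiteSeries d (⟨P, h⟩ : MonicIrr F)) else 0
  have h1 : ∑ x : L, legSum L (x ^ d) = ∑ P ∈ irrDvd F n, (P.natDegree : ℤ) * g P := by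
    rw [← hL, ← sum_minpoly (L := L) g]
    refine Finset.sum_congr rfl fun x _ => ?_
    have hint : IsIntegral F x := Algebra.IsIntegral.isIntegral x
    have hP : (minpoly F x).Monic ∧ Irreducible (minpoly F x) :=
      ⟨minpoly.monic hint, minpoly.irreducible hint⟩
    simp only [g]
    rw [dif_pos hP, ← coeff_finiteSeries hF d ⟨minpoly F x, hP⟩ x (minpoly.aeval F x), hL]
  have h2 : ∀ P : {P : F[X] // P.Monic ∧ Irreducible P},
      PowerSeries.coeff n (eulerSeries F d (some P)) =
      (fun P : F[X] => if P.natDegree ∣ n then -((P.natDegree : ℤ) * g P) else 0) P.1 := by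
    intro P
    rw [coeff_eulerSeries_some]
    simp only [g]
    rw [dif_pos P.2]
  have h3 : ∑ P ∈ (irrLE F n).subtype (fun P => P.Monic ∧ Irreducible P),
      PowerSeries.coeff n (eulerSeries F d (some P)) =
      -∑ P ∈ irrDvd F n, (P.natDegree : ℤ) * g P := by
    rw [Finset.sum_congr rfl fun P _ => h2 P, Finset.sum_subtype_of_mem
      (fun P : F[X] => if P.natDegree ∣ n then -((P.natDegree : ℤ) * g P) else 0)
      fun P hP => ⟨(mem_irrLE.1 hP).1, (mem_irrLE.1 hP).2.1⟩, ← Finset.sum_filter,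
      Finset.sum_neg_distrib]
    rfl
  rw [placesLE, Finset.sum_insertNone, h1]
  refine (congrArg₂ _ ?_ h3).trans (sub_eq_add_neg _ _).symm
  rw [eulerSeries, PowerSeries.coeff_mk]
  simp [NeZero.ne n]

end EulerProduct

/-! ### The `L`-function as a polynomial -/

section LFunction

open Polynomial

lemma nonempty_ringHom_of_charP (F k : Type*) [Field F] [Fintype F] [Field k] [IsAlgClosed k]
    (p : ℕ) [Fact p.Prime] [CharP F p] [CharP k p] : Nonempty (F →+* k) := by
  let _ : Algebra (ZMod p) F := ZMod.algebra F p
  let _ : Algebra (ZMod p) k := ZMod.algebra k p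
  exact ⟨(IsAlgClosed.lift : F →ₐ[ZMod p] k).toRingHom⟩

lemma card_pos_of_mem_orbits {q d : ℕ} [NeZero d] {A : Finset (ZMod d)} {o : Finset (ZMod d)}
    (ho : o ∈ orbits q A) : 0 < o.card := by
  classical
  obtain ⟨m, -, rfl⟩ := Finset.mem_image.1 ho
  exact card_orbit_pos m

/-- Integrality comes from the Euler product and finiteness from the product over orbits in Ω; ℤ
embeds in `R`, so both hold for one polynomial. -/
lemma exists_polynomial_of_map_eq {R : Type*} [CommRing R] [CharZero R] (f : ℤ⟦X⟧) (P : R[X])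
    (h : PowerSeries.map (Int.castRingHom R) f = P.toPowerSeries) :
    ∃ L : ℤ[X], L.toPowerSeries = f ∧ L.map (Int.castRingHom R) = P := by
  have hcoeff : ∀ n, ((PowerSeries.coeff n f : ℤ) : R) = P.coeff n := fun n => by
    rw [← Polynomial.coeff_coe, ← h, PowerSeries.coeff_map]
    rfl
  have hL : (f.trunc (P.natDegree + 1)).toPowerSeries = f := by
    ext n
    rw [Polynomial.coeff_coe, PowerSeries.coeff_trunc]
    split_ifs with hn
    · rfl
    · have h1 := hcoeff n
      rw [Polynomial.coeff_eq_zero_of_natDegree_lt (by omega)] at h1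
      exact (Int.cast_eq_zero.1 h1).symm
  refine ⟨_, hL, ?_⟩
  ext n
  rw [Polynomial.coeff_map, ← Polynomial.coeff_coe, hL, ← hcoeff]
  rfl

attribute [local instance] Ideal.Quotient.field

variable {Ω : Type*} [Field Ω] [Algebra ℚ Ω] [IsAlgClosure ℚ Ω] (p : ℕ) [hp : Fact p.Prime]
  (𝔓 : Ideal (integralClosure ℤ Ω)) [𝔓.IsMaximal] [𝔓.LiesOver (Ideal.span {(p : ℤ)})]
  {F : Type*} [Field F] [Fintype F] [Algebra F (integralClosure ℤ Ω ⧸ 𝔓)]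
  [IsAlgClosed (integralClosure ℤ Ω ⧸ 𝔓)]
  {d : ℕ} [NeZero d]

open scoped PowerSeries.WithPiTopology in
theorem exists_hasLFunction (hF : ringChar F ≠ 2) (hd : 2 ≤ d) (hdq : d.Coprime (Fintype.card F))
    (c : Finset (ZMod d) → Ω)
    (hc : ∀ m ∈ Z d, J p 𝔓 (Fintype.card F) m ^ 2 = c (orbit (Fintype.card F) m)) :
    ∃ L : ℤ[X], HasLFunction (Fintype.card F) (legendreCurve F d) L.toPowerSeries ∧
      L.map (Int.castRingHom Ω) =
        ∏ o ∈ orbits (Fintype.card F) (Z d), (1 - C (c o) * X ^ o.card) := by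
  classical
  have : CharZero Ω := algebraRat.charZero Ω
  have hd0 : d ≠ 0 := by omega
  set Orb := orbits (Fintype.card F) (Z d) with hOrb
  have hP : (∏ o ∈ Orb, (1 - C (c o) * X ^ o.card : Polynomial Ω)).toPowerSeries =
      ∏ o ∈ Orb, (1 - PowerSeries.C (c o) * PowerSeries.X ^ o.card) := by
    rw [← Polynomial.coeToPowerSeries.ringHom_apply, map_prod]
    refine Finset.prod_congr rfl fun o _ => ?_
    simp
  have hτ := HasDLog.prod Orb (A := fun o => 1 - PowerSeries.C (c o) * PowerSeries.X ^ o.card)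
    (fun o ho => hasDLog_one_sub_C_mul_X_pow (c o) (card_pos_of_mem_orbits ho).ne')
  have hconst : PowerSeries.constantCoeff
      (∏ o ∈ Orb, (1 - PowerSeries.C (c o) * PowerSeries.X ^ o.card)) = 1 := by
    rw [map_prod]
    refine Finset.prod_eq_one fun o ho => ?_
    simp [(card_pos_of_mem_orbits ho).ne']
  have hexists := exists_hasProd_of_hasDLog
    (f := fun i => eulerFactor (Fintype.card F) (legendreCurve F d) (placeEquiv F i))
    (fun i => hasDLog_eulerSeries hF hd0 i) (fun i => constantCoeff_eulerFactor _ _ _)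
    (placesLE F) (fun n i hi j hj => coeff_eulerSeries_eq_zero hF hd0 hi hj) hτ hconst
  obtain ⟨L₀, hL₀, hprod⟩ := hexists (by
      intro n
      rw [map_sum]
      simp only [PowerSeries.coeff_mk]
      by_cases hn : n = 0
      · subst hn
        rw [Finset.sum_eq_zero fun i _ =>
          (hasDLog_eulerSeries hF hd0 i).coeff_zero (constantCoeff_eulerFactor _ _ _)]
        simp
      have : NeZero n := ⟨hn⟩
      have h1 := sum_coeff_eulerSeries (d := d) hF n
        (L := extension F (integralClosure ℤ Ω ⧸ 𝔓) n) (finrank_extension n)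
      -- The term at infinity cancels the contribution of m = d/2, so only the orbits in `Z d` are
      -- left.
      rw [h1, Int.cast_sub, sum_legSum_extension hF (teichHom_injective p 𝔓) hd n,
        sum_jacSq p 𝔓 hF hdq n c hc]
      have h2 : ∀ o : Finset (ZMod d), (if n ≠ 0 ∧ o.card ∣ n then
          -((o.card : Ω) * c o ^ (n / o.card)) else 0) =
          -(if o.card ∣ n then (o.card : Ω) * c o ^ (n / o.card) else 0) := fun o => by
        by_cases h : o.card ∣ n
        · rw [if_pos ⟨hn, h⟩, if_pos h]
        · rw [if_neg fun h' => h h'.2, if_neg h, neg_zero]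
      rw [Finset.sum_congr rfl fun o _ => h2 o, Finset.sum_neg_distrib]
      push_cast
      ring)
  obtain ⟨L, hL, hLmap⟩ := exists_polynomial_of_map_eq L₀ _ (hL₀.trans hP.symm)
  refine ⟨L, ?_, hLmap⟩
  rw [HasLFunction, hL]
  exact (Equiv.hasProd_iff (placeEquiv F)).1 hprod

variable (rep : Finset (ZMod d) → ZMod d)

theorem exists_specialValue (hF : ringChar F ≠ 2) (hd : 2 ≤ d)
    (hdq : d.Coprime (Fintype.card F))
    (hrep : ∀ o ∈ orbits (Fintype.card F) (Z d), rep o ∈ o) :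
    ∃ L : ℤ[X], HasLFunction (Fintype.card F) (legendreCurve F d) L.toPowerSeries ∧
      algebraMap ℚ Ω (specialValue (Fintype.card F) L) =
        (∏ o ∈ orbits (Fintype.card F) (V p 𝔓 (Fintype.card F) d), (o.card : Ω)) *
        ∏ o ∈ orbits (Fintype.card F) (S p 𝔓 (Fintype.card F) d),
          (1 - J p 𝔓 (Fintype.card F) (rep o) ^ 2 / ((Fintype.card F : ℕ) : Ω) ^ o.card) := by
  classical
  have : CharZero Ω := algebraRat.charZero Ω
  set q := Fintype.card F with hq
  have hq0 : (q : Ω) ≠ 0 := Nat.cast_ne_zero.2 Fintype.card_ne_zero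
  have hc : ∀ m ∈ Z d, J p 𝔓 q m ^ 2 = J p 𝔓 q (rep (orbit q m)) ^ 2 := fun m hm =>
    (J_sq_eq_of_mem_orbit p 𝔓 hF hdq (hrep _ (Finset.mem_image_of_mem _ hm))).symm
  obtain ⟨L, hL, hLmap⟩ := exists_hasLFunction p 𝔓 hF hd hdq (fun o => J p 𝔓 q (rep o) ^ 2) hc
  refine ⟨L, hL, ?_⟩
  set G : Polynomial Ω := (∏ o ∈ orbits q (V p 𝔓 q d),
      ∑ i ∈ Finset.range o.card, (C (q : Ω) * X) ^ i) *
    ∏ o ∈ orbits q (S p 𝔓 q d), (1 - C (J p 𝔓 q (rep o) ^ 2) * X ^ o.card) with hG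
  -- J² is constant on orbits, so `V` and `S` are unions of orbits and no factor is counted twice.
  have hVS : ∀ m ∈ Z d, ∀ m' ∈ Z d, orbit q m = orbit q m' → m ∈ V p 𝔓 q d → m' ∈ V p 𝔓 q d := by
    intro m hm m' hm' h hV
    rw [V, Finset.mem_filter] at hV ⊢
    refine ⟨hm', ?_⟩
    rw [hc m' hm', ← h, ← hc m hm]
    exact hV.2
  have hVZ : V p 𝔓 q d ⊆ Z d := Finset.filter_subset _ _
  have hdisj : Disjoint (orbits q (V p 𝔓 q d)) (orbits q (S p 𝔓 q d)) := by
    rw [Finset.disjoint_left]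
    intro o h1 h2
    obtain ⟨m, hm, rfl⟩ := Finset.mem_image.1 h1
    obtain ⟨m', hm', h⟩ := Finset.mem_image.1 h2
    rw [S, Finset.mem_sdiff] at hm'
    exact hm'.2 (hVS m (hVZ hm) m' hm'.1 h.symm hm)
  have hunion : orbits q (Z d) = orbits q (V p 𝔓 q d) ∪ orbits q (S p 𝔓 q d) := by
    rw [orbits, orbits, orbits, ← Finset.image_union, S, Finset.union_sdiff_of_subset hVZ]
  have hfactor : L.map (Int.castRingHom Ω) =
      (1 - C (q : Ω) * X) ^ (orbits q (V p 𝔓 q d)).card * G := by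
    rw [hLmap, hunion, Finset.prod_union hdisj, hG, ← mul_assoc, ← Finset.prod_const,
      ← Finset.prod_mul_distrib]
    congr 1
    refine Finset.prod_congr rfl fun o ho => ?_
    obtain ⟨m, hm, rfl⟩ := Finset.mem_image.1 ho
    rw [← hc m (hVZ hm), (Finset.mem_filter.1 hm).2, mul_neg_geom_sum, mul_pow, C_pow]
  have hGeval : G.eval (q : Ω)⁻¹ = (∏ o ∈ orbits q (V p 𝔓 q d), (o.card : Ω)) *
      ∏ o ∈ orbits q (S p 𝔓 q d), (1 - J p 𝔓 q (rep o) ^ 2 / (q : Ω) ^ o.card) := by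
    rw [hG, eval_mul, eval_prod, eval_prod]
    congr 1
    · refine Finset.prod_congr rfl fun o _ => ?_
      rw [eval_finsetSum, Finset.sum_congr rfl (g := fun _ => (1 : Ω))]
      · simp
      · intro i _
        rw [eval_pow, eval_mul, eval_C, eval_X, mul_inv_cancel₀ hq0, one_pow]
    · refine Finset.prod_congr rfl fun o _ => ?_
      rw [eval_sub, eval_one, eval_mul, eval_C, eval_pow, eval_X, inv_pow, div_eq_mul_inv]
  rw [← hGeval]
  refine specialValue_eq Fintype.card_ne_zero L hfactor ?_
  rw [hGeval]
  refine mul_ne_zero (Finset.prod_ne_zero_iff.2 fun o ho =>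
    Nat.cast_ne_zero.2 (card_pos_of_mem_orbits ho).ne') (Finset.prod_ne_zero_iff.2 fun o ho => ?_)
  obtain ⟨m, hm, rfl⟩ := Finset.mem_image.1 ho
  rw [S, Finset.mem_sdiff] at hm
  intro h
  refine hm.2 ?_
  rw [V, Finset.mem_filter]
  refine ⟨hm.1, ?_⟩
  rw [hc m hm.1]
  exact ((div_eq_one_iff_eq (pow_ne_zero _ hq0)).1 (sub_eq_zero.1 h).symm)

end LFunction

end LegendreLValue

end

/-- `rep` is an arbitrary choice of representatives of the orbits of `q` on `Z d`. -/
theorem mainTheorem7 {F : Type*} [Field F] [Fintype F] (p : ℕ) [Fact p.Prime] [CharP F p]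
    (hp : p ≠ 2) (q : ℕ) (hq : q = Fintype.card F)
    {Ω : Type*} [Field Ω] [Algebra ℚ Ω] [IsAlgClosure ℚ Ω]
    (𝔓 : Ideal (integralClosure ℤ Ω)) [𝔓.IsPrime] [𝔓.LiesOver (Ideal.span {(p : ℤ)})]
    (d : ℕ) [NeZero d] (hd : 2 ≤ d) (hdq : d.Coprime q)
    (rep : Finset (ZMod d) → ZMod d)
    (hrep : ∀ o ∈ LegendreLValue.orbits q (LegendreLValue.Z d), rep o ∈ o) :
    ∃ L : Polynomial ℤ,
      LegendreLValue.HasLFunction q (LegendreLValue.legendreCurve F d) L.toPowerSeries ∧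
      algebraMap ℚ Ω (LegendreLValue.specialValue q L) =
        (∏ o ∈ LegendreLValue.orbits q (LegendreLValue.V p 𝔓 q d), (o.card : Ω)) *
        ∏ o ∈ LegendreLValue.orbits q (LegendreLValue.S p 𝔓 q d),
          (1 - LegendreLValue.J p 𝔓 q (rep o) ^ 2 / (q : Ω) ^ o.card) := by
  subst hq
  have hmax : 𝔓.IsMaximal := LegendreLValue.isMaximal_of_liesOver p 𝔓
  let _ : Field (integralClosure ℤ Ω ⧸ 𝔓) := Ideal.Quotient.field 𝔓
  have : CharP (integralClosure ℤ Ω ⧸ 𝔓) p := LegendreLValue.charP_quotient p 𝔓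
  have : IsAlgClosed Ω := IsAlgClosure.isAlgClosed ℚ
  have : IsAlgClosed (integralClosure ℤ Ω ⧸ 𝔓) :=
    LegendreLValue.isAlgClosed_of_surjective (Ideal.Quotient.mk 𝔓) Ideal.Quotient.mk_surjective
  -- Any embedding of `F` into the residue field will do, since J refers to `F` only through q.
  obtain ⟨φ⟩ := LegendreLValue.nonempty_ringHom_of_charP F (integralClosure ℤ Ω ⧸ 𝔓) p
  let _ : Algebra F (integralClosure ℤ Ω ⧸ 𝔓) := φ.toAlgebra
  have hF : ringChar F ≠ 2 := by rwa [ringChar.eq F p]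
  exact LegendreLValue.exists_specialValue p 𝔓 rep hF hd hdq hrep
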